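/- Let $n\ge 0$ and let $B^n$ be the set of crossingless matchings of $2n$ points on the line $\{0\}\times\mathbb R$ (arcs drawn in the right half plane); let $W$ denote reflection to the left half plane. Khovanov's arc algebra $H^n$ has the $\mathbb Z$-basis of all $(W(a)b,\sigma)$, where $a,b\in B^n$ and $\sigma$ labels each circle of $W(a)b$ by $+$ or $-$. The product $(W(a)b,\sigma)(W(b')c,\tau)$ is $0$ for $b\ne b'$; for $b=b'$ it is given by the minimal cobordism (one saddle for every arc of $b$) from $W(a)b\sqcup W(b)c$ to $W(a)c$ under the 2-dimensional TQFT of the Frobenius algebra $\mathbb Z[X]/(X^2)$, $\Delta(1)=1\otimes X+X\otimes 1$, $\varepsilon(1)=0$, $\varepsilon(X)=1$, with $+=1$, $-=X$. The degree of $(W(a)b,\sigma)$ is $n-\#\{\text{circles}\}+2\cdot\#\{\text{minus signs}\}$. The degree-zero part is the idempotent ring $I_n\cong\mathbb Z^{B^n}$, with elementary idempotents $1_a=(W(a)a,\text{all plus})$, and projection onto it is the augmentation $H^n\to I_n$. A bridge $\gamma$ on $a\in B^n$ is, up to isotopy, a curve in the half plane joining two distinct arcs of $a$ whose interior misses $a$;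 surgery of $a$ along $\gamma$ gives $a_\gamma\in B^n$. Put $h_\gamma=(W(a)a_\gamma,\text{all plus})$. For an arc $\alpha$ of $a$ put $h_\alpha=(W(a)a,\text{minus exactly on the circle }W(\alpha)\alpha)$. Let $V$ be the free $\mathbb Z$-module on all $h_\gamma$ and $h_\alpha$, with its left and right $I_n$-actions, let $T(V)$ be its tensor algebra over $I_n$, let $J$ be the kernel of the natural map $T(V)\to H^n$, and let $J_2=J\cap(V\oplus V\otimes_{I_n}V)$. Theorem. $H^n$ is an associative unital algebra over $I_n$, the augmentation is a homomorphism of $I_n$-algebras which vanishes on all $h_\gamma$ and $h_\alpha$, and, with these generators and this augmentation, $H^n$ is a linear-quadratic algebra: the natural map $T(V)\to H^n$ is surjective, $J=T(V)\cdot J_2\cdot T(V)$, and $J\cap V=0$. Moreover, $J_2$ is the additive group generated by the following elements: 1. $h_\gamma h_{\eta'}-h_\eta h_{\gamma'}$ for distinct bridges $\gamma,\eta$ drawn without intersection on the same $a\in B^n$, where $\eta'$ is the bridge on $a_\gamma$ given by $\eta$ and $\gamma'$ is the bridge on $a_\eta$ given by $\gamma$ (if $\gamma$ and $\eta$ end on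 a common arc from opposite sides, there are two ways to draw them and both give elements); 2. $h_\gamma h_{\alpha'}-h_\alpha h_\gamma$ for a bridge $\gamma$ on $a$, an arc $\alpha$ of $a$, and an arc $\alpha'$ of $a_\gamma$ sharing an endpoint with $\alpha$ (so $\alpha'=\alpha$ unless $\gamma$ ends on $\alpha$, in which case there are two choices); 3. $h_{\alpha_1}h_{\alpha_2}-h_{\alpha_2}h_{\alpha_1}$ for arcs $\alpha_1,\alpha_2$ of the same $a$, and $h_\alpha^2$ for every arc $\alpha$; 4. $h_\gamma h_{\gamma^\dagger}-h_{\alpha_1}-h_{\alpha_2}$ for every bridge $\gamma$, where $\gamma^\dagger$ is the dual bridge on $a_\gamma$, which reverses the surgery on $\gamma$, and $\alpha_1,\alpha_2$ are the arcs joined by $\gamma$. Hence the natural map induces an isomorphism $T(V)/(J_2)\cong H^n$, where the two-sided ideal $(J_2)$ is generated by the elements 1–4. -/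

import Mathlib

open scoped Classical

noncomputable section

namespace KhovanovArc

/-! ### Crossingless matchings, arcs, bridges, surgery -/

/-- A crossingless matching of `2n` points on a line, given by the involution exchanging the two
endpoints of every arc. -/
@[ext]
structure Matching (n : ℕ) where
  partner : Fin (2 * n) → Fin (2 * n)
  partner_partner : ∀ i, partner (partner i) = i
  partner_ne : ∀ i, partner i ≠ i
  noncrossing : ∀ i j, ¬ (i < j ∧ j < partner i ∧ partner i < partner j)

instance (n : ℕ) : Finite (Matching n) :=
  Finite.of_injective Matching.partner (fun _ _ h => Matching.ext h)

instance (n : ℕ) : Fintype (Matching n) := Fintype.ofFinite _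

variable {n : ℕ}

/-- The arcs of `a`, named by their smaller endpoints. -/
def Arc (a : Matching n) : Type := {i : Fin (2 * n) // i < a.partner i}

namespace Arc

variable {a : Matching n}

/-- The smaller endpoint of an arc. -/
def left (α : Arc a) : Fin (2 * n) := α.1

/-- The larger endpoint of an arc. -/
def right (α : Arc a) : Fin (2 * n) := a.partner α.1

/-- The arc `ε` encloses the arc `δ`. -/
def Encloses (ε δ : Arc a) : Prop := ε.left < δ.left ∧ δ.right < ε.right

end Arc

/-- The arc of `a` one of whose endpoints is `i`. -/
def arcThrough (a : Matching n) (i : Fin (2 * n)) : Arc a :=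
  if h : i < a.partner i then ⟨i, h⟩
  else ⟨a.partner i, by
    rw [a.partner_partner]
    exact lt_of_le_of_ne (not_lt.mp h) (a.partner_ne i)⟩

/-- A bridge on `a`, up to isotopy: an (unordered) pair of distinct arcs of `a` which can be
connected by a curve in the half plane whose interior misses all arcs of `a`, that is, such that
no other arc of `a` separates the two. -/
@[ext]
structure Bridge (a : Matching n) where
  fst : Arc a
  snd : Arc a
  lt : fst.left < snd.left
  adjacent : ∀ ε : Arc a, ε ≠ fst → ε ≠ snd → (ε.Encloses fst ↔ ε.Encloses snd)

/-- The two arcs connected by `γ` are the arc through `i` and the arc through `j`. -/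
def Bridge.Joins {a : Matching n} (γ : Bridge a) (i j : Fin (2 * n)) : Prop :=
  (γ.fst = arcThrough a i ∧ γ.snd = arcThrough a j) ∨
    (γ.fst = arcThrough a j ∧ γ.snd = arcThrough a i)

/-- The effect of surgery on the involution `f`, for arcs with smaller endpoints `i < j`:
if `i < f i < j < f j`, the arcs `{i, f i}`, `{j, f j}` are replaced by `{i, f j}`, `{f i, j}`;
if `i < j < f j < f i`, they are replaced by `{i, j}`, `{f j, f i}`. -/
def surgeryFun {m : ℕ} (f : Fin m → Fin m) (i j k : Fin m) : Fin m :=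
  if f i < j then
    if k = i then f j
    else if k = f j then i
    else if k = f i then j
    else if k = j then f i
    else f k
  else
    if k = i then j
    else if k = j then i
    else if k = f i then f j
    else if k = f j then f i
    else f k

theorem surgeryFun_noncrossing {m : ℕ} (f : Fin m → Fin m) (h0 : ∀ i, f (f i) = i)
    (ne : ∀ i, f i ≠ i) (nc : ∀ i j, ¬ (i < j ∧ j < f i ∧ f i < f j)) (i j : Fin m)
    (hi : i < f i) (hj : j < f j) (lt : i < j)
    (key : ∀ k, k < f k → k ≠ i → k ≠ j → ((k < i ∧ f i < f k) ↔ (k < j ∧ f j < f k)))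
    (k l : Fin m) :
    ¬ (k < l ∧ l < surgeryFun f i j k ∧ surgeryFun f i j k < surgeryFun f i j l) := by
  unfold surgeryFun
  have a1 := h0 i
  have a2 := h0 j
  have a3 := h0 k
  have a4 := h0 l
  have b1 := ne k
  have b2 := ne l
  have k1 := key k
  have k2 := key l
  have k3 := key (f k)
  have k4 := key (f l)
  have c1 := nc k l
  have c2 := nc k i
  have c3 := nc k j
  have c4 := nc l i
  have c5 := nc l j
  have c6 := nc i k
  have c7 := nc j k
  have c8 := nc i l
  have c9 := nc j l
  have d1 := nc i (f k)
  have d2 := nc j (f k)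
  have d3 := nc i (f l)
  have d4 := nc j (f l)
  have d5 := nc (f k) i
  have d6 := nc (f k) j
  have d7 := nc (f l) i
  have d8 := nc (f l) j
  have e1 := nc i j
  rw [a3] at d1 d2 d5 d6 k3
  rw [a4] at d3 d4 d7 d8 k4
  clear h0 nc ne key
  split_ifs <;> grind

/-- The crossingless matching `a_γ` obtained from `a` by surgery along the bridge `γ`. -/
def surger {a : Matching n} (γ : Bridge a) : Matching n where
  partner := surgeryFun a.partner γ.fst.left γ.snd.left
  partner_partner := by
    intro k
    have lt := γ.lt
    have hi := γ.fst.2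
    have hj := γ.snd.2
    change γ.fst.left < a.partner γ.fst.left at hi
    change γ.snd.left < a.partner γ.snd.left at hj
    have h1 := a.partner_partner γ.fst.left
    have h2 := a.partner_partner γ.snd.left
    have h3 := a.partner_partner k
    unfold surgeryFun
    grind
  partner_ne := by
    intro k
    have lt := γ.lt
    have hi := γ.fst.2
    have hj := γ.snd.2
    change γ.fst.left < a.partner γ.fst.left at hi
    change γ.snd.left < a.partner γ.snd.left at hj
    have h1 := a.partner_partner γ.fst.left
    have h2 := a.partner_partner γ.snd.left
    have h3 := a.partner_ne k
    unfold surgeryFun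
    grind
  noncrossing := surgeryFun_noncrossing a.partner a.partner_partner a.partner_ne a.noncrossing
    γ.fst.left γ.snd.left γ.fst.2 γ.snd.2 γ.lt
    (fun k hk h1 h2 => γ.adjacent ⟨k, hk⟩ (fun h => h1 (congrArg Subtype.val h))
      (fun h => h2 (congrArg Subtype.val h)))

/-! ### Circles, the arc algebra -/

/-- The equivalence relation on the `2n` points generated by the arcs of the matchings in `S`. -/
def joinSetoid (S : Set (Matching n)) : Setoid (Fin (2 * n)) :=
  Relation.EqvGen.setoid (fun i j => ∃ m ∈ S, m.partner i = j)

/-- The connected components of the union of the matchings in `S`. -/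
def Components (S : Set (Matching n)) : Type := Quotient (joinSetoid S)

instance (S : Set (Matching n)) : Finite (Components S) :=
  inferInstanceAs (Finite (Quotient (joinSetoid S)))

instance (S : Set (Matching n)) : Fintype (Components S) := Fintype.ofFinite _

/-- The component containing the point `i`. -/
def component (S : Set (Matching n)) (i : Fin (2 * n)) : Components S :=
  Quotient.mk (joinSetoid S) i

/-- The circles of the closed 1-manifold `W(a)b`. -/
abbrev Circle (a b : Matching n) : Type := Components ({a, b} : Set (Matching n))

/-- The components of the minimal cobordism from `W(a)b ⊔ W(b)c` to `W(a)c`. (This cobordism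
retracts to the union of the matchings `a`, `b`, `c`, glued along their endpoints.) -/
abbrev Cobordism (a b c : Matching n) : Type := Components ({a, b, c} : Set (Matching n))

/-- The circle `C` is part of the boundary of the component `K`. -/
def Bounds {S T : Set (Matching n)} (C : Components S) (K : Components T) : Prop :=
  ∃ i, component S i = C ∧ component T i = K

instance (a b : Matching n) : Fintype (Set (Circle a b)) := Fintype.ofFinite _

/-- The underlying abelian group of the arc algebra `H^n`: the free abelian group on the triples
`(a, b, σ)` where `σ` is a labelling of the circles of `W(a)b` by `+` and `-`. A labelling is given
by the set of circles labelled `-`, and an element by its coefficients. -/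
def ArcAlgebra (n : ℕ) : Type := ∀ a b : Matching n, Set (Circle a b) → ℤ

instance : AddCommGroup (ArcAlgebra n) :=
  inferInstanceAs (AddCommGroup (∀ a b : Matching n, Set (Circle a b) → ℤ))

/-- The basis element `(W(a)b, σ)`, where `σ` is `-` exactly on the circles in `S`. -/
def basisElt (a b : Matching n) (S : Set (Circle a b)) : ArcAlgebra n :=
  Pi.single a (Pi.single b (Pi.single S 1))

/-- The Euler characteristic of the closed surface obtained from the component `K` of the minimal
cobordism by capping off all its boundary circles with disks. The cobordism consists of one saddle
for every arc of `b`. -/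
def closedEuler {a b c : Matching n} (K : Cobordism a b c) : ℤ :=
  ({C : Circle a b | Bounds C K}.ncard + {C : Circle b c | Bounds C K}.ncard
    + {C : Circle a c | Bounds C K}.ncard : ℤ)
    - {α : Arc b | component {a, b, c} α.left = K}.ncard

/-- The number of dots on the capped component `K`: an incoming circle is capped by a disk carrying
a dot when its label is `-` (that is, `X`), and an outgoing circle is capped by a dotted disk when
its label is `+` (that is, `1`); for the trace `ε(1) = 0`, `ε(X) = 1` on `ℤ[X]/(X²)` the basis dual
to `1, X` is `X, 1`. -/
def dots {a b c : Matching n} (S : Set (Circle a b)) (T : Set (Circle b c)) (U : Set (Circle a c))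
    (K : Cobordism a b c) : ℕ :=
  {C : Circle a b | C ∈ S ∧ Bounds C K}.ncard + {C : Circle b c | C ∈ T ∧ Bounds C K}.ncard
    + {C : Circle a c | C ∉ U ∧ Bounds C K}.ncard

/-- The value on a closed connected orientable surface of Euler characteristic `χ` with `d` dots of
the 2-dimensional TQFT of the Frobenius algebra `ℤ[X]/(X²)`, `Δ(1) = 1 ⊗ X + X ⊗ 1`, `ε(1) = 0`,
`ε(X) = 1`, a dot being multiplication by `X`. A surface of genus `g` has value `ε((2X)^g X^d)`, so
a sphere with one dot has value `1`, a torus without dots has value `2`, and all others vanish. -/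
def closedValue (χ : ℤ) (d : ℕ) : ℤ :=
  if χ = 2 ∧ d = 1 then 1 else if χ = 0 ∧ d = 0 then 2 else 0

/-- The coefficient of `(W(a)c, U)` in the product of `(W(a)b, S)` and `(W(b)c, T)`, that is, the
matrix entry of the map induced by the minimal cobordism under the TQFT. -/
def structureConst {a b c : Matching n} (S : Set (Circle a b)) (T : Set (Circle b c))
    (U : Set (Circle a c)) : ℤ :=
  ∏ K : Cobordism a b c, closedValue (closedEuler K) (dots S T U K)

/-- The multiplication of `H^n`. -/
instance : Mul (ArcAlgebra n) where
  mul x y := fun a c U => ∑ b : Matching n, ∑ S : Set (Circle a b), ∑ T : Set (Circle b c),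
    x a b S * y b c T * structureConst S T U

theorem ArcAlgebra.mul_apply (x y : ArcAlgebra n) (a c : Matching n) (U : Set (Circle a c)) :
    (x * y) a c U = ∑ b : Matching n, ∑ S : Set (Circle a b), ∑ T : Set (Circle b c),
      x a b S * y b c T * structureConst S T U := rfl

/-- The additive structure and the biadditivity of the multiplication of `H^n`. -/
instance : NonUnitalNonAssocRing (ArcAlgebra n) where
  __ := (inferInstance : AddCommGroup (ArcAlgebra n))
  __ := (inferInstance : Mul (ArcAlgebra n))
  left_distrib x y z := by
    funext a c U
    change (x * (y + z)) a c U = (x * y) a c U + (x * z) a c U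
    simp only [ArcAlgebra.mul_apply, ← Finset.sum_add_distrib]
    refine Finset.sum_congr rfl fun b _ => Finset.sum_congr rfl fun S _ =>
      Finset.sum_congr rfl fun T _ => ?_
    change x a b S * (y b c T + z b c T) * _ = _
    ring
  right_distrib x y z := by
    funext a c U
    change ((x + y) * z) a c U = (x * z) a c U + (y * z) a c U
    simp only [ArcAlgebra.mul_apply, ← Finset.sum_add_distrib]
    refine Finset.sum_congr rfl fun b _ => Finset.sum_congr rfl fun S _ =>
      Finset.sum_congr rfl fun T _ => ?_
    change (x a b S + y a b S) * z b c T * _ = _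
    ring
  zero_mul x := by
    funext a c U
    change ((0 : ArcAlgebra n) * x) a c U = 0
    rw [ArcAlgebra.mul_apply]
    refine Finset.sum_eq_zero fun b _ => Finset.sum_eq_zero fun S _ =>
      Finset.sum_eq_zero fun T _ => ?_
    change (0 : ℤ) * _ * _ = 0
    ring
  mul_zero x := by
    funext a c U
    change (x * (0 : ArcAlgebra n)) a c U = 0
    rw [ArcAlgebra.mul_apply]
    refine Finset.sum_eq_zero fun b _ => Finset.sum_eq_zero fun S _ =>
      Finset.sum_eq_zero fun T _ => ?_
    change _ * (0 : ℤ) * _ = 0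
    ring

/-- The degree of the basis element `(W(a)b, σ)`, `σ` being `-` exactly on `S`. -/
def degree (a b : Matching n) (S : Set (Circle a b)) : ℤ :=
  (n : ℤ) - Fintype.card (Circle a b) + 2 * S.ncard

/-- The projection of `H^n` onto its summand of degree zero. -/
def degreeZeroPart (x : ArcAlgebra n) : ArcAlgebra n :=
  fun a b S => if degree a b S = 0 then x a b S else 0

/-- The inclusion of the idempotent ring `I_n = ℤ^{B^n}` in `H^n`; it sends the elementary
idempotents to the elements `1_a = (W(a)a, all plus)`. -/
def ofIdempotents (r : Matching n → ℤ) : ArcAlgebra n :=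
  ∑ a, r a • basisElt a a ∅

/-! ### The multiplicative generators -/

/-- The index set of the multiplicative generators `h_γ` (`γ` a bridge on `a`) and `h_α`
(`α` an arc of `a`). -/
inductive Gen (n : ℕ) : Type
  | bridge (a : Matching n) (γ : Bridge a) : Gen n
  | arc (a : Matching n) (α : Arc a) : Gen n

/-- The left idempotent of a generator. -/
def Gen.left : Gen n → Matching n
  | .bridge a _ => a
  | .arc a _ => a

/-- The right idempotent of a generator. -/
def Gen.right : Gen n → Matching n
  | .bridge _ γ => surger γ
  | .arc a _ => a

/-- The generators as elements of `H^n`: `h_γ = (W(a)a_γ, all plus)` and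
`h_α = (W(a)a, minus exactly on the circle W(α)α)`. -/
def Gen.toArcAlgebra : Gen n → ArcAlgebra n
  | .bridge a γ => basisElt a (surger γ) ∅
  | .arc a α => basisElt a a {component {a, a} α.left}

end KhovanovArc

/-! ### Linear-quadratic algebras -/

namespace LinQuad

variable {E G : Type} [Fintype E]

/-- The relations defining the tensor algebra of a bimodule in terms of generators. -/
inductive TensorRel (s t : G → E) : FreeAlgebra ℤ (E ⊕ G) → FreeAlgebra ℤ (E ⊕ G) → Prop
  | idem (e : E) : TensorRel s t
      (FreeAlgebra.ι ℤ (Sum.inl e) * FreeAlgebra.ι ℤ (Sum.inl e)) (FreeAlgebra.ι ℤ (Sum.inl e))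
  | orth (e f : E) (h : e ≠ f) : TensorRel s t
      (FreeAlgebra.ι ℤ (Sum.inl e) * FreeAlgebra.ι ℤ (Sum.inl f)) 0
  | one : TensorRel s t (∑ e : E, FreeAlgebra.ι ℤ (Sum.inl e)) 1
  | left (g : G) : TensorRel s t
      (FreeAlgebra.ι ℤ (Sum.inl (s g)) * FreeAlgebra.ι ℤ (Sum.inr g)) (FreeAlgebra.ι ℤ (Sum.inr g))
  | right (g : G) : TensorRel s t
      (FreeAlgebra.ι ℤ (Sum.inr g) * FreeAlgebra.ι ℤ (Sum.inl (t g))) (FreeAlgebra.ι ℤ (Sum.inr g))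

/-- The tensor algebra `T(V) = R ⊕ V ⊕ (V ⊗_R V) ⊕ ⋯` over `R = ℤ^E` of the `R`-bimodule `V` which is
free over `ℤ` on the set `G`, the left and right idempotents of `g ∈ G` being `s g` and `t g`. It is
the universal ring containing `R` and the bimodule `V`. -/
def TensorAlg (s t : G → E) : Type := RingQuot (TensorRel s t)

instance (s t : G → E) : Ring (TensorAlg s t) := inferInstanceAs (Ring (RingQuot (TensorRel s t)))

variable (s t : G → E)

/-- The elementary idempotent `e` of `R`, in `T(V)`. -/
def idem (e : E) : TensorAlg s t :=
  RingQuot.mkRingHom (TensorRel s t) (FreeAlgebra.ι ℤ (Sum.inl e))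

/-- The generator `g` of `V`, in `T(V)`. -/
def gen (g : G) : TensorAlg s t :=
  RingQuot.mkRingHom (TensorRel s t) (FreeAlgebra.ι ℤ (Sum.inr g))

/-- The summand `V` of `T(V)`. -/
def linearPart : AddSubgroup (TensorAlg s t) := AddSubgroup.closure (Set.range (gen s t))

/-- The summand `V ⊗_R V` of `T(V)`. -/
def quadraticPart : AddSubgroup (TensorAlg s t) :=
  AddSubgroup.closure {x | ∃ g h : G, x = gen s t g * gen s t h}

variable {s t}

/-- `J₂ = J ∩ (V ⊕ V ⊗_R V)`, where `J` is the kernel of `π`. -/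
def linQuadRelations {B : Type} [NonUnitalNonAssocRing B] (π : TensorAlg s t →ₙ+* B) :
    Set (TensorAlg s t) :=
  {x | π x = 0 ∧ x ∈ linearPart s t ⊔ quadraticPart s t}

/-- The ring `B` is associative and unital, and it is an algebra over `R = ℤ^E` by the unital ring
homomorphism `η : R → B` (whose image need not be central), with augmentation `ε : B → R`, a
homomorphism of algebras over `R`. -/
structure IsAugmentedAlgebra {B : Type} [NonUnitalNonAssocRing B] (η : (E → ℤ) → B)
    (ε : B → (E → ℤ)) : Prop where
  mul_assoc : ∀ x y z : B, x * y * z = x * (y * z)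
  one_mul : ∀ x : B, η 1 * x = x
  mul_one : ∀ x : B, x * η 1 = x
  map_add : ∀ r r', η (r + r') = η r + η r'
  map_mul : ∀ r r', η (r * r') = η r * η r'
  aug_add : ∀ x y, ε (x + y) = ε x + ε y
  aug_mul : ∀ x y, ε (x * y) = ε x * ε y
  aug_map : ∀ r, ε (η r) = r

/-- The augmented algebra `B` over `R = ℤ^E`, with the multiplicative generators `b g` having left
and right idempotents `s g` and `t g`, is a linear-quadratic algebra; `π : T(V) → B` is the natural
map and `J` is its kernel. -/
structure IsLinearQuadratic {B : Type} [NonUnitalNonAssocRing B] (η : (E → ℤ) → B)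
    (ε : B → (E → ℤ)) (b : G → B) (π : TensorAlg s t →ₙ+* B) : Prop
    extends IsAugmentedAlgebra η ε where
  left_idem : ∀ g, η (Pi.single (s g) 1) * b g = b g
  right_idem : ∀ g, b g * η (Pi.single (t g) 1) = b g
  aug_gen : ∀ g, ε (b g) = 0
  map_idem : ∀ e, π (idem s t e) = η (Pi.single e 1)
  map_gen : ∀ g, π (gen s t g) = b g
  /-- The elements `b g` generate `B`. -/
  surjective : Function.Surjective π
  /-- `J` is generated by `J₂` as a two-sided ideal. -/
  ker_eq : TwoSidedIdeal.ker π = TwoSidedIdeal.span (linQuadRelations π)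
  /-- `J ∩ V = 0`. -/
  ker_inf_linear : ∀ x ∈ linearPart s t, π x = 0 → x = 0

end LinQuad

/-! ### The explicit relations -/

namespace KhovanovArc

variable {n : ℕ}

/-- The tensor algebra `T(V)` over `I_n` on the generators `h_γ`, `h_α`. -/
abbrev TV (n : ℕ) : Type := LinQuad.TensorAlg (Gen.left (n := n)) (Gen.right (n := n))

/-- The generator `h_γ` of `T(V)`, for a bridge `γ` on `a`. -/
def hBridge {a : Matching n} (γ : Bridge a) : TV n := LinQuad.gen _ _ (Gen.bridge a γ)

/-- The generator `h_α` of `T(V)`, for an arc `α` of `a`. -/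
def hArc {a : Matching n} (α : Arc a) : TV n := LinQuad.gen _ _ (Gen.arc a α)

/-- The explicit linear-quadratic relations. -/
inductive Relation : TV n → Prop
  /-- `h_γ h_{η'} - h_η h_{γ'}`, for two distinct bridges `γ`, `η` on `a` drawn without intersection,
  where `η'` is the bridge on `a_γ` given by `η` and `γ'` is the bridge on `a_η` given by `γ`. The
  positions of the bridges are recorded by endpoints of the arcs which they meet: the two ends of
  `γ` can be slid along these arcs to the points `i` and `j` without meeting `η`, and those of `η`
  to `k` and `l` without meeting `γ`. So if an arc is met by both bridges, one of its endpoints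
  belongs to `γ` and the other one to `η`. After surgery on `γ`, the bridge `η` connects
  the arcs through `k` and `l`, and vice versa. -/
  | twoBridges {a : Matching n} (γ η : Bridge a) (hne : γ ≠ η) (i j k l : Fin (2 * n))
      (hik : i ≠ k) (hil : i ≠ l) (hjk : j ≠ k) (hjl : j ≠ l)
      (hγ : γ.Joins i j) (hη : η.Joins k l)
      (η' : Bridge (surger γ)) (γ' : Bridge (surger η))
      (hη' : η'.Joins k l) (hγ' : γ'.Joins i j) (htarget : surger η' = surger γ') :
      Relation (hBridge γ * hBridge η' - hBridge η * hBridge γ')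
  /-- `h_γ h_{α'} - h_α h_γ`, where `α` is an arc of `a` and `α'` is an arc of `a_γ` sharing an
  endpoint with `α`. (If `γ` does not end on `α` then `α' = α`, otherwise there are two choices.) -/
  | bridgeArc {a : Matching n} (γ : Bridge a) (i : Fin (2 * n)) :
      Relation (hBridge γ * hArc (arcThrough (surger γ) i) - hArc (arcThrough a i) * hBridge γ)
  /-- `h_{α₁} h_{α₂} - h_{α₂} h_{α₁}`. -/
  | twoArcs {a : Matching n} (α₁ α₂ : Arc a) :
      Relation (hArc α₁ * hArc α₂ - hArc α₂ * hArc α₁)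
  /-- `h_α²`. -/
  | arcSquare {a : Matching n} (α : Arc a) : Relation (hArc α * hArc α)
  /-- `h_γ h_{γ†} - h_{α₁} - h_{α₂}`, where the dual bridge `γ†` on `a_γ` reverses the surgery along
  `γ`, and `α₁`, `α₂` are the arcs of `a` connected by `γ`. -/
  | dualBridge {a : Matching n} (γ : Bridge a) (γd : Bridge (surger γ)) (hd : surger γd = a) :
      Relation (hBridge γ * hBridge γd - hArc γ.fst - hArc γ.snd)

end KhovanovArc

end

/-!
The associativity of `H^n` comes from neck cutting. A structure constant is a product of values of
closed surfaces, one for each component of the minimal cobordism, and these components are the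
connected components of the union of three matchings. Their genus is computed in `exists_genus`: one of
the matchings is moved towards another one by surgeries, each of which splits or merges circles
(the parity colouring of the points excludes that a surgery preserves the number of circles). Summing
over the labels of intermediate circles cuts the necks of the composed surface
(`sum_prod_closedValue_glue`), so both `(xy)z` and `x(yz)` evaluate the surface whose components are
those of the union of four matchings (`structureConst_assoc`). As a component contributes only if
its Euler characteristic is twice its number of dots, the multiplication is homogeneous, and degree
zero is spanned by the idempotents; this gives the augmentation.

The relations hold in `H^n` because the number of circles of `W(a)c` measures the distance from `a` to
`c`: if `#W(a)b + #W(b)c = n + #W(a)c`, then the minimal cobordism consists of merges only, and the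
product of two all-plus elements is all-plus (`basisElt_mul_basisElt_empty`). The arcs act by `X` on
the circles to which they belong, and a bridge times its dual is a comultiplication.

That the relations suffice is an argument with geodesics. For `a ≠ c`, a shortest arc of `c` which is
not an arc of `a` gives a bridge on `a` that leads one step closer to `c` (`IsShortcut`), so there is
a product of bridges from `a` to `c` (`geodesic`) with image the all-plus element. Any other bridge on
`a` towards `c` can be drawn disjointly from the shortcut, and together they form a commuting square
(`exists_square`); by induction, modulo the relations all geodesics from `a` to `c` agree
(`map_hBridge_mul_geodesic`). Sliding arcs along a geodesic shows that an arc times a geodesic depends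
only on the circle of the arc. So one can define an additive map from `H^n` to any quotient of `T(V)` in
which the relations hold (`ofArcAlgebra`), by sending a basis element to a geodesic times one arc for
each circle with label `-`. It is linear over the generators of `T(V)`; for a bridge that leads away
from `c`, the geodesic is chosen to begin with the dual bridge. Therefore it inverts the natural map,
whose kernel is the ideal generated by the relations.

For the elements of the kernel in `V ⊕ V ⊗ V`, the same is done without multiplying: each
generator or product of two generators either is mapped to a basis element of `H^n` and, modulo the
additive group generated by the relations, is determined by it (`Represents.sub_mem`), or is reduced
to other ones by a single relation.
-/

noncomputable section

namespace KhovanovArc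

/-! ### Orbits of families of involutions -/

section Orbits

variable {X : Type*}

/-- The equivalence relation whose classes are the connected components of the graph in which every
`f ∈ F` joins each point `x` to `f x`. -/
def orbitSetoid (F : Set (X → X)) : Setoid X :=
  Relation.EqvGen.setoid (fun x y => ∃ f ∈ F, f x = y)

theorem orbitSetoid_le_iff {F : Set (X → X)} {r : Setoid X} :
    orbitSetoid F ≤ r ↔ ∀ f ∈ F, ∀ x, r x (f x) := by
  constructor
  · intro h f hf x
    exact h (Relation.EqvGen.rel _ _ ⟨f, hf, rfl⟩)
  · intro h x y hxy
    induction hxy with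
    | rel x y hxy => obtain ⟨f, hf, rfl⟩ := hxy; exact h f hf x
    | refl x => exact r.refl x
    | symm x y _ ih => exact r.symm ih
    | trans x y z _ _ ih1 ih2 => exact r.trans ih1 ih2

theorem orbitSetoid_apply {F : Set (X → X)} {f : X → X} (hf : f ∈ F) (x : X) :
    orbitSetoid F x (f x) :=
  orbitSetoid_le_iff.1 le_rfl f hf x

theorem orbitSetoid_mono {F G : Set (X → X)} (h : F ⊆ G) : orbitSetoid F ≤ orbitSetoid G :=
  orbitSetoid_le_iff.2 fun _ hf x => orbitSetoid_apply (h hf) x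

/-- A set which is closed under the involutions of `F` is a union of classes. -/
theorem orbitSetoid_mem_iff {F : Set (X → X)} {P : Set X} (hP : ∀ f ∈ F, ∀ x, f x ∈ P ↔ x ∈ P)
    {x y : X} (h : orbitSetoid F x y) : x ∈ P ↔ y ∈ P := by
  have : orbitSetoid F ≤ Setoid.comap (· ∈ P) (⊥ : Setoid Prop) := by
    refine orbitSetoid_le_iff.2 fun f hf x => ?_
    exact propext (hP f hf x).symm
  exact iff_of_eq (this h)

/-- The equivalence relation obtained from `r` by identifying the classes of `p` and `q`. -/
def mergeSetoid (r : Setoid X) (p q : X) : Setoid X where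
  r x y := r x y ∨ (r x p ∧ r y q) ∨ (r x q ∧ r y p)
  iseqv := by
    have rf := r.refl
    have sm : ∀ {x y}, r x y → r y x := fun h => r.symm h
    have tr : ∀ {x y z}, r x y → r y z → r x z := fun h h' => r.trans h h'
    refine ⟨fun x => Or.inl (rf x), ?_, ?_⟩
    · rintro x y (h | h | h)
      · exact Or.inl (sm h)
      · exact Or.inr (Or.inr ⟨h.2, h.1⟩)
      · exact Or.inr (Or.inl ⟨h.2, h.1⟩)
    · rintro x y z (h | ⟨h, h'⟩ | ⟨h, h'⟩) (k | ⟨k, k'⟩ | ⟨k, k'⟩)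
      · exact Or.inl (tr h k)
      · exact Or.inr (Or.inl ⟨tr h k, k'⟩)
      · exact Or.inr (Or.inr ⟨tr h k, k'⟩)
      · exact Or.inr (Or.inl ⟨h, tr (sm k) h'⟩)
      · exact Or.inl (tr h (tr (sm k) (tr h' (sm k'))))
      · exact Or.inl (tr h (sm k'))
      · exact Or.inr (Or.inr ⟨h, tr (sm k) h'⟩)
      · exact Or.inl (tr h (sm k'))
      · exact Or.inl (tr h (tr (sm k) (tr h' (sm k'))))

theorem mergeSetoid_apply {r : Setoid X} {p q x y : X} :
    mergeSetoid r p q x y ↔ r x y ∨ (r x p ∧ r y q) ∨ (r x q ∧ r y p) := Iff.rfl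

theorem mergeSetoid_le_iff {r s : Setoid X} {p q : X} :
    mergeSetoid r p q ≤ s ↔ r ≤ s ∧ s p q := by
  constructor
  · intro h
    exact ⟨fun x y hxy => h (Or.inl hxy), h (Or.inr (Or.inl ⟨r.refl p, r.refl q⟩))⟩
  · rintro ⟨h, hpq⟩ x y (hxy | ⟨h1, h2⟩ | ⟨h1, h2⟩)
    · exact h hxy
    · exact s.trans (h h1) (s.trans hpq (s.symm (h h2)))
    · exact s.trans (h h1) (s.trans (s.symm hpq) (s.symm (h h2)))

theorem le_mergeSetoid (r : Setoid X) (p q : X) : r ≤ mergeSetoid r p q :=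
  (mergeSetoid_le_iff.1 le_rfl).1

theorem mergeSetoid_self (r : Setoid X) (p q : X) : mergeSetoid r p q p q :=
  (mergeSetoid_le_iff.1 le_rfl).2

theorem mergeSetoid_eq_self {r : Setoid X} {p q : X} (h : r p q) : mergeSetoid r p q = r :=
  le_antisymm (mergeSetoid_le_iff.2 ⟨le_rfl, h⟩) (le_mergeSetoid r p q)

/-- The number of classes of `r` which meet `P`. -/
def classCount (r : Setoid X) (P : Set X) : ℕ := (Quotient.mk r '' P).ncard

theorem classCount_congr {r s : Setoid X} {P : Set X}
    (h : ∀ x ∈ P, ∀ y ∈ P, r x y ↔ s x y) : classCount r P = classCount s P := by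
  unfold classCount
  refine Set.ncard_congr' ?_
  have hr : ∀ u : (Quotient.mk r '' P : Set (Quotient r)), ∃ x ∈ P, Quotient.mk r x = u.1 :=
    fun u => u.2
  have hs : ∀ u : (Quotient.mk s '' P : Set (Quotient s)), ∃ x ∈ P, Quotient.mk s x = u.1 :=
    fun u => u.2
  choose f hf hf' using hr
  choose g hg hg' using hs
  refine ⟨fun u => ⟨Quotient.mk s (f u), f u, hf u, rfl⟩,
    fun u => ⟨Quotient.mk r (g u), g u, hg u, rfl⟩, fun u => ?_, fun u => ?_⟩
  · apply Subtype.ext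
    rw [← hf' u]
    refine Quotient.sound ((h _ (hg _) _ (hf _)).2 ?_)
    exact Quotient.exact (hg' ⟨Quotient.mk s (f u), f u, hf u, rfl⟩)
  · apply Subtype.ext
    rw [← hg' u]
    refine Quotient.sound ((h _ (hf _) _ (hg _)).1 ?_)
    exact Quotient.exact (hf' ⟨Quotient.mk r (g u), g u, hg u, rfl⟩)

theorem classCount_merge [Finite X] {r : Setoid X} {P : Set X} {p q : X} (hp : p ∈ P) (hq : q ∈ P)
    (h : ¬ r p q) : classCount (mergeSetoid r p q) P + 1 = classCount r P := by
  unfold classCount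
  let φ : Quotient r → Quotient (mergeSetoid r p q) :=
    Quotient.map id (fun x y hxy => le_mergeSetoid r p q hxy)
  have hφ : ∀ x, φ (Quotient.mk r x) = Quotient.mk _ x := fun x => rfl
  have himg : Quotient.mk (mergeSetoid r p q) '' P
      = φ '' (Quotient.mk r '' P \ {Quotient.mk r q}) := by
    ext u
    constructor
    · rintro ⟨x, hx, rfl⟩
      by_cases hxq : r x q
      · refine ⟨Quotient.mk r p, ⟨⟨p, hp, rfl⟩, fun hpq => h (Quotient.exact hpq)⟩, ?_⟩
        rw [hφ]
        refine Quotient.sound ?_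
        exact (mergeSetoid r p q).trans (mergeSetoid_self r p q)
          ((mergeSetoid r p q).symm (le_mergeSetoid r p q hxq))
      · exact ⟨Quotient.mk r x, ⟨⟨x, hx, rfl⟩, fun hx' => hxq (Quotient.exact hx')⟩, rfl⟩
    · rintro ⟨_, ⟨⟨x, hx, rfl⟩, -⟩, rfl⟩
      exact ⟨x, hx, rfl⟩
  rw [himg, Set.InjOn.ncard_image, Set.ncard_sdiff_singleton_add_one]
  · exact ⟨q, hq, rfl⟩
  rintro _ ⟨⟨x, hx, rfl⟩, hxq⟩ _ ⟨⟨y, hy, rfl⟩, hyq⟩ hxy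
  have hxy' : mergeSetoid r p q x y := Quotient.exact hxy
  rcases hxy' with hxy' | ⟨-, hy'⟩ | ⟨hx', -⟩
  · exact Quotient.sound hxy'
  · exact absurd (Quotient.sound hy') hyq
  · exact absurd (Quotient.sound hx') hxq

/-- A perfect matching of the points of `X`, as a fixed-point free involution. -/
structure IsPairing (c : X → X) : Prop where
  apply_apply : ∀ x, c (c x) = x
  ne : ∀ x, c x ≠ x

/-- A finite set on which a fixed-point free involution acts has an even number of elements. -/
theorem even_ncard_of_involution [Finite X] {f : X → X} {Y : Set X} (hf : IsPairing f)
    (hY : ∀ x ∈ Y, f x ∈ Y) : Even Y.ncard := by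
  have : Fintype X := Fintype.ofFinite X
  rw [Set.ncard_eq_toFinset_card']
  have := Finset.sum_involution (s := Y.toFinset) (f := fun _ => (1 : ZMod 2))
    (fun x _ => f x) (fun x _ => by decide) (fun x _ _ => hf.ne x)
    (fun x hx => by simpa using hY x (by simpa using hx)) (fun x _ => hf.apply_apply x)
  simp only [Finset.sum_const, nsmul_eq_mul, mul_one] at this
  rwa [ZMod.natCast_eq_zero_iff_even] at this

/-- The involution obtained from the involution `c` by replacing its pairs `{p, c p}` and `{q, c q}`
by `{p, q}` and `{c p, c q}`. -/
def reconnect (c : X → X) (p q : X) (x : X) : X :=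
  if x = p then q else if x = q then p else if x = c p then c q else if x = c q then c p else c x

section Reconnect

variable {c : X → X} {p q : X}

theorem reconnect_left (c : X → X) (p q : X) : reconnect c p q p = q := by
  simp [reconnect]

theorem reconnect_right (c : X → X) (p q : X) : reconnect c p q q = p := by
  unfold reconnect; grind

theorem reconnect_partner_left (hc : IsPairing c) (hcq : q ≠ c p) : reconnect c p q (c p) = c q := by
  have h2 := hc.apply_apply
  have hne := hc.ne
  unfold reconnect; grind

theorem reconnect_partner_right (hc : IsPairing c) (hcq : q ≠ c p) : reconnect c p q (c q) = c p := by
  have h2 := hc.apply_apply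
  have hne := hc.ne
  unfold reconnect; grind

theorem reconnect_of_ne {x : X} (h1 : x ≠ p) (h2 : x ≠ q) (h3 : x ≠ c p) (h4 : x ≠ c q) :
    reconnect c p q x = c x := by
  simp [reconnect, h1, h2, h3, h4]

theorem reconnect_reconnect (hc : IsPairing c) (hpq : q ≠ p) (hcq : q ≠ c p)
    (x : X) : reconnect c p q (reconnect c p q x) = x := by
  have h2 := hc.apply_apply
  have hne := hc.ne
  have := h2 x
  have := h2 p
  have := h2 q
  unfold reconnect; grind

theorem reconnect_flips (hc : IsPairing c) {κ : X → Bool} (hκ : ∀ x, κ (c x) = !κ x)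
    (h : κ q = !κ p) (x : X) : κ (reconnect c p q x) = !κ x := by
  have h2 := hc.apply_apply
  have := h2 x
  have := hκ p
  have := hκ q
  have := hκ x
  unfold reconnect; grind

/-- The saddle which replaces `{p, c p}`, `{q, c q}` by `{p, q}`, `{c p, c q}` connects all four
points. So the relations before and after the surgery agree once `p` is identified with `q` in the
former and with `c p` in the latter. -/
theorem mergeSetoid_reconnect (hc : IsPairing c) (hpq : q ≠ p) (hcq : q ≠ c p)
    (F : Set (X → X)) :
    mergeSetoid (orbitSetoid (insert c F)) p q
      = mergeSetoid (orbitSetoid (insert (reconnect c p q) F)) p (c p) := by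
  have h2 := hc.apply_apply
  apply le_antisymm
  · set s := mergeSetoid (orbitSetoid (insert (reconnect c p q) F)) p (c p) with hs
    have hle : orbitSetoid (insert (reconnect c p q) F) ≤ s := le_mergeSetoid _ _ _
    have hstep : ∀ x, s x (reconnect c p q x) := fun x =>
      hle (orbitSetoid_apply (Set.mem_insert _ _) x)
    have hp : s p (c p) := mergeSetoid_self _ _ _
    have hpq' : s p q := by simpa [reconnect_left] using hstep p
    have hq : s q (c q) := by
      refine s.trans (s.symm hpq') (s.trans hp ?_)
      simpa [reconnect_partner_left hc hcq] using hstep (c p)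
    refine mergeSetoid_le_iff.2 ⟨orbitSetoid_le_iff.2 ?_, hpq'⟩
    rintro f (rfl | hf) x
    · by_cases h1 : x = p
      · subst h1; exact hp
      by_cases h3 : x = q
      · subst h3; exact hq
      by_cases h4 : x = f p
      · subst h4; rw [h2]; exact s.symm hp
      by_cases h5 : x = f q
      · subst h5; rw [h2]; exact s.symm hq
      rw [← reconnect_of_ne h1 h3 h4 h5]
      exact hstep x
    · exact hle (orbitSetoid_apply (Set.mem_insert_of_mem _ hf) x)
  · set s := mergeSetoid (orbitSetoid (insert c F)) p q with hs
    have hle : orbitSetoid (insert c F) ≤ s := le_mergeSetoid _ _ _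
    have hstep : ∀ x, s x (c x) := fun x => hle (orbitSetoid_apply (Set.mem_insert _ _) x)
    have hpq' : s p q := mergeSetoid_self _ _ _
    have hc : s (c p) (c q) := s.trans (s.symm (hstep p)) (s.trans hpq' (hstep q))
    refine mergeSetoid_le_iff.2 ⟨orbitSetoid_le_iff.2 ?_, hstep p⟩
    rintro f (rfl | hf) x
    · unfold reconnect
      split_ifs with h1 h3 h4 h5
      · subst h1; exact hpq'
      · subst h3; exact s.symm hpq'
      · subst h4; exact hc
      · subst h5; exact s.symm hc
      · exact hstep x
    · exact hle (orbitSetoid_apply (Set.mem_insert_of_mem _ hf) x)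

/-- Reconnecting two different circles of `a ∪ c` merges them: the old arc `{p, c p}` has both its
endpoints on one circle of `a ∪ c'`. Otherwise the intersection of the class of `p` before and
after the surgery would be closed under `a`, and, without `p`, also under `c`. -/
theorem orbitSetoid_reconnect_of_not [Finite X] {a : X → X} (ha : IsPairing a)
    (hc : IsPairing c) (hpq : q ≠ p) (hcq : q ≠ c p)
    (h : ¬ orbitSetoid {c, a} p q) : orbitSetoid {reconnect c p q, a} p (c p) := by
  by_contra h'
  have h2 := hc.apply_apply
  set r := orbitSetoid {c, a} with hr
  set s := orbitSetoid {reconnect c p q, a} with hs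
  have rc : ∀ x, r x (c x) := fun x => orbitSetoid_apply (by simp) x
  have ra : ∀ x, r x (a x) := fun x => orbitSetoid_apply (by simp) x
  have sc : ∀ x, s x (reconnect c p q x) := fun x => orbitSetoid_apply (by simp) x
  have sa : ∀ x, s x (a x) := fun x => orbitSetoid_apply (by simp) x
  -- `Y` has an even number of elements, and so does `Y` without `p`
  set Y : Set X := {x | r p x ∧ s p x} with hY
  have hpY : p ∈ Y := ⟨r.refl p, s.refl p⟩
  have e1 : Even Y.ncard := by
    refine even_ncard_of_involution ha fun x hx => ?_
    exact ⟨r.trans hx.1 (ra x), s.trans hx.2 (sa x)⟩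
  have scq : ¬ s p (c q) := by
    intro hcq'
    have := sc (c q)
    rw [reconnect_partner_right hc hcq] at this
    exact h' (s.trans hcq' this)
  have e2 : Even (Y \ {p}).ncard := by
    refine even_ncard_of_involution hc fun x hx => ?_
    obtain ⟨⟨hx1, hx2⟩, hxp⟩ := hx
    have hxq : x ≠ q := by rintro rfl; exact h hx1
    have hxcp : x ≠ c p := by rintro rfl; exact h' hx2
    have hxcq : x ≠ c q := by rintro rfl; exact scq hx2
    refine ⟨⟨r.trans hx1 (rc x), ?_⟩, ?_⟩
    · have := sc x
      rw [reconnect_of_ne hxp hxq hxcp hxcq] at this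
      exact s.trans hx2 this
    · intro hcx
      exact hxcp (by rw [← Set.mem_singleton_iff.1 hcx, h2])
  have := Set.ncard_sdiff_singleton_add_one hpY
  rw [← this] at e1
  exact (Nat.even_add_one.1 e1) e2

/-- Two points of the same colour on the same circle lie in one orbit of `c ∘ a`. -/
theorem exists_iterate_eq_of_orbitSetoid [Finite X] {a : X → X} (ha : IsPairing a)
    (hc : IsPairing c) {κ : X → Bool} (hκa : ∀ x, κ (a x) = !κ x) (hκc : ∀ x, κ (c x) = !κ x)
    {x y : X} (h : orbitSetoid {c, a} x y) (hκ : κ x = κ y) : ∃ k : ℕ, (c ∘ a)^[k] x = y := by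
  have a2 := ha.apply_apply
  have c2 := hc.apply_apply
  have inj : Function.Injective (c ∘ a) := by
    intro u v huv
    have := congrArg (fun w => a (c w)) huv
    simpa [a2, c2] using this
  obtain ⟨m, hm, hper⟩ := inj.mem_periodicPts x
  -- the points on the circle through `x`, with one endpoint of each arc of `a` in the orbit of `x`
  set Y : Set X := {y | ∃ k : ℕ, (c ∘ a)^[k] x = y ∨ (c ∘ a)^[k] x = a y} with hY
  have ya : ∀ y ∈ Y, a y ∈ Y := by
    rintro y ⟨k, hk | hk⟩
    · exact ⟨k, Or.inr (by rw [a2, hk])⟩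
    · exact ⟨k, Or.inl hk⟩
  have yc : ∀ y ∈ Y, c y ∈ Y := by
    rintro y ⟨k, hk | hk⟩
    · have hk' : (c ∘ a)^[k + m] x = y := by
        rw [Function.iterate_add_apply, hper, hk]
      obtain ⟨l, hl⟩ : ∃ l, k + m = l + 1 := ⟨k + m - 1, by omega⟩
      refine ⟨l, Or.inr ?_⟩
      rw [hl, Function.iterate_succ_apply'] at hk'
      rw [← hk']
      simp [a2, c2]
    · refine ⟨k + 1, Or.inl ?_⟩
      rw [Function.iterate_succ_apply', hk]
      simp [a2]
  have hiff : x ∈ Y ↔ y ∈ Y := by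
    refine orbitSetoid_mem_iff ?_ h
    rintro f (rfl | rfl) z
    · exact ⟨fun hz => by simpa [c2] using yc _ hz, yc z⟩
    · exact ⟨fun hz => by simpa [a2] using ya _ hz, ya z⟩
  have hκk : ∀ k : ℕ, κ ((c ∘ a)^[k] x) = κ x := by
    intro k
    induction k with
    | zero => rfl
    | succ k ih => rw [Function.iterate_succ_apply', Function.comp_apply, hκc, hκa, ih]; simp
  obtain ⟨k, hk | hk⟩ := hiff.1 ⟨0, Or.inl rfl⟩
  · exact ⟨k, hk⟩
  · have := hκk k
    rw [hk, hκa, hκ] at this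
    simp at this

/-- Reconnecting two arcs of one circle splits it. This needs the orientability that is expressed
by the colouring `κ`. -/
theorem not_orbitSetoid_reconnect [Finite X] {a : X → X} (ha : IsPairing a) (hc : IsPairing c)
    (hpq : q ≠ p) (hcq : q ≠ c p) {κ : X → Bool} (hκa : ∀ x, κ (a x) = !κ x)
    (hκc : ∀ x, κ (c x) = !κ x) (hκ : κ q = !κ p) (h : orbitSetoid {c, a} p q) :
    ¬ orbitSetoid {reconnect c p q, a} p (c p) := by
  have a2 := ha.apply_apply
  have c2 := hc.apply_apply
  have hex : ∃ k : ℕ, (c ∘ a)^[k] (c p) = q := by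
    refine exists_iterate_eq_of_orbitSetoid ha hc hκa hκc ?_ (by rw [hκc, hκ])
    exact (orbitSetoid _).trans ((orbitSetoid _).symm (orbitSetoid_apply (by simp) p)) h
  set k := Nat.find hex with hk
  have hkq : (c ∘ a)^[k] (c p) = q := Nat.find_spec hex
  have hmin : ∀ j < k, (c ∘ a)^[j] (c p) ≠ q := fun j hj => Nat.find_min hex hj
  have hk0 : k ≠ 0 := by
    intro h0
    rw [h0] at hkq
    exact hcq hkq.symm
  have hκj : ∀ j : ℕ, κ ((c ∘ a)^[j] (c p)) = !κ p := by
    intro j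
    induction j with
    | zero => exact hκc p
    | succ j ih => rw [Function.iterate_succ_apply', Function.comp_apply, hκc, hκa, ih]; simp
  -- the arc of the circle from `c p` to `q`, which is closed up by the new pair `{c p, c q}`
  set Z : Set X := {x | ∃ j < k, x = (c ∘ a)^[j] (c p) ∨ a x = (c ∘ a)^[j] (c p)} with hZ
  have za : ∀ x ∈ Z, a x ∈ Z := by
    rintro x ⟨j, hj, hx | hx⟩
    · exact ⟨j, hj, Or.inr (by rw [a2, hx])⟩
    · exact ⟨j, hj, Or.inl hx⟩
  have zc : ∀ x ∈ Z, reconnect c p q x ∈ Z := by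
    rintro x ⟨j, hj, hx | hx⟩
    · have hκx : κ x = !κ p := by rw [hx, hκj]
      have h1 : x ≠ p := by rintro rfl; simp at hκx
      have h3 : x ≠ q := by rintro rfl; exact hmin j hj hx.symm
      have h5 : x ≠ c q := by
        rintro rfl
        rw [hκc, hκ] at hκx
        simp at hκx
      by_cases h4 : x = c p
      · rw [h4, reconnect_partner_left hc hcq]
        obtain ⟨l, hl⟩ : ∃ l, k = l + 1 := ⟨k - 1, by omega⟩
        refine ⟨l, by omega, Or.inr ?_⟩
        rw [hl, Function.iterate_succ_apply'] at hkq
        rw [← hkq]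
        simp [a2, c2]
      · rw [reconnect_of_ne h1 h3 h4 h5]
        obtain ⟨l, hl⟩ : ∃ l, j = l + 1 := by
          refine ⟨j - 1, ?_⟩
          have : j ≠ 0 := by rintro rfl; exact h4 hx
          omega
        refine ⟨l, by omega, Or.inr ?_⟩
        rw [hx, hl, Function.iterate_succ_apply']
        simp [a2, c2]
    · have hκx : κ x = κ p := by
        have := hκj j
        rw [← hx, hκa] at this
        simpa using this
      have hcx : c x = (c ∘ a)^[j + 1] (c p) := by
        rw [Function.iterate_succ_apply', ← hx]
        simp [a2]
      have h3 : x ≠ q := by rintro rfl; rw [hκ] at hκx; simp at hκx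
      have h4 : x ≠ c p := by rintro rfl; rw [hκc] at hκx; simp at hκx
      have h1 : x ≠ p := by
        rintro rfl
        rcases Nat.lt_or_ge (j + 1) k with hlt | hge
        · refine hmin (k - (j + 1)) (by omega) ?_
          conv_lhs => rw [hcx]
          rw [← Function.iterate_add_apply, Nat.sub_add_cancel hlt.le, hkq]
        · have : j + 1 = k := by omega
          rw [this, hkq] at hcx
          exact hcq hcx.symm
      by_cases h5 : x = c q
      · rw [h5, reconnect_partner_right hc hcq]
        exact ⟨0, by omega, Or.inl rfl⟩
      · rw [reconnect_of_ne h1 h3 h4 h5]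
        refine ⟨j + 1, ?_, Or.inl hcx⟩
        rcases Nat.lt_or_ge (j + 1) k with hlt | hge
        · exact hlt
        · have : j + 1 = k := by omega
          rw [this, hkq] at hcx
          exact absurd (by rw [← hcx, c2]) h5
  have hiff : ∀ {x y}, orbitSetoid {reconnect c p q, a} x y → (x ∈ Z ↔ y ∈ Z) := by
    intro x y hxy
    refine orbitSetoid_mem_iff ?_ hxy
    rintro f (rfl | rfl) z
    · exact ⟨fun hz => by simpa [reconnect_reconnect hc hpq hcq] using zc _ hz, zc z⟩
    · exact ⟨fun hz => by simpa [a2] using za _ hz, za z⟩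
  intro hcon
  have hp : p ∈ Z := (hiff hcon).2 ⟨0, by omega, Or.inl rfl⟩
  have hq : q ∈ Z := by simpa [reconnect_left] using zc p hp
  obtain ⟨j, hj, hx | hx⟩ := hq
  · exact hmin j hj hx.symm
  · have := hκj j
    rw [← hx, hκa, hκ] at this
    simp at this

end Reconnect

end Orbits

/-! ### The genus of a triple of matchings -/

section Genus

variable {X : Type*}

/-- On a closed set of points, the classes depend only on the arcs in this set. -/
theorem orbitSetoid_of_eqOn {F G : Set (X → X)} {P : Set X}
    (hP : ∀ f ∈ F, ∀ x, f x ∈ P ↔ x ∈ P) (hFG : ∀ f ∈ F, ∃ g ∈ G, ∀ x ∈ P, f x = g x)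
    {x y : X} (hx : x ∈ P) (h : orbitSetoid F x y) : orbitSetoid G x y := by
  induction h with
  | rel x y hxy =>
    obtain ⟨f, hf, rfl⟩ := hxy
    obtain ⟨g, hg, hfg⟩ := hFG f hf
    rw [hfg x hx]
    exact orbitSetoid_apply hg x
  | refl x => exact (orbitSetoid G).refl x
  | symm x y hxy ih => exact (orbitSetoid G).symm (ih ((orbitSetoid_mem_iff hP hxy).2 hx))
  | trans x y z hxy _ ih1 ih2 =>
    exact (orbitSetoid G).trans (ih1 hx) (ih2 ((orbitSetoid_mem_iff hP hxy).1 hx))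

theorem classCount_orbitSetoid_congr {F G : Set (X → X)} {P : Set X}
    (hF : ∀ f ∈ F, ∀ x, f x ∈ P ↔ x ∈ P) (hG : ∀ g ∈ G, ∀ x, g x ∈ P ↔ x ∈ P)
    (hFG : ∀ f ∈ F, ∃ g ∈ G, ∀ x ∈ P, f x = g x) (hGF : ∀ g ∈ G, ∃ f ∈ F, ∀ x ∈ P, g x = f x) :
    classCount (orbitSetoid F) P = classCount (orbitSetoid G) P :=
  classCount_congr fun _ hx _ _ =>
    ⟨orbitSetoid_of_eqOn hF hFG hx, orbitSetoid_of_eqOn hG hGF hx⟩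

theorem IsPairing.reconnect {c : X → X} (hc : IsPairing c) {p q : X} (hpq : q ≠ p)
    (hcq : q ≠ c p) : IsPairing (reconnect c p q) where
  apply_apply := reconnect_reconnect hc hpq hcq
  ne x := by
    have h2 := hc.apply_apply
    have hne := hc.ne
    have := hne x
    have := h2 x
    have := hne p
    have := hne q
    have := h2 p
    have := h2 q
    unfold KhovanovArc.reconnect; grind

variable [Finite X]

/-- Surgery on two arcs `{p, c p}`, `{q, c q}` of a circle of `a ∪ c` increases the number of circles
by one. -/
theorem classCount_reconnect_of_orbitSetoid {a c : X → X} (ha : IsPairing a) (hc : IsPairing c)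
    {p q : X} (hpq : q ≠ p) (hcq : q ≠ c p) {κ : X → Bool} (hκa : ∀ x, κ (a x) = !κ x)
    (hκc : ∀ x, κ (c x) = !κ x) (hκ : κ q = !κ p) {P : Set X} (hp : p ∈ P) (hcp : c p ∈ P)
    (h : orbitSetoid {c, a} p q) :
    classCount (orbitSetoid {reconnect c p q, a}) P = classCount (orbitSetoid {c, a}) P + 1 := by
  have := classCount_merge hp hcp (not_orbitSetoid_reconnect ha hc hpq hcq hκa hκc hκ h)
  rw [← this, ← mergeSetoid_reconnect hc hpq hcq, mergeSetoid_eq_self h]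

/-- Surgery on arcs of two different circles of `a ∪ c` decreases the number of circles by one. -/
theorem classCount_reconnect_of_not_orbitSetoid {a c : X → X} (ha : IsPairing a)
    (hc : IsPairing c) {p q : X} (hpq : q ≠ p) (hcq : q ≠ c p) {P : Set X} (hp : p ∈ P)
    (hq : q ∈ P) (h : ¬ orbitSetoid {c, a} p q) :
    classCount (orbitSetoid {reconnect c p q, a}) P + 1 = classCount (orbitSetoid {c, a}) P := by
  have := classCount_merge hp hq h
  rw [← this, mergeSetoid_reconnect hc hpq hcq,
    mergeSetoid_eq_self (orbitSetoid_reconnect_of_not ha hc hpq hcq h)]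

/-- The Euler characteristic of the closed surface that is glued from disks bounded by the circles of
`a ∪ b`, `b ∪ c` and `a ∪ c` and from a saddle for every arc of `b` (the restriction of `b` to `P` has
`classCount (orbitSetoid {b}) P` arcs) is `2` for each component minus `2` for each handle. The pairing
`c` is moved towards `b` by surgeries; both sides of the equation are followed through each
surgery. -/
theorem exists_genus {a b : X → X} (ha : IsPairing a) (hb : IsPairing b) {κ : X → Bool}
    (hκa : ∀ x, κ (a x) = !κ x) (hκb : ∀ x, κ (b x) = !κ x) {P : Set X}
    (hPa : ∀ x, a x ∈ P ↔ x ∈ P) (hPb : ∀ x, b x ∈ P ↔ x ∈ P) {c : X → X} (hc : IsPairing c)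
    (hκc : ∀ x, κ (c x) = !κ x) (hPc : ∀ x, c x ∈ P ↔ x ∈ P) :
    ∃ g : ℕ, classCount (orbitSetoid {a, b}) P + classCount (orbitSetoid {b, c}) P
      + classCount (orbitSetoid {a, c}) P + 2 * g
      = classCount (orbitSetoid {b}) P + 2 * classCount (orbitSetoid {a, b, c}) P := by
  induction hk : {x ∈ P | c x ≠ b x}.ncard using Nat.strong_induction_on generalizing c with
  | _ k ih =>
  by_cases hcb : ∃ p ∈ P, c p ≠ b p
  · obtain ⟨p, hp, hcp⟩ := hcb
    have hpq : b p ≠ p := hb.ne p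
    have hq : b p ∈ P := (hPb p).2 hp
    have hcpP : c p ∈ P := (hPc p).2 hp
    have hcqP : c (b p) ∈ P := (hPc _).2 hq
    have b2 := hb.apply_apply
    have c2 := hc.apply_apply
    have hlt : {x ∈ P | reconnect c p (b p) x ≠ b x}.ncard < k := by
      rw [← hk]
      refine Set.ncard_lt_ncard ⟨?_, fun hsub => ?_⟩
      · rintro x ⟨hxP, hx⟩
        refine ⟨hxP, ?_⟩
        rcases eq_or_ne x p with rfl | h1
        · exact hcp
        rcases eq_or_ne x (b p) with rfl | h3
        · exact absurd (by rw [reconnect_right, b2]) hx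
        rcases eq_or_ne x (c p) with rfl | h4
        · rw [c2]
          intro h
          have := congrArg b h
          rw [b2] at this
          exact h3 this.symm
        rcases eq_or_ne x (c (b p)) with rfl | h5
        · rw [c2]
          intro h
          have := hb.apply_apply (c (b p))
          rw [← h, b2] at this
          exact h1 this.symm
        · rwa [reconnect_of_ne h1 h3 h4 h5] at hx
      · exact (hsub ⟨hp, hcp⟩).2 (reconnect_left c p (b p))
    have hPc' : ∀ x, reconnect c p (b p) x ∈ P ↔ x ∈ P := by
      intro x
      unfold reconnect
      split_ifs with h1 h3 h4 h5
      · subst h1; exact iff_of_true hq hp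
      · subst h3; exact iff_of_true hp hq
      · subst h4; exact iff_of_true hcqP hcpP
      · subst h5; exact iff_of_true hcpP hcqP
      · exact hPc x
    have hκ : κ (b p) = !κ p := hκb p
    obtain ⟨g, hg⟩ := ih _ hlt (hc.reconnect hpq hcp.symm)
      (reconnect_flips hc hκc hκ) hPc' rfl
    -- the pair `{p, b p}` is split off from a circle of `b ∪ c`, while the circles of `a ∪ c` and
    -- the components may be split or, in the case of the circles, merged
    have hbc := classCount_reconnect_of_orbitSetoid hb hc hpq hcp.symm hκb hκc hκ hp hcpP
      (orbitSetoid_apply (by simp) p)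
    have habc0 : orbitSetoid {c, a, b} p (b p) := orbitSetoid_apply (by simp) p
    have hmerge := mergeSetoid_reconnect hc hpq hcp.symm {a, b}
    rw [mergeSetoid_eq_self habc0] at hmerge
    have e1 : ∀ u : X → X, ({u, b} : Set (X → X)) = {b, u} := fun u => Set.pair_comm _ _
    have e2 : ∀ u : X → X, ({u, a} : Set (X → X)) = {a, u} := fun u => Set.pair_comm _ _
    have e3 : ∀ u : X → X, ({u, a, b} : Set (X → X)) = {a, b, u} := by
      intro u; ext f; simp only [Set.mem_insert_iff, Set.mem_singleton_iff]; tauto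
    rw [e1, e1] at hbc
    by_cases h3 : orbitSetoid {reconnect c p (b p), a, b} p (c p)
    · rw [mergeSetoid_eq_self h3, e3, e3] at hmerge
      rw [← hmerge] at hg
      by_cases h4 : orbitSetoid {c, a} p (b p)
      · have hac := classCount_reconnect_of_orbitSetoid ha hc hpq hcp.symm hκa hκc hκ hp hcpP h4
        rw [e2, e2] at hac
        exact ⟨g + 1, by omega⟩
      · have hac := classCount_reconnect_of_not_orbitSetoid ha hc hpq hcp.symm hp hq h4
        rw [e2, e2] at hac
        exact ⟨g, by omega⟩
    · have habc := classCount_merge hp hcpP h3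
      rw [← hmerge, e3, e3] at habc
      have h4 : orbitSetoid {c, a} p (b p) := by
        by_contra h4
        refine h3 (orbitSetoid_mono ?_ (orbitSetoid_reconnect_of_not ha hc hpq hcp.symm h4))
        intro f; simp only [Set.mem_insert_iff, Set.mem_singleton_iff]; tauto
      have hac := classCount_reconnect_of_orbitSetoid ha hc hpq hcp.symm hκa hκc hκ hp hcpP h4
      rw [e2, e2] at hac
      exact ⟨g, by omega⟩
  · -- if `c = b` on `P`, the surface consists of spheres
    push Not at hcb
    refine ⟨0, ?_⟩
    have e1 : classCount (orbitSetoid {b, c}) P = classCount (orbitSetoid {b}) P := by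
      apply classCount_orbitSetoid_congr <;> simp_all
    have e2 : classCount (orbitSetoid {a, c}) P = classCount (orbitSetoid {a, b}) P := by
      apply classCount_orbitSetoid_congr <;> simp_all
    have e3 : classCount (orbitSetoid {a, b, c}) P = classCount (orbitSetoid {a, b}) P := by
      apply classCount_orbitSetoid_congr <;> simp_all
    omega

end Genus

/-! ### Circles of crossingless matchings -/

variable {n : ℕ}

theorem Matching.isPairing (a : Matching n) : IsPairing a.partner :=
  ⟨a.partner_partner, a.partner_ne⟩

/-- The colouring of the points by the parity of their position. It orients all circles `W(a)b`
coherently, which makes the minimal cobordisms orientable. -/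
def colour (i : Fin (2 * n)) : Bool := decide (i.val % 2 = 0)

/-- An arc of a crossingless matching encloses an even number of points. -/
theorem Matching.colour_partner (a : Matching n) (i : Fin (2 * n)) :
    colour (a.partner i) = !colour i := by
  have key : ∀ i, i < a.partner i → colour (a.partner i) = !colour i := by
    intro i hi
    have he : Even (Set.Ioo i (a.partner i)).ncard := by
      refine even_ncard_of_involution a.isPairing fun x hx => ?_
      have h1 := a.noncrossing i x
      have h2 := a.noncrossing (a.partner x) i
      have h3 := a.partner_partner x
      have h4 := a.partner_partner i
      have h5 := a.partner_ne x
      obtain ⟨hx1, hx2⟩ := hx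
      constructor <;> grind
    rw [Set.ncard_eq_toFinset_card', Set.toFinset_Ioo, Fin.card_Ioo] at he
    unfold colour
    rw [Nat.even_iff] at he
    have : i.val < (a.partner i).val := hi
    by_cases h : i.val % 2 = 0
    · have : (a.partner i).val % 2 ≠ 0 := by omega
      simp [h, this]
    · have : (a.partner i).val % 2 = 0 := by omega
      simp [h, this]
  rcases lt_or_gt_of_ne (a.partner_ne i) with h | h
  · have := key (a.partner i) (by rwa [a.partner_partner])
    rw [a.partner_partner] at this
    rw [this, Bool.not_not]
  · exact key i h

theorem joinSetoid_eq_orbitSetoid (S : Set (Matching n)) :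
    joinSetoid S = orbitSetoid (Matching.partner '' S) := by
  unfold joinSetoid orbitSetoid
  congr 1
  funext i j
  simp

theorem component_eq_iff {S : Set (Matching n)} {i j : Fin (2 * n)} :
    component S i = component S j ↔ joinSetoid S i j :=
  Quotient.eq (r := joinSetoid S)

theorem component_surjective (S : Set (Matching n)) : Function.Surjective (component S) :=
  Quotient.mk_surjective

theorem component_partner {S : Set (Matching n)} {a : Matching n} (ha : a ∈ S)
    (i : Fin (2 * n)) : component S (a.partner i) = component S i := by
  rw [component_eq_iff, joinSetoid_eq_orbitSetoid]
  exact (orbitSetoid _).symm (orbitSetoid_apply (Set.mem_image_of_mem _ ha) i)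

theorem joinSetoid_le_iff {S : Set (Matching n)} {r : Setoid (Fin (2 * n))} :
    joinSetoid S ≤ r ↔ ∀ a ∈ S, ∀ i, r i (a.partner i) := by
  rw [joinSetoid_eq_orbitSetoid, orbitSetoid_le_iff]
  simp

theorem joinSetoid_mono {S T : Set (Matching n)} (h : S ⊆ T) : joinSetoid S ≤ joinSetoid T := by
  rw [joinSetoid_eq_orbitSetoid, joinSetoid_eq_orbitSetoid]
  exact orbitSetoid_mono (Set.image_mono h)

/-- The component of the union of `T` which contains a component of the union of `S ⊆ T`. -/
def Components.map {S T : Set (Matching n)} (h : S ⊆ T) : Components S → Components T :=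
  Quotient.map id (fun _ _ hij => joinSetoid_mono h hij)

theorem Components.map_component {S T : Set (Matching n)} (h : S ⊆ T) (i : Fin (2 * n)) :
    Components.map h (component S i) = component T i := rfl

theorem bounds_iff {S T : Set (Matching n)} (h : S ⊆ T) {C : Components S} {K : Components T} :
    Bounds C K ↔ Components.map h C = K := by
  constructor
  · rintro ⟨i, rfl, rfl⟩
    rfl
  · rintro rfl
    obtain ⟨i, rfl⟩ := component_surjective S C
    exact ⟨i, rfl, rfl⟩

/-- The number of arcs of `b` with an endpoint in a set of points that is closed under `b`. -/
theorem ncard_arcs {b : Matching n} {P : Set (Fin (2 * n))}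
    (hP : ∀ i, b.partner i ∈ P ↔ i ∈ P) :
    {β : Arc b | β.left ∈ P}.ncard = classCount (orbitSetoid {b.partner}) P := by
  have hpair : ∀ {x y}, orbitSetoid {b.partner} x y → y = x ∨ y = b.partner x := by
    intro x y h
    have := (orbitSetoid_mem_iff (P := {x, b.partner x}) ?_ h).1 (by simp)
    · simpa using this
    · rintro f rfl z
      have := b.partner_partner z
      have := b.partner_partner x
      simp only [Set.mem_insert_iff, Set.mem_singleton_iff]
      grind
  unfold classCount
  refine Set.ncard_congr (fun β _ => Quotient.mk _ β.left) ?_ ?_ ?_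
  · exact fun β hβ => ⟨β.left, hβ, rfl⟩
  · intro β γ _ _ h
    have h' := hpair (Quotient.exact h)
    have h1 : β.left < b.partner β.left := β.2
    have h2 : γ.left < b.partner γ.left := γ.2
    have h3 := b.partner_partner β.left
    apply Subtype.ext
    change β.left = γ.left
    grind
  · rintro _ ⟨i, hi, rfl⟩
    rcases lt_or_gt_of_ne (b.partner_ne i) with h | h
    · refine ⟨⟨b.partner i, by rwa [b.partner_partner]⟩, (hP i).2 hi, ?_⟩
      exact Quotient.sound ((orbitSetoid _).symm (orbitSetoid_apply (Set.mem_singleton _) i))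
    · exact ⟨⟨i, h⟩, hi, rfl⟩

/-- The number of circles of `W(a)b`. -/
def circles (a b : Matching n) : ℕ := Nat.card (Circle a b)

theorem classCount_univ (S : Set (Matching n)) :
    classCount (orbitSetoid (Matching.partner '' S)) Set.univ = Nat.card (Components S) := by
  rw [← joinSetoid_eq_orbitSetoid]
  unfold classCount
  rw [Set.image_univ_of_surjective Quotient.mk_surjective, Set.ncard_univ]
  rfl

theorem classCount_univ_pair (a b : Matching n) :
    classCount (orbitSetoid {a.partner, b.partner}) Set.univ = circles a b := by
  rw [← Set.image_pair, classCount_univ]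
  rfl

theorem circles_comm (a b : Matching n) : circles a b = circles b a := by
  rw [← classCount_univ_pair, ← classCount_univ_pair, Set.pair_comm]

theorem classCount_univ_singleton (a : Matching n) :
    classCount (orbitSetoid {a.partner}) Set.univ = n := by
  have h1 : ∀ P : Set (Fin (2 * n)), (∀ i, a.partner i ∈ P ↔ i ∈ P) →
      2 * classCount (orbitSetoid {a.partner}) P = P.ncard := by
    intro P hP
    rw [← ncard_arcs hP]
    have hd : Disjoint ((fun β : Arc a => β.left) '' {β : Arc a | β.left ∈ P})
        ((fun β : Arc a => β.right) '' {β : Arc a | β.left ∈ P}) := by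
      rw [Set.disjoint_left]
      rintro _ ⟨β, -, rfl⟩ ⟨γ, -, hγ⟩
      have h1 : β.left < a.partner β.left := β.2
      have h2 : γ.left < a.partner γ.left := γ.2
      have h3 := a.partner_partner γ.left
      change a.partner γ.left = β.left at hγ
      grind
    have hu : P = (fun β : Arc a => β.left) '' {β : Arc a | β.left ∈ P} ∪
        (fun β : Arc a => β.right) '' {β : Arc a | β.left ∈ P} := by
      ext i
      constructor
      · intro hi
        rcases lt_or_gt_of_ne (a.partner_ne i) with h | h
        · exact Or.inr ⟨⟨a.partner i, by rwa [a.partner_partner]⟩, (hP i).2 hi,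
            a.partner_partner i⟩
        · exact Or.inl ⟨⟨i, h⟩, hi, rfl⟩
      · rintro (⟨β, hβ, rfl⟩ | ⟨β, hβ, rfl⟩)
        · exact hβ
        · exact (hP _).2 hβ
    have hfin : Finite (Arc a) := inferInstanceAs (Finite {i : Fin (2 * n) // i < a.partner i})
    conv_rhs => rw [hu]
    rw [Set.ncard_union_eq hd, Set.ncard_image_of_injective, Set.ncard_image_of_injective]
    · ring
    · intro β γ h
      have : a.partner (a.partner β.left) = a.partner (a.partner γ.left) := congrArg a.partner h
      rw [a.partner_partner, a.partner_partner] at this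
      exact Subtype.ext this
    · exact fun β γ h => Subtype.ext h
  have := h1 Set.univ (by simp)
  rw [Set.ncard_univ, Nat.card_fin] at this
  omega

theorem circles_self (a : Matching n) : circles a a = n := by
  rw [← classCount_univ_pair, Set.pair_eq_singleton, classCount_univ_singleton]

theorem card_cobordism_le (a b c : Matching n) : Nat.card (Cobordism a b c) ≤ circles a c :=
  Nat.card_le_card_of_surjective
    (Components.map (S := {a, c}) (T := {a, b, c}) (by grind)) (by
      intro K
      obtain ⟨i, rfl⟩ := component_surjective _ K
      exact ⟨component _ i, rfl⟩)

/-- The matchings `a` and `c` are equal if `W(a)c` has as many circles as there are arcs, and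
otherwise it has fewer. -/
theorem circles_lt {a c : Matching n} (h : a ≠ c) : circles a c < n := by
  obtain ⟨i, hi⟩ : ∃ i, a.partner i ≠ c.partner i := by
    by_contra hcon
    push Not at hcon
    exact h (Matching.ext (funext hcon))
  rw [← classCount_univ_pair]
  conv_rhs => rw [← classCount_univ_singleton a]
  have hni : ¬ orbitSetoid {a.partner} i (c.partner i) := by
    intro hcon
    have := (orbitSetoid_mem_iff (P := {i, a.partner i}) ?_ hcon).1 (by simp)
    · rcases this with h | h
      · exact c.partner_ne i h
      · exact hi (Set.mem_singleton_iff.1 h).symm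
    · rintro f rfl z
      have := a.partner_partner z
      have := a.partner_partner i
      simp only [Set.mem_insert_iff, Set.mem_singleton_iff]
      grind
  have h1 := classCount_merge (P := Set.univ) (Set.mem_univ _) (Set.mem_univ _) hni
  rw [← h1, Nat.lt_succ_iff]
  unfold classCount
  rw [Set.image_univ_of_surjective Quotient.mk_surjective,
    Set.image_univ_of_surjective Quotient.mk_surjective, Set.ncard_univ, Set.ncard_univ]
  have hle : mergeSetoid (orbitSetoid {a.partner}) i (c.partner i)
      ≤ orbitSetoid {a.partner, c.partner} :=
    mergeSetoid_le_iff.2 ⟨orbitSetoid_mono (by simp), orbitSetoid_apply (by simp) i⟩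
  refine Nat.card_le_card_of_surjective (Quotient.map id fun _ _ h => hle h) ?_
  intro u
  obtain ⟨x, rfl⟩ := Quotient.mk_surjective u
  exact ⟨Quotient.mk _ x, rfl⟩

theorem circles_le (a c : Matching n) : circles a c ≤ n := by
  rcases eq_or_ne a c with rfl | h
  · exact (circles_self a).le
  · exact (circles_lt h).le

/-! ### The Euler characteristic of the minimal cobordism -/

/-- Each component of the minimal cobordism, capped off, is a closed orientable surface. -/
theorem exists_closedEuler_eq {a b c : Matching n} (K : Cobordism a b c) :
    ∃ g : ℕ, closedEuler K = 2 - 2 * g := by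
  set P : Set (Fin (2 * n)) := {i | component {a, b, c} i = K} with hPdef
  have hP : ∀ m ∈ ({a, b, c} : Set (Matching n)), ∀ i, m.partner i ∈ P ↔ i ∈ P := by
    intro m hm i
    rw [hPdef, Set.mem_ofPred_eq, Set.mem_ofPred_eq, component_partner hm]
  have hcount : ∀ u v : Matching n,
      {C : Circle u v | Bounds C K}.ncard = classCount (orbitSetoid {u.partner, v.partner}) P := by
    intro u v
    unfold classCount
    rw [← Set.image_pair, ← joinSetoid_eq_orbitSetoid]
    congr 1
    ext C
    constructor
    · rintro ⟨i, hi, hi'⟩; exact ⟨i, hi', hi⟩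
    · rintro ⟨i, hi, hi'⟩; exact ⟨i, hi', hi⟩
  obtain ⟨g, hg⟩ := exists_genus a.isPairing b.isPairing a.colour_partner b.colour_partner
    (P := P) (hP a (by simp)) (hP b (by simp)) c.isPairing c.colour_partner (hP c (by simp))
  have h1 : classCount (orbitSetoid {a.partner, b.partner, c.partner}) P = 1 := by
    have : ({a.partner, b.partner, c.partner} : Set (Fin (2 * n) → Fin (2 * n)))
      = Matching.partner '' {a, b, c} := by simp [Set.image_insert_eq]
    unfold classCount
    rw [this, ← joinSetoid_eq_orbitSetoid, Set.ncard_eq_one]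
    refine ⟨K, ?_⟩
    ext u
    constructor
    · rintro ⟨i, hi, rfl⟩; exact hi
    · rintro rfl
      obtain ⟨i, rfl⟩ := component_surjective _ u
      exact ⟨i, rfl, rfl⟩
  have h2 : {α : Arc b | component {a, b, c} α.left = K}.ncard
      = classCount (orbitSetoid {b.partner}) P := ncard_arcs (hP b (by simp))
  refine ⟨g, ?_⟩
  unfold closedEuler
  rw [hcount, hcount, hcount, h2]
  omega

/-! ### Gluing closed surfaces -/

/-- Neck cutting along a circle which separates two surfaces of genus `g₁` and `g₂` with `d₁` and `d₂`
dots. -/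
theorem closedValue_neck (g₁ g₂ d₁ d₂ : ℕ) :
    closedValue (2 - 2 * g₁) (d₁ + 1) * closedValue (2 - 2 * g₂) d₂
      + closedValue (2 - 2 * g₁) d₁ * closedValue (2 - 2 * g₂) (d₂ + 1)
      = closedValue ((2 - 2 * g₁) + (2 - 2 * g₂) - 2) (d₁ + d₂) := by
  unfold closedValue
  rcases g₁ with _ | _ | g₁ <;> rcases g₂ with _ | _ | g₂ <;> rcases d₁ with _ | _ | d₁ <;>
    rcases d₂ with _ | _ | d₂ <;> simp <;> omega

/-- Neck cutting along a circle which does not separate: a handle equals two dots. -/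
theorem closedValue_handle (g d : ℕ) :
    closedValue (2 - 2 * g) (d + 1) + closedValue (2 - 2 * g) (d + 1)
      = closedValue (2 - 2 * g - 2) d := by
  unfold closedValue
  rcases g with _ | _ | g <;> rcases d with _ | d <;> simp <;> omega

section Gluing

variable {V E : Type*} [Fintype V]

/-- The evaluation of the closed surfaces which arise from surfaces with Euler characteristics
`χ v` and `D v` dots by attaching a tube from `s e` to `t e` for all `e ∈ F`, where the fibres of
`p` are the connected components of the result. Each tube lowers the Euler characteristic by two. -/
def gluedValue (s : E → V) (χ : V → ℤ) (F : Finset E) (p : V → V) (D : V → ℕ) : ℤ :=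
  ∏ l ∈ Finset.univ.image p,
    closedValue ((∑ v, if p v = l then χ v else 0) - 2 * ∑ e ∈ F, if p (s e) = l then 1 else 0)
      (∑ v, if p v = l then D v else 0)

set_option maxHeartbeats 1000000 in
/-- Neck cutting: a tube is the sum of the two ways to replace it by two disks one of which carries a
dot, as `Δ(1) = 1 ⊗ X + X ⊗ 1`. The set `U` consists of the tubes whose dot lies at `t e`; the value
of `p` at a vertex is a representative of its connected component. -/
theorem sum_powerset_prod_closedValue (s t : E → V) (χ : V → ℤ)
    (hχ : ∀ v, ∃ g : ℕ, χ v = 2 - 2 * g) (F : Finset E) :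
    ∃ p : V → V,
      (∀ v w, p v = p w ↔ Relation.EqvGen (fun v w => ∃ e ∈ F, s e = v ∧ t e = w) v w) ∧
      (∀ l ∈ Finset.univ.image p, ∃ g : ℕ, (∑ v, if p v = l then χ v else 0)
        - 2 * (∑ e ∈ F, if p (s e) = l then (1 : ℤ) else 0) = 2 - 2 * g) ∧
      ∀ D : V → ℕ,
        ∑ U ∈ F.powerset, ∏ v, closedValue (χ v)
          (D v + ∑ e ∈ F, if (if e ∈ U then t e else s e) = v then 1 else 0)
        = gluedValue s χ F p D := by
  induction F using Finset.induction_on with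
  | empty =>
    refine ⟨id, fun v w => ⟨?_, ?_⟩, ?_, ?_⟩
    · rintro rfl; exact Relation.EqvGen.refl _
    · intro h
      induction h with
      | rel x y h => simp at h
      | refl => rfl
      | symm _ _ _ ih => exact ih.symm
      | trans _ _ _ _ _ ih1 ih2 => exact ih1.trans ih2
    · intro l _
      simpa using hχ l
    · intro D
      simp [gluedValue]
  | insert e F he ih =>
    obtain ⟨p, hp, hg, hZ⟩ := ih
    have hmono : ∀ v w, Relation.EqvGen (fun v w => ∃ e ∈ F, s e = v ∧ t e = w) v w →
        Relation.EqvGen (fun v w => ∃ e' ∈ insert e F, s e' = v ∧ t e' = w) v w := by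
      intro v w h
      refine Relation.EqvGen.mono (r := fun v w => ∃ e ∈ F, s e = v ∧ t e = w) ?_ _ _ h
      rintro x y ⟨e', he', h⟩
      exact ⟨e', Finset.mem_insert_of_mem he', h⟩
    have hnew : Relation.EqvGen (fun v w => ∃ e' ∈ insert e F, s e' = v ∧ t e' = w) (s e) (t e) :=
      Relation.EqvGen.rel _ _ ⟨e, Finset.mem_insert_self _ _, rfl, rfl⟩
    have hLHS : ∀ D : V → ℕ,
        ∑ U ∈ (insert e F).powerset, ∏ v, closedValue (χ v)
          (D v + ∑ e' ∈ insert e F, if (if e' ∈ U then t e' else s e') = v then 1 else 0)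
        = gluedValue s χ F p (fun v => D v + if s e = v then 1 else 0)
          + gluedValue s χ F p (fun v => D v + if t e = v then 1 else 0) := by
      intro D
      rw [Finset.sum_powerset_insert he, ← hZ, ← hZ]
      congr 1
      · refine Finset.sum_congr rfl fun U hU => Finset.prod_congr rfl fun v _ => ?_
        have heU : e ∉ U := fun h => he (Finset.mem_powerset.1 hU h)
        rw [Finset.sum_insert he, if_neg heU, add_assoc]
      · refine Finset.sum_congr rfl fun U hU => Finset.prod_congr rfl fun v _ => ?_
        rw [Finset.sum_insert he, if_pos (Finset.mem_insert_self _ _), add_assoc]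
        congr 3
        refine Finset.sum_congr rfl fun e' he' => ?_
        have : e' ≠ e := fun h => he (h ▸ he')
        simp [this]
    have hmem : ∀ v, p v ∈ Finset.univ.image p := fun v =>
      Finset.mem_image_of_mem _ (Finset.mem_univ _)
    have hδ : ∀ (D : V → ℕ) (x l : V),
        (∑ v, if p v = l then (D v + if x = v then 1 else 0) else 0)
        = (∑ v, if p v = l then D v else 0) + if p x = l then 1 else 0 := by
      intro D x l
      have : ∀ v, (if p v = l then (D v + if x = v then 1 else 0) else 0)
          = (if p v = l then D v else 0) + if x = v then (if p x = l then 1 else 0) else 0 := by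
        intro v
        split_ifs <;> simp_all
      simp_rw [this, Finset.sum_add_distrib, Finset.sum_ite_eq, Finset.mem_univ, if_true]
    simp only [hLHS]
    by_cases hst : p (s e) = p (t e)
    · -- the tube `e` is a handle of the component of `s e`
      have hχ' : ∀ l, (∑ v, if p v = l then χ v else 0)
          - 2 * (∑ e' ∈ insert e F, if p (s e') = l then (1 : ℤ) else 0)
          = (∑ v, if p v = l then χ v else 0) - 2 * (∑ e' ∈ F, if p (s e') = l then (1 : ℤ) else 0)
            - if p (s e) = l then 2 else 0 := by
        intro l
        rw [Finset.sum_insert he]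
        split_ifs <;> ring
      refine ⟨p, fun v w => ⟨fun h => hmono _ _ ((hp v w).1 h), ?_⟩, ?_, ?_⟩
      · intro h
        induction h with
        | rel x y h =>
          obtain ⟨e', he', rfl, rfl⟩ := h
          rcases Finset.mem_insert.1 he' with rfl | he'
          · exact hst
          · exact (hp _ _).2 (Relation.EqvGen.rel _ _ ⟨e', he', rfl, rfl⟩)
        | refl => rfl
        | symm _ _ _ ih => exact ih.symm
        | trans _ _ _ _ _ ih1 ih2 => exact ih1.trans ih2
      · intro l hl
        obtain ⟨g, hg⟩ := hg l hl
        rw [hχ', hg]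
        split_ifs
        · exact ⟨g + 1, by push_cast; ring⟩
        · exact ⟨g, by ring⟩
      · intro D
        unfold gluedValue
        rw [← Finset.mul_prod_erase _ _ (hmem (s e)), ← Finset.mul_prod_erase _ _ (hmem (s e)),
          ← Finset.mul_prod_erase _ _ (hmem (s e))]
        simp only [hδ, hχ', ← hst, if_true]
        have hrest : ∀ l ∈ (Finset.univ.image p).erase (p (s e)), p (s e) ≠ l := fun l hl h =>
          (Finset.mem_erase.1 hl).1 h.symm
        obtain ⟨g, hg⟩ := hg _ (hmem (s e))
        rw [hg, ← closedValue_handle, add_mul]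
        congr 1 <;>
        · congr 1
          refine Finset.prod_congr rfl fun l hl => ?_
          simp [hrest l hl]
    · -- the tube `e` connects two components, and `p'` maps their union to the representative of
      -- the component of `s e`
      let p' : V → V := fun v => if p v = p (t e) then p (s e) else p v
      have hif : ∀ {M : Type} [AddCommMonoid M] (v : V) (m : M),
          (if p' v = p (s e) then m else 0)
          = (if p v = p (s e) then m else 0) + if p v = p (t e) then m else 0 := by
        intro M _ v m
        by_cases h : p v = p (t e)
        · simp [p', h, Ne.symm hst]
        · simp [p', h]
      have hif' : ∀ (v l : V), l ≠ p (s e) → l ≠ p (t e) → (p' v = l ↔ p v = l) := by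
        intro v l h1 h2
        by_cases h : p v = p (t e)
        · simp [p', h, h1.symm, h2.symm]
        · simp [p', h]
      have hp'1 : ∀ {M : Type} [AddCommMonoid M] (f : V → M),
          (∑ v, if p' v = p (s e) then f v else 0)
          = (∑ v, if p v = p (s e) then f v else 0) + ∑ v, if p v = p (t e) then f v else 0 := by
        intro M _ f
        rw [← Finset.sum_add_distrib]
        refine Finset.sum_congr rfl fun v _ => ?_
        exact hif v (f v)
      have hp'2 : ∀ {M : Type} [AddCommMonoid M] (f : V → M) (l : V), l ≠ p (s e) → l ≠ p (t e) →
          (∑ v, if p' v = l then f v else 0) = ∑ v, if p v = l then f v else 0 := by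
        intro M _ f l h1 h2
        refine Finset.sum_congr rfl fun v _ => ?_
        simp only [hif' v l h1 h2]
      have hχ1 : (∑ v, if p' v = p (s e) then χ v else 0)
          - 2 * (∑ e' ∈ insert e F, if p' (s e') = p (s e) then (1 : ℤ) else 0)
          = ((∑ v, if p v = p (s e) then χ v else 0)
              - 2 * (∑ e' ∈ F, if p (s e') = p (s e) then (1 : ℤ) else 0))
            + ((∑ v, if p v = p (t e) then χ v else 0)
              - 2 * (∑ e' ∈ F, if p (s e') = p (t e) then (1 : ℤ) else 0)) - 2 := by
        have h1 : (∑ e' ∈ F, if p' (s e') = p (s e) then (1 : ℤ) else 0)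
            = (∑ e' ∈ F, if p (s e') = p (s e) then (1 : ℤ) else 0)
              + ∑ e' ∈ F, if p (s e') = p (t e) then (1 : ℤ) else 0 := by
          rw [← Finset.sum_add_distrib]
          exact Finset.sum_congr rfl fun v _ => hif (s v) 1
        rw [Finset.sum_insert he, hp'1, h1]
        have : p' (s e) = p (s e) := by simp [p']
        rw [this, if_pos rfl]
        ring
      have hχ2 : ∀ l, l ≠ p (s e) → l ≠ p (t e) → (∑ v, if p' v = l then χ v else 0)
          - 2 * (∑ e' ∈ insert e F, if p' (s e') = l then (1 : ℤ) else 0)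
          = (∑ v, if p v = l then χ v else 0)
            - 2 * (∑ e' ∈ F, if p (s e') = l then (1 : ℤ) else 0) := by
        intro l h1 h2
        have h3 : (∑ e' ∈ F, if p' (s e') = l then (1 : ℤ) else 0)
            = (∑ e' ∈ F, if p (s e') = l then (1 : ℤ) else 0) := by
          refine Finset.sum_congr rfl fun v _ => ?_
          simp only [hif' (s v) l h1 h2]
        rw [Finset.sum_insert he, hp'2 _ _ h1 h2, h3]
        have : p' (s e) = p (s e) := by simp [p']
        rw [this, if_neg h1.symm, zero_add]
      have himg : Finset.univ.image p' = (Finset.univ.image p).erase (p (t e)) := by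
        ext l
        simp only [Finset.mem_image, Finset.mem_univ, true_and, Finset.mem_erase, p']
        constructor
        · rintro ⟨v, rfl⟩
          split_ifs with h
          · exact ⟨hst, s e, rfl⟩
          · exact ⟨h, v, rfl⟩
        · rintro ⟨h, v, rfl⟩
          exact ⟨v, by simp [h]⟩
      have hms : p (s e) ∈ (Finset.univ.image p).erase (p (t e)) :=
        Finset.mem_erase.2 ⟨hst, hmem _⟩
      obtain ⟨g₁, hg₁⟩ := hg _ (hmem (s e))
      obtain ⟨g₂, hg₂⟩ := hg _ (hmem (t e))
      refine ⟨p', fun v w => ⟨fun h => ?_, fun h => ?_⟩, ?_, ?_⟩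
      · have hcl : ∀ v, Relation.EqvGen (fun v w => ∃ e' ∈ insert e F, s e' = v ∧ t e' = w) v
            (if p v = p (t e) then s e else v) := by
          intro v
          split_ifs with h
          · exact (hmono _ _ ((hp _ _).1 h)).trans _ _ _ (hnew.symm _ _)
          · exact Relation.EqvGen.refl _
        have hpp : p (if p v = p (t e) then s e else v) = p (if p w = p (t e) then s e else w) := by
          simp only [p'] at h
          split_ifs at h ⊢ <;> simp_all
        exact ((hcl v).trans _ _ _ (hmono _ _ ((hp _ _).1 hpp))).trans _ _ _
          ((hcl w).symm _ _)
      · induction h with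
        | rel x y h =>
          obtain ⟨e', he', rfl, rfl⟩ := h
          rcases Finset.mem_insert.1 he' with rfl | he'
          · simp [p']
          · have := (hp _ _).2 (Relation.EqvGen.rel _ _ ⟨e', he', rfl, rfl⟩)
            simp [p', this]
        | refl => rfl
        | symm _ _ _ ih => exact ih.symm
        | trans _ _ _ _ _ ih1 ih2 => exact ih1.trans ih2
      · intro l hl
        rw [himg] at hl
        obtain ⟨hl2, hl⟩ := Finset.mem_erase.1 hl
        by_cases hl1 : l = p (s e)
        · rw [hl1, hχ1, hg₁, hg₂]
          exact ⟨g₁ + g₂, by push_cast; ring⟩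
        · rw [hχ2 l hl1 hl2]
          exact hg l hl
      · intro D
        unfold gluedValue
        rw [himg, ← Finset.mul_prod_erase _ _ (hmem (t e)), ← Finset.mul_prod_erase _ _ (hmem (t e)),
          ← Finset.mul_prod_erase _ _ hms, ← Finset.mul_prod_erase _ _ hms,
          ← Finset.mul_prod_erase _ _ hms]
        simp only [hδ, if_true, hst, Ne.symm hst, if_false, add_zero]
        rw [hχ1, hp'1, hg₁, hg₂, ← closedValue_neck, add_mul]
        have hrest : ∀ l ∈ ((Finset.univ.image p).erase (p (t e))).erase (p (s e)),
            l ≠ p (s e) ∧ l ≠ p (t e) := fun l hl =>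
          ⟨(Finset.mem_erase.1 hl).1, (Finset.mem_erase.1 (Finset.mem_erase.1 hl).2).1⟩
        rw [← mul_assoc, ← mul_assoc]
        congr 1
        · congr 1
          · ring
          · refine Finset.prod_congr rfl fun l hl => ?_
            rw [hχ2 l (hrest l hl).1 (hrest l hl).2, hp'2 _ l (hrest l hl).1 (hrest l hl).2,
              if_neg (hrest l hl).1.symm, add_zero]
        · congr 1
          · ring
          · refine Finset.prod_congr rfl fun l hl => ?_
            rw [hχ2 l (hrest l hl).1 (hrest l hl).2, hp'2 _ l (hrest l hl).1 (hrest l hl).2,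
              if_neg (hrest l hl).2.symm, add_zero]

/-- Neck cutting of all tubes of a closed surface, with the components of the surface indexed by
a given type `L`. -/
theorem sum_prod_closedValue_eq [Fintype E] [Fintype (Set E)] {L : Type*} [Fintype L] (s t : E → V)
    (χ : V → ℤ) (hχ : ∀ v, ∃ g : ℕ, χ v = 2 - 2 * g) (q : V → L) (hq : Function.Surjective q)
    (hker : ∀ v w, q v = q w ↔ Relation.EqvGen (fun v w => ∃ e, s e = v ∧ t e = w) v w)
    (D : V → ℕ) :
    ∑ U : Set E, ∏ v, closedValue (χ v)
        (D v + ∑ e, if (if e ∈ U then t e else s e) = v then 1 else 0)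
      = ∏ l : L, closedValue
        ((∑ v, if q v = l then χ v else 0) - 2 * ∑ e, if q (s e) = l then 1 else 0)
        (∑ v, if q v = l then D v else 0) := by
  obtain ⟨p, hp, -, hsum⟩ := sum_powerset_prod_closedValue s t χ hχ Finset.univ
  have hpq : ∀ v w, p v = p w ↔ q v = q w := by
    intro v w
    rw [hp, hker]
    simp
  have h1 : ∑ U : Set E, ∏ v, closedValue (χ v)
        (D v + ∑ e, if (if e ∈ U then t e else s e) = v then 1 else 0)
      = ∑ U ∈ (Finset.univ : Finset E).powerset, ∏ v, closedValue (χ v)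
        (D v + ∑ e, if (if e ∈ U then t e else s e) = v then 1 else 0) := by
    rw [Finset.powerset_univ]
    refine Fintype.sum_equiv Fintype.finsetEquivSet.symm _ _ fun U => ?_
    simp
  rw [h1, hsum, gluedValue]
  symm
  let f : L → V := fun l => p (Function.surjInv hq l)
  have hf : ∀ v, f (q v) = p v := fun v => (hpq _ _).2 (Function.surjInv_eq hq (q v))
  have hfl : ∀ v l, p v = f l ↔ q v = l := by
    intro v l
    rw [hpq, Function.surjInv_eq hq l]
  have hinj : Function.Injective f := by
    intro l l' h
    obtain ⟨v, rfl⟩ := hq l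
    rwa [hf, hfl] at h
  have himg : Finset.univ.image p = Finset.univ.image f := by
    ext x
    simp only [Finset.mem_image, Finset.mem_univ, true_and]
    constructor
    · rintro ⟨v, rfl⟩; exact ⟨q v, hf v⟩
    · rintro ⟨l, rfl⟩; exact ⟨_, rfl⟩
  rw [himg, Finset.prod_image fun _ _ _ _ h => hinj h]
  simp only [hfl]

end Gluing

theorem ncard_eq_sum {α : Type*} [Fintype α] (P : α → Prop) :
    {x | P x}.ncard = ∑ x, if P x then 1 else 0 := by
  rw [Set.ncard_eq_toFinset_card', Finset.sum_boole]
  simp [Set.toFinset_ofPred]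

theorem sum_ncard_fiber {α β γ : Type*} [Finite α] [Fintype β] (P : α → Prop) (f : α → β)
    (g : β → γ) (l : γ) :
    (∑ k : β, if g k = l then {x | P x ∧ f x = k}.ncard else 0)
      = {x | P x ∧ g (f x) = l}.ncard := by
  have : Fintype α := Fintype.ofFinite α
  have h : ∀ k, (if g k = l then {x | P x ∧ f x = k}.ncard else 0)
      = ∑ x, if f x = k then (if P x ∧ g (f x) = l then 1 else 0) else 0 := by
    intro k
    rw [ncard_eq_sum]
    split_ifs with hk
    · refine Finset.sum_congr rfl fun x _ => ?_
      split_ifs <;> grind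
    · symm
      refine Finset.sum_eq_zero fun x _ => ?_
      split_ifs <;> grind
  simp only [h]
  rw [Finset.sum_comm, ncard_eq_sum]
  refine Finset.sum_congr rfl fun x _ => ?_
  rw [Finset.sum_ite_eq, if_pos (Finset.mem_univ _)]
  split_ifs <;> rfl

theorem sum_ncard_bounds {R S T : Set (Matching n)} (hRS : R ⊆ S) (hST : S ⊆ T)
    (P : Components R → Prop) (L : Components T) :
    (∑ K : Components S, if Components.map hST K = L then {C | P C ∧ Bounds C K}.ncard else 0)
      = {C | P C ∧ Bounds C L}.ncard := by
  have h : ∀ C : Components R,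
      Components.map hST (Components.map hRS C) = Components.map (hRS.trans hST) C := by
    intro C
    obtain ⟨i, rfl⟩ := component_surjective _ C
    rfl
  simp only [bounds_iff hRS, bounds_iff (hRS.trans hST), ← h]
  exact sum_ncard_fiber P (Components.map hRS) (Components.map hST) L

instance (a : Matching n) : Finite (Arc a) :=
  inferInstanceAs (Finite {i : Fin (2 * n) // i < a.partner i})

theorem sum_ncard_arcs {S T : Set (Matching n)} (hST : S ⊆ T) (b : Matching n)
    (L : Components T) :
    (∑ K : Components S, if Components.map hST K = L then
      {α : Arc b | component S α.left = K}.ncard else 0)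
      = {α : Arc b | component T α.left = L}.ncard := by
  have := sum_ncard_fiber (fun _ : Arc b => True) (fun α => component S α.left)
    (Components.map hST) L
  simpa [Components.map_component] using this

/-- Two cobordisms with components indexed by `S₁` and `S₂` are glued along the circles `S₀`: the sum
over all labels of these circles evaluates the glued surface, with components indexed by `T`. -/
theorem sum_prod_closedValue_glue {S₀ S₁ S₂ T : Set (Matching n)} (h₁ : S₀ ⊆ S₁) (h₂ : S₀ ⊆ S₂)
    (h₁T : S₁ ⊆ T) (h₂T : S₂ ⊆ T) (hT : T ⊆ S₁ ∪ S₂) [Fintype (Set (Components S₀))]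
    (χ₁ : Components S₁ → ℤ) (χ₂ : Components S₂ → ℤ) (hχ₁ : ∀ K, ∃ g : ℕ, χ₁ K = 2 - 2 * g)
    (hχ₂ : ∀ K, ∃ g : ℕ, χ₂ K = 2 - 2 * g) (d₁ : Components S₁ → ℕ) (d₂ : Components S₂ → ℕ) :
    ∑ U : Set (Components S₀),
      (∏ K, closedValue (χ₁ K) (d₁ K + {C : Components S₀ | C ∉ U ∧ Bounds C K}.ncard)) *
        ∏ K, closedValue (χ₂ K) (d₂ K + {C : Components S₀ | C ∈ U ∧ Bounds C K}.ncard)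
      = ∏ L : Components T, closedValue
        ((∑ K, if Components.map h₁T K = L then χ₁ K else 0)
          + (∑ K, if Components.map h₂T K = L then χ₂ K else 0)
          - 2 * {C : Components S₀ | Bounds C L}.ncard)
        ((∑ K, if Components.map h₁T K = L then d₁ K else 0)
          + ∑ K, if Components.map h₂T K = L then d₂ K else 0) := by
  let s : Components S₀ → Components S₁ ⊕ Components S₂ := fun C => Sum.inl (Components.map h₁ C)
  let t : Components S₀ → Components S₁ ⊕ Components S₂ := fun C => Sum.inr (Components.map h₂ C)
  let q : Components S₁ ⊕ Components S₂ → Components T :=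
    Sum.elim (Components.map h₁T) (Components.map h₂T)
  have hq : Function.Surjective q := by
    intro L
    obtain ⟨i, rfl⟩ := component_surjective _ L
    exact ⟨Sum.inl (component _ i), rfl⟩
  -- the components of `T` are the connected components of the graph whose vertices are the
  -- components of `S₁` and `S₂` and whose edges are those of `S₀`
  set r := Relation.EqvGen.setoid (fun v w => ∃ C, s C = v ∧ t C = w) with hr
  have hst : ∀ i, r (Sum.inl (component S₁ i)) (Sum.inr (component S₂ i)) := fun i =>
    Relation.EqvGen.rel _ _ ⟨component S₀ i, rfl, rfl⟩
  have hq1 : ∀ i j, joinSetoid T i j →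
      r (Sum.inl (component S₁ i)) (Sum.inl (component S₁ j)) := by
    intro i j hij
    have hle : joinSetoid T ≤ Setoid.comap (fun i => Sum.inl (component S₁ i)) r := by
      refine joinSetoid_le_iff.2 fun m hm i => ?_
      change r (Sum.inl (component S₁ i)) (Sum.inl (component S₁ (m.partner i)))
      rcases hT hm with hm | hm
      · rw [component_partner hm]
      · refine r.trans (hst i) (r.trans ?_ (r.symm (hst _)))
        rw [component_partner hm]
    exact hle hij
  have hrep : ∀ v, ∃ i, r v (Sum.inl (component S₁ i)) ∧ q v = component T i := by
    rintro (K | K)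
    · obtain ⟨i, rfl⟩ := component_surjective _ K
      exact ⟨i, r.refl _, rfl⟩
    · obtain ⟨i, rfl⟩ := component_surjective _ K
      exact ⟨i, r.symm (hst i), rfl⟩
  have hker : ∀ v w, q v = q w ↔ Relation.EqvGen (fun v w => ∃ C, s C = v ∧ t C = w) v w := by
    intro v w
    constructor
    · intro h
      obtain ⟨i, hi, hi'⟩ := hrep v
      obtain ⟨j, hj, hj'⟩ := hrep w
      rw [hi', hj', component_eq_iff] at h
      exact r.trans hi (r.trans (hq1 i j h) (r.symm hj))
    · intro h
      induction h with
      | rel x y h =>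
        obtain ⟨C, rfl, rfl⟩ := h
        obtain ⟨i, rfl⟩ := component_surjective _ C
        rfl
      | refl => rfl
      | symm _ _ _ ih => exact ih.symm
      | trans _ _ _ _ _ ih1 ih2 => exact ih1.trans ih2
  have hχ : ∀ v, ∃ g : ℕ, Sum.elim χ₁ χ₂ v = 2 - 2 * g := by
    rintro (K | K)
    · exact hχ₁ K
    · exact hχ₂ K
  have key := sum_prod_closedValue_eq s t (Sum.elim χ₁ χ₂) hχ q hq hker (Sum.elim d₁ d₂)
  simp only [Fintype.prod_sum_type, Fintype.sum_sum_type, Sum.elim_inl, Sum.elim_inr, q] at key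
  convert key using 2 with U _ L _
  · congr 1
    · refine Finset.prod_congr rfl fun K _ => ?_
      congr 2
      rw [ncard_eq_sum]
      refine Finset.sum_congr rfl fun C _ => ?_
      rw [bounds_iff h₁]
      by_cases hC : C ∈ U <;> simp [hC, s, t]
    · refine Finset.prod_congr rfl fun K _ => ?_
      congr 2
      rw [ncard_eq_sum]
      refine Finset.sum_congr rfl fun C _ => ?_
      rw [bounds_iff h₂]
      by_cases hC : C ∈ U <;> simp [hC, s, t]
  · congr 2
    rw [ncard_eq_sum]
    push_cast
    congr 1
    refine Finset.sum_congr rfl fun C _ => ?_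
    have : Components.map h₁T (Components.map h₁ C) = Components.map (h₁.trans h₁T) C := by
      obtain ⟨i, rfl⟩ := component_surjective _ C
      rfl
    rw [bounds_iff (h₁.trans h₁T), ← this]
    simp only [s, Sum.elim_inl]
    congr

/-! ### Associativity -/

theorem sum_ite_add {α M : Type*} [Fintype α] [AddCommMonoid M] (P : α → Prop) (f g : α → M) :
    (∑ x, if P x then f x + g x else 0)
      = (∑ x, if P x then f x else 0) + ∑ x, if P x then g x else 0 := by
  rw [← Finset.sum_add_distrib]
  refine Finset.sum_congr rfl fun x _ => ?_
  split_ifs <;> simp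

/-- The capped components of the minimal cobordism which lie in a component `L` of a larger union of
matchings. -/
theorem sum_closedEuler {a b c : Matching n} {T : Set (Matching n)}
    (hT : ({a, b, c} : Set (Matching n)) ⊆ T) (L : Components T) :
    (∑ K : Cobordism a b c, if Components.map hT K = L then closedEuler K else 0)
      = ({C : Circle a b | Bounds C L}.ncard + {C : Circle b c | Bounds C L}.ncard
        + {C : Circle a c | Bounds C L}.ncard : ℤ)
        - {α : Arc b | component T α.left = L}.ncard := by
  have h : ∀ {R : Set (Matching n)} (_ : R ⊆ {a, b, c}), (∑ K : Cobordism a b c,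
      if Components.map hT K = L then ({C : Components R | Bounds C K}.ncard : ℤ) else 0)
      = {C : Components R | Bounds C L}.ncard := by
    intro R hR
    have := sum_ncard_bounds hR hT (fun _ => True) L
    simp only [true_and] at this
    exact_mod_cast this
  have h' := sum_ncard_arcs hT b L
  rw [← h (R := {a, b}) (by grind), ← h (R := {b, c}) (by grind), ← h (R := {a, c}) (by grind), ← h']
  push_cast
  rw [← sum_ite_add, ← sum_ite_add, ← Finset.sum_sub_distrib]
  refine Finset.sum_congr rfl fun K _ => ?_
  unfold closedEuler
  split_ifs <;> simp

/-- Both sides evaluate the surface which is glued from two cobordisms and capped off, and whose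
components are those of `a ∪ b ∪ c ∪ d`; their Euler characteristics and dots do not depend on whether
the cobordisms are glued along the circles of `W(a)c` or of `W(b)d`. -/
theorem structureConst_assoc {a b c d : Matching n} (S : Set (Circle a b)) (T : Set (Circle b c))
    (V : Set (Circle c d)) (W : Set (Circle a d)) :
    ∑ U : Set (Circle a c), structureConst S T U * structureConst U V W
      = ∑ U : Set (Circle b d), structureConst T V U * structureConst S U W := by
  have hsub : ∀ {x y z : Matching n}, x ∈ ({a, b, c, d} : Set (Matching n)) →
      y ∈ ({a, b, c, d} : Set (Matching n)) → z ∈ ({a, b, c, d} : Set (Matching n)) →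
      ({x, y, z} : Set (Matching n)) ⊆ {a, b, c, d} := by
    intro x y z hx hy hz
    simp [Set.insert_subset_iff, hx, hy, hz]
  have habc : ({a, b, c} : Set (Matching n)) ⊆ {a, b, c, d} := hsub (by simp) (by simp) (by simp)
  have hacd : ({a, c, d} : Set (Matching n)) ⊆ {a, b, c, d} := hsub (by simp) (by simp) (by simp)
  have hbcd : ({b, c, d} : Set (Matching n)) ⊆ {a, b, c, d} := hsub (by simp) (by simp) (by simp)
  have habd : ({a, b, d} : Set (Matching n)) ⊆ {a, b, c, d} := hsub (by simp) (by simp) (by simp)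
  have g1 := sum_prod_closedValue_glue (S₀ := {a, c}) (S₁ := {a, b, c}) (S₂ := {a, c, d})
    (T := {a, b, c, d}) (by grind) (by grind) habc hacd (by grind) closedEuler closedEuler
    exists_closedEuler_eq exists_closedEuler_eq
    (fun K => {C : Circle a b | C ∈ S ∧ Bounds C K}.ncard
      + {C : Circle b c | C ∈ T ∧ Bounds C K}.ncard)
    (fun K => {C : Circle c d | C ∈ V ∧ Bounds C K}.ncard
      + {C : Circle a d | C ∉ W ∧ Bounds C K}.ncard)
  have g2 := sum_prod_closedValue_glue (S₀ := {b, d}) (S₁ := {b, c, d}) (S₂ := {a, b, d})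
    (T := {a, b, c, d}) (by grind) (by grind) hbcd habd (by grind) closedEuler closedEuler
    exists_closedEuler_eq exists_closedEuler_eq
    (fun K => {C : Circle b c | C ∈ T ∧ Bounds C K}.ncard
      + {C : Circle c d | C ∈ V ∧ Bounds C K}.ncard)
    (fun K => {C : Circle a b | C ∈ S ∧ Bounds C K}.ncard
      + {C : Circle a d | C ∉ W ∧ Bounds C K}.ncard)
  refine (Finset.sum_congr rfl fun U _ => ?_).trans
    (g1.trans (Eq.trans ?_ (g2.symm.trans (Finset.sum_congr rfl fun U _ => ?_))))
  · unfold structureConst dots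
    congr 1
    refine Finset.prod_congr rfl fun K _ => ?_
    congr 1
    ring
  rotate_left
  · unfold structureConst dots
    congr 1
    refine Finset.prod_congr rfl fun K _ => ?_
    congr 1
    ring
  refine Finset.prod_congr rfl fun L _ => ?_
  congr 1
  · simp only [sum_closedEuler]
    ring
  · simp only [sum_ite_add]
    rw [sum_ncard_bounds (by grind), sum_ncard_bounds (by grind), sum_ncard_bounds (by grind),
      sum_ncard_bounds (by grind), sum_ncard_bounds (by grind), sum_ncard_bounds (by grind),
      sum_ncard_bounds (by grind), sum_ncard_bounds (by grind)]
    ring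

theorem sum_rotate {α β γ M : Type*} [Fintype α] [Fintype β] [Fintype γ] [AddCommMonoid M]
    (f : α → β → γ → M) : ∑ x, ∑ y, ∑ z, f x y z = ∑ z, ∑ x, ∑ y, f x y z :=
  (Finset.sum_congr rfl fun _ _ => Finset.sum_comm).trans Finset.sum_comm

theorem ArcAlgebra.mul_assoc (x y z : ArcAlgebra n) : x * y * z = x * (y * z) := by
  funext a d W
  simp only [ArcAlgebra.mul_apply, Finset.sum_mul, Finset.mul_sum]
  -- both sides are sums over `b, c, S, T, V` and the labels `U` of the circles glued first
  trans ∑ b : Matching n, ∑ c : Matching n, ∑ S : Set (Circle a b), ∑ T : Set (Circle b c),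
    ∑ V : Set (Circle c d), ∑ U : Set (Circle a c),
      x a b S * y b c T * structureConst S T U * z c d V * structureConst U V W
  · rw [Finset.sum_comm (s := Finset.univ (α := Matching n))]
    refine Finset.sum_congr rfl fun c _ => ?_
    rw [sum_rotate]
    refine Finset.sum_congr rfl fun b _ => ?_
    rw [sum_rotate]
    refine Finset.sum_congr rfl fun S _ => ?_
    rw [sum_rotate]
    refine Finset.sum_congr rfl fun T _ => ?_
    rw [Finset.sum_comm]
  · refine Finset.sum_congr rfl fun b _ => ?_
    rw [sum_rotate]
    refine Finset.sum_congr rfl fun c _ => ?_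
    refine Finset.sum_congr rfl fun S _ => ?_
    refine Eq.trans ?_ (sum_rotate _)
    refine Finset.sum_congr rfl fun T _ => ?_
    refine Finset.sum_congr rfl fun V _ => ?_
    have := congrArg (fun k => x a b S * y b c T * z c d V * k) (structureConst_assoc S T V W)
    simp only [Finset.mul_sum] at this
    convert this using 1
    · exact Finset.sum_congr rfl fun U _ => by ring
    · exact Finset.sum_congr rfl fun U _ => by ring

/-! ### The grading -/

theorem sum_ncard_bounds_univ {R S : Set (Matching n)} (hRS : R ⊆ S) (P : Components R → Prop) :
    ∑ K : Components S, {C | P C ∧ Bounds C K}.ncard = {C | P C}.ncard := by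
  have := sum_ncard_fiber P (Components.map hRS) (fun _ => ()) ()
  simpa [bounds_iff hRS] using this

theorem sum_closedEuler_univ (a b c : Matching n) :
    ∑ K : Cobordism a b c, closedEuler K
      = (circles a b + circles b c + circles a c : ℤ) - n := by
  have h : ∀ {u v : Matching n}, ({u, v} : Set (Matching n)) ⊆ {a, b, c} →
      ∑ K : Cobordism a b c, ({C : Circle u v | Bounds C K}.ncard : ℤ) = circles u v := by
    intro u v huv
    have := sum_ncard_bounds_univ huv (fun _ => True)
    simp only [true_and, Set.ofPred_true, Set.ncard_univ] at this
    exact_mod_cast this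
  have hb : ∑ K : Cobordism a b c, ({α : Arc b | component {a, b, c} α.left = K}.ncard : ℤ)
      = n := by
    have h1 := sum_ncard_fiber (fun _ : Arc b => True) (fun α => component {a, b, c} α.left)
      (fun _ => ()) ()
    have h2 := ncard_arcs (b := b) (P := Set.univ) (by simp)
    rw [classCount_univ_singleton] at h2
    simp only [true_and, if_true, and_self, Set.ofPred_true] at h1
    simp only [Set.mem_univ, Set.ofPred_true] at h2
    rw [h2] at h1
    exact_mod_cast h1
  unfold closedEuler
  rw [Finset.sum_sub_distrib, Finset.sum_add_distrib, Finset.sum_add_distrib, h (by grind),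
    h (by grind), h (by grind), hb]

theorem sum_dots {a b c : Matching n} (S : Set (Circle a b)) (T : Set (Circle b c))
    (U : Set (Circle a c)) :
    ((∑ K : Cobordism a b c, dots S T U K : ℕ) : ℤ)
      = S.ncard + T.ncard + circles a c - U.ncard := by
  unfold dots
  rw [Finset.sum_add_distrib, Finset.sum_add_distrib, sum_ncard_bounds_univ (by grind),
    sum_ncard_bounds_univ (by grind), sum_ncard_bounds_univ (by grind)]
  have := Set.ncard_add_ncard_compl U
  change U.ncard + {C | C ∉ U}.ncard = circles a c at this
  have h1 : {C | C ∈ S} = S := rfl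
  have h2 : {C | C ∈ T} = T := rfl
  rw [h1, h2]
  have h3 : (U.ncard : ℤ) + {C | C ∉ U}.ncard = circles a c := by exact_mod_cast this
  push_cast
  linarith

theorem closedValue_ne_zero {χ : ℤ} {d : ℕ} (h : closedValue χ d ≠ 0) : χ = 2 * d := by
  unfold closedValue at h
  grind

theorem degree_eq (a b : Matching n) (S : Set (Circle a b)) :
    degree a b S = n - circles a b + 2 * S.ncard := by
  rw [degree, circles, Nat.card_eq_fintype_card]

/-- The multiplication is homogeneous: each component of the cobordism which contributes satisfies
`χ = 2 · #dots`. -/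
theorem degree_add {a b c : Matching n} {S : Set (Circle a b)} {T : Set (Circle b c)}
    {U : Set (Circle a c)} (h : structureConst S T U ≠ 0) :
    degree a b S + degree b c T = degree a c U := by
  have h1 : ∑ K : Cobordism a b c, closedEuler K
      = 2 * ((∑ K : Cobordism a b c, dots S T U K : ℕ) : ℤ) := by
    push_cast
    rw [Finset.mul_sum]
    exact Finset.sum_congr rfl fun K _ => closedValue_ne_zero (Finset.prod_ne_zero_iff.1 h K
      (Finset.mem_univ _))
  rw [sum_dots, sum_closedEuler_univ] at h1
  rw [degree_eq, degree_eq, degree_eq]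
  linarith

theorem degree_nonneg (a b : Matching n) (S : Set (Circle a b)) : 0 ≤ degree a b S := by
  have := circles_le a b
  rw [degree_eq]
  omega

theorem degree_eq_zero_iff {a b : Matching n} {S : Set (Circle a b)} :
    degree a b S = 0 ↔ a = b ∧ S = ∅ := by
  constructor
  · intro h
    rw [degree_eq] at h
    have h1 := circles_le a b
    refine ⟨?_, ?_⟩
    · by_contra hab
      have := circles_lt hab
      omega
    · rw [← Set.ncard_eq_zero (Set.toFinite S)]
      omega
  · rintro ⟨rfl, rfl⟩
    rw [degree_eq, circles_self]
    simp

/-! ### Products without handles or splittings -/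

theorem closedEuler_le {a b c : Matching n} (K : Cobordism a b c) : closedEuler K ≤ 2 := by
  obtain ⟨g, hg⟩ := exists_closedEuler_eq K
  omega

/-- If the degrees of the all-plus elements add up, all components of the cobordism are spheres with
a single outgoing circle. -/
theorem map_injective_of_circles {a b c : Matching n}
    (h : circles a b + circles b c = n + circles a c) :
    Function.Injective (Components.map (S := {a, c}) (T := {a, b, c}) (by grind)) ∧
      ∀ K : Cobordism a b c, closedEuler K = 2 := by
  have h1 := sum_closedEuler_univ a b c
  have h2 := card_cobordism_le a b c
  have h3 : ∑ K : Cobordism a b c, (2 - closedEuler K) = 2 * Nat.card (Cobordism a b c)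
      - 2 * (circles a c : ℤ) := by
    rw [Finset.sum_sub_distrib, h1]
    simp only [Finset.sum_const, Finset.card_univ, nsmul_eq_mul, Nat.card_eq_fintype_card]
    have : (circles a b : ℤ) + circles b c = n + circles a c := by exact_mod_cast h
    linarith
  have h4 : ∀ K ∈ Finset.univ, 0 ≤ 2 - closedEuler (a := a) (b := b) (c := c) K :=
    fun K _ => by have := closedEuler_le K; omega
  have h5 := Finset.sum_nonneg h4
  have h6 : Nat.card (Cobordism a b c) = circles a c := by omega
  rw [h6, sub_self] at h3
  refine ⟨?_, fun K => ?_⟩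
  · have hsurj : Function.Surjective
        (Components.map (S := {a, c}) (T := {a, b, c}) (by grind)) := by
      intro K
      obtain ⟨i, rfl⟩ := component_surjective _ K
      exact ⟨component _ i, rfl⟩
    exact ((Nat.bijective_iff_surjective_and_card _).2 ⟨hsurj, h6.symm⟩).1
  · have := (Finset.sum_eq_zero_iff_of_nonneg h4).1 h3 K (Finset.mem_univ _)
    omega

/-- The structure constants of products without handles and splittings: on each component of the
cobordism, exactly one circle may fail to be labelled by `1`, respectively by the dual of `X`. -/
theorem structureConst_of_circles {a b c : Matching n}
    (h : circles a b + circles b c = n + circles a c) (S : Set (Circle a b))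
    (T : Set (Circle b c)) (U : Set (Circle a c)) :
    structureConst S T U = if ∀ i : Fin (2 * n),
      {C : Circle a b | C ∈ S ∧ Bounds C (component {a, b, c} i)}.ncard
        + {C : Circle b c | C ∈ T ∧ Bounds C (component {a, b, c} i)}.ncard
        + (if component {a, c} i ∈ U then 0 else 1) = 1 then 1 else 0 := by
  obtain ⟨hinj, hχ⟩ := map_injective_of_circles h
  have hU : ∀ i, {C : Circle a c | C ∉ U ∧ Bounds C (component {a, b, c} i)}.ncard
      = if component {a, c} i ∈ U then 0 else 1 := by
    intro i
    have : ∀ C : Circle a c, Bounds C (component {a, b, c} i) ↔ C = component {a, c} i := by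
      intro C
      rw [bounds_iff (by grind), ← Components.map_component (S := {a, c}) (by grind), hinj.eq_iff]
    simp only [this]
    split_ifs with hi
    · rw [Set.ncard_eq_zero]
      ext C
      simp only [Set.mem_ofPred_eq, Set.mem_empty_iff_false, iff_false]
      rintro ⟨h1, rfl⟩
      exact h1 hi
    · rw [Set.ncard_eq_one]
      refine ⟨component {a, c} i, ?_⟩
      ext C
      simp only [Set.mem_ofPred_eq, Set.mem_singleton_iff]
      constructor
      · exact fun h => h.2
      · rintro rfl
        exact ⟨hi, rfl⟩
  have hd : ∀ i, dots S T U (component {a, b, c} i)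
      = {C : Circle a b | C ∈ S ∧ Bounds C (component {a, b, c} i)}.ncard
        + {C : Circle b c | C ∈ T ∧ Bounds C (component {a, b, c} i)}.ncard
        + (if component {a, c} i ∈ U then 0 else 1) := by
    intro i
    rw [dots, hU]
  have hval : ∀ d : ℕ, closedValue 2 d = if d = 1 then 1 else 0 := by
    intro d
    simp [closedValue]
  unfold structureConst
  simp only [hχ, hval]
  split_ifs with hall
  · refine Finset.prod_eq_one fun K _ => ?_
    obtain ⟨i, rfl⟩ := component_surjective _ K
    rw [hd, if_pos (hall i)]
  · push Not at hall
    obtain ⟨i, hi⟩ := hall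
    refine Finset.prod_eq_zero (Finset.mem_univ (component {a, b, c} i)) ?_
    rw [hd, if_neg hi]

theorem ncard_singleton_bounds {R S : Set (Matching n)} (hRS : R ⊆ S) (i j : Fin (2 * n)) :
    {C : Components R | C ∈ ({component R i} : Set (Components R)) ∧
      Bounds C (component S j)}.ncard = if component S i = component S j then 1 else 0 := by
  split_ifs with h
  · rw [Set.ncard_eq_one]
    refine ⟨component R i, ?_⟩
    ext C
    simp only [Set.mem_ofPred_eq, Set.mem_singleton_iff]
    constructor
    · exact fun h => h.1
    · rintro rfl
      exact ⟨rfl, i, rfl, h⟩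
  · rw [Set.ncard_eq_zero]
    ext C
    simp only [Set.mem_ofPred_eq, Set.mem_singleton_iff, Set.mem_empty_iff_false, iff_false]
    rintro ⟨rfl, hC⟩
    rw [bounds_iff hRS] at hC
    exact h hC

/-! ### Products of basis elements -/

theorem basisElt_apply (a b : Matching n) (S S' : Set (Circle a b)) :
    basisElt a b S a b S' = if S' = S then 1 else 0 := by
  unfold basisElt
  rw [Pi.single_eq_same, Pi.single_eq_same, Pi.single_apply]

theorem basisElt_apply_of_ne {a b a' b' : Matching n} (S : Set (Circle a b))
    (S' : Set (Circle a' b')) (h : a' ≠ a ∨ b' ≠ b) : basisElt a b S a' b' S' = 0 := by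
  unfold basisElt
  by_cases ha : a' = a
  · subst ha
    have hb : b' ≠ b := h.resolve_left fun h => h rfl
    rw [Pi.single_eq_same, Pi.single_eq_of_ne hb]
    rfl
  · rw [Pi.single_eq_of_ne ha]
    rfl

theorem basisElt_mul_apply {a b c : Matching n} (S : Set (Circle a b)) (y : ArcAlgebra n)
    (U : Set (Circle a c)) : (basisElt a b S * y) a c U
      = ∑ T : Set (Circle b c), y b c T * structureConst S T U := by
  rw [ArcAlgebra.mul_apply, Finset.sum_eq_single b, Finset.sum_eq_single S]
  · refine Finset.sum_congr rfl fun T _ => ?_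
    rw [basisElt_apply, if_pos rfl, one_mul]
  · intro S' _ hS'
    refine Finset.sum_eq_zero fun T _ => ?_
    rw [basisElt_apply, if_neg hS', zero_mul, zero_mul]
  · simp
  · intro b' _ hb'
    refine Finset.sum_eq_zero fun S' _ => Finset.sum_eq_zero fun T _ => ?_
    rw [basisElt_apply_of_ne _ _ (Or.inr hb'), zero_mul, zero_mul]
  · simp

theorem basisElt_mul_basisElt_apply {a b c : Matching n} (S : Set (Circle a b))
    (T : Set (Circle b c)) (U : Set (Circle a c)) :
    (basisElt a b S * basisElt b c T) a c U = structureConst S T U := by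
  rw [basisElt_mul_apply, Finset.sum_eq_single T]
  · rw [basisElt_apply, if_pos rfl, one_mul]
  · intro T' _ hT'
    rw [basisElt_apply, if_neg hT', zero_mul]
  · simp

theorem basisElt_mul_basisElt_apply_of_ne {a b b' c a' c' : Matching n} (S : Set (Circle a b))
    (T : Set (Circle b' c)) (U : Set (Circle a' c')) (h : a' ≠ a ∨ c' ≠ c ∨ b ≠ b') :
    (basisElt a b S * basisElt b' c T) a' c' U = 0 := by
  rw [ArcAlgebra.mul_apply]
  refine Finset.sum_eq_zero fun m _ => Finset.sum_eq_zero fun S' _ =>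
    Finset.sum_eq_zero fun T' _ => ?_
  by_cases hm : a' = a ∧ m = b
  · obtain ⟨rfl, rfl⟩ := hm
    rw [basisElt_apply_of_ne (a := b') (b := c) (a' := m) (b' := c') T T' (by tauto), mul_zero,
      zero_mul]
  · rw [basisElt_apply_of_ne (a := a) (b := b) (a' := a') (b' := m) S S' (by tauto), zero_mul,
      zero_mul]

theorem basisElt_mul_basisElt_of_ne {a b b' c : Matching n} (S : Set (Circle a b))
    (T : Set (Circle b' c)) (h : b ≠ b') : basisElt a b S * basisElt b' c T = 0 := by
  funext a' c' U
  exact basisElt_mul_basisElt_apply_of_ne S T U (Or.inr (Or.inr h))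

/-- A product of basis elements is determined by its structure constants. -/
theorem basisElt_mul_basisElt_eq {a b c : Matching n} {S : Set (Circle a b)}
    {T : Set (Circle b c)} {x : ArcAlgebra n} (h1 : ∀ U, structureConst S T U = x a c U)
    (h2 : ∀ a' c' U, a' ≠ a ∨ c' ≠ c → x a' c' U = 0) :
    basisElt a b S * basisElt b c T = x := by
  funext a' c' U
  by_cases h : a' = a ∧ c' = c
  · obtain ⟨rfl, rfl⟩ := h
    rw [basisElt_mul_basisElt_apply, h1]
  · rw [h2 a' c' U (by tauto), basisElt_mul_basisElt_apply_of_ne _ _ _ (by tauto)]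

/-- If the degrees add up, the minimal cobordism only merges circles, and the product of all-plus
elements is all-plus. -/
theorem basisElt_mul_basisElt_empty {a b c : Matching n}
    (h : circles a b + circles b c = n + circles a c) :
    basisElt a b ∅ * basisElt b c ∅ = basisElt a c ∅ := by
  refine basisElt_mul_basisElt_eq (fun U => ?_) fun a' c' U h => basisElt_apply_of_ne _ _ h
  rw [structureConst_of_circles h, basisElt_apply]
  congr 1
  simp only [Set.mem_empty_iff_false, false_and, Set.ofPred_false, Set.ncard_empty, zero_add,
    eq_iff_iff]
  constructor
  · intro hU
    ext C
    obtain ⟨i, rfl⟩ := component_surjective _ C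
    have := hU i
    split_ifs at this with hi
    simpa using hi
  · rintro rfl i
    simp

theorem ncard_mem_bounds {R S : Set (Matching n)} (hRS : R ⊆ S) (hSR : S ⊆ R)
    (T : Set (Components R)) (i : Fin (2 * n)) :
    {C : Components R | C ∈ T ∧ Bounds C (component S i)}.ncard
      = if component R i ∈ T then 1 else 0 := by
  obtain rfl : R = S := Set.Subset.antisymm hRS hSR
  have : ∀ C : Components R, Bounds C (component R i) ↔ C = component R i := by
    intro C
    constructor
    · rintro ⟨j, rfl, hj⟩; exact hj
    · rintro rfl; exact ⟨i, rfl, rfl⟩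
  simp only [this]
  split_ifs with hi
  · rw [Set.ncard_eq_one]
    refine ⟨component R i, ?_⟩
    ext C
    simp only [Set.mem_ofPred_eq, Set.mem_singleton_iff]
    constructor
    · exact fun h => h.2
    · rintro rfl
      exact ⟨hi, rfl⟩
  · rw [Set.ncard_eq_zero]
    ext C
    simp only [Set.mem_ofPred_eq, Set.mem_empty_iff_false, iff_false]
    rintro ⟨h1, rfl⟩
    exact hi h1

theorem component_eq_congr {R S : Set (Matching n)} (h : R = S) {i j : Fin (2 * n)} :
    component R i = component R j ↔ component S i = component S j := by
  subst h; rfl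

theorem basisElt_idem_mul {a c : Matching n} (T : Set (Circle a c)) :
    basisElt a a ∅ * basisElt a c T = basisElt a c T := by
  refine basisElt_mul_basisElt_eq (fun U => ?_) fun a' c' U h => basisElt_apply_of_ne _ _ h
  rw [structureConst_of_circles (by rw [circles_self]), basisElt_apply]
  congr 1
  simp only [Set.mem_empty_iff_false, false_and, Set.ofPred_false, Set.ncard_empty, zero_add,
    eq_iff_iff]
  have h : ∀ i, {C : Circle a c | C ∈ T ∧ Bounds C (component {a, a, c} i)}.ncard
      = if component {a, c} i ∈ T then 1 else 0 := ncard_mem_bounds (by simp) (by simp) T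
  simp only [h]
  constructor
  · intro hU
    ext C
    obtain ⟨i, rfl⟩ := component_surjective _ C
    have := hU i
    split_ifs at this <;> simp_all
  · rintro rfl i
    split_ifs <;> rfl

theorem basisElt_mul_idem {a c : Matching n} (T : Set (Circle a c)) :
    basisElt a c T * basisElt c c ∅ = basisElt a c T := by
  refine basisElt_mul_basisElt_eq (fun U => ?_) fun a' c' U h => basisElt_apply_of_ne _ _ h
  rw [structureConst_of_circles (by rw [circles_self, add_comm]), basisElt_apply]
  congr 1
  simp only [Set.mem_empty_iff_false, false_and, Set.ofPred_false, Set.ncard_empty, add_zero,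
    eq_iff_iff]
  have h : ∀ i, {C : Circle a c | C ∈ T ∧ Bounds C (component {a, c, c} i)}.ncard
      = if component {a, c} i ∈ T then 1 else 0 := ncard_mem_bounds (by simp) (by simp) T
  simp only [h]
  constructor
  · intro hU
    ext C
    obtain ⟨i, rfl⟩ := component_surjective _ C
    have := hU i
    split_ifs at this <;> simp_all
  · rintro rfl i
    split_ifs <;> rfl

/-- On each circle there is exactly one of the following: the dot of an arc through `i`, a label `-` in
`T`, a label `+` in `U`. -/
theorem forall_count_eq_one_iff {S : Set (Matching n)} (i : Fin (2 * n))
    (T U : Set (Components S)) :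
    (∀ j, (if component S i = component S j then 1 else 0) + (if component S j ∈ T then 1 else 0)
      + (if component S j ∈ U then 0 else 1) = 1)
      ↔ component S i ∉ T ∧ U = insert (component S i) T := by
  constructor
  · intro h
    have hi : component S i ∉ T := by
      intro hi
      have := h i
      rw [if_pos rfl, if_pos hi] at this
      omega
    refine ⟨hi, ?_⟩
    ext C
    obtain ⟨j, rfl⟩ := component_surjective _ C
    have := h j
    rw [Set.mem_insert_iff, eq_comm]
    split_ifs at this <;> simp_all
  · rintro ⟨hi, rfl⟩ j
    by_cases hij : component S i = component S j
    · rw [if_pos hij, if_neg (hij ▸ hi), if_pos (by rw [← hij]; exact Set.mem_insert _ _)]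
    · have : component S j ∈ insert (component S i) T ↔ component S j ∈ T := by
        rw [Set.mem_insert_iff, eq_comm]
        tauto
      simp only [this, if_neg hij]
      split_ifs <;> rfl

/-- The element `h_α` acts from the left as multiplication by `X` on the circle through `α`. -/
theorem basisElt_arc_mul {a c : Matching n} (i : Fin (2 * n)) (T : Set (Circle a c)) :
    basisElt a a {component {a, a} i} * basisElt a c T
      = if component {a, c} i ∈ T then 0 else basisElt a c (insert (component {a, c} i) T) := by
  refine basisElt_mul_basisElt_eq (fun U => ?_) fun a' c' U h => ?_
  · rw [structureConst_of_circles (by rw [circles_self])]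
    have h1 : ∀ j, _ = if component {a, a, c} i = component {a, a, c} j then 1 else 0 :=
      ncard_singleton_bounds (R := {a, a}) (S := {a, a, c}) (by simp) i
    have h2 : ∀ i, {C : Circle a c | C ∈ T ∧ Bounds C (component {a, a, c} i)}.ncard
      = if component {a, c} i ∈ T then 1 else 0 := ncard_mem_bounds (by simp) (by simp) T
    have h3 : ∀ j, component {a, a, c} i = component {a, a, c} j
        ↔ component {a, c} i = component {a, c} j := fun j => component_eq_congr (by simp)
    simp only [h1, h2, h3]
    have key := forall_count_eq_one_iff (S := {a, c}) i T U
    simp only [key]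
    by_cases hi : component {a, c} i ∈ T
    · simp only [hi, not_true_eq_false, false_and, if_false, if_true]
      rfl
    · rw [if_neg hi, basisElt_apply]
      simp [hi]
  · split_ifs
    · rfl
    · exact basisElt_apply_of_ne _ _ h

/-- The element `h_α` acts from the right as multiplication by `X` on the circle through `α`. -/
theorem basisElt_mul_arc {a c : Matching n} (i : Fin (2 * n)) (T : Set (Circle a c)) :
    basisElt a c T * basisElt c c {component {c, c} i}
      = if component {a, c} i ∈ T then 0 else basisElt a c (insert (component {a, c} i) T) := by
  refine basisElt_mul_basisElt_eq (fun U => ?_) fun a' c' U h => ?_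
  · rw [structureConst_of_circles (by rw [circles_self, add_comm])]
    have h1 : ∀ j, _ = if component {a, c, c} i = component {a, c, c} j then 1 else 0 :=
      ncard_singleton_bounds (R := {c, c}) (S := {a, c, c}) (by simp) i
    have h2 : ∀ i, {C : Circle a c | C ∈ T ∧ Bounds C (component {a, c, c} i)}.ncard
      = if component {a, c} i ∈ T then 1 else 0 := ncard_mem_bounds (by simp) (by simp) T
    have h3 : ∀ j, component {a, c, c} i = component {a, c, c} j
        ↔ component {a, c} i = component {a, c} j := fun j => component_eq_congr (by simp)
    simp only [h1, h2, h3]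
    have key := forall_count_eq_one_iff (S := {a, c}) i T U
    simp only [add_comm (if component {a, c} _ ∈ T then 1 else 0)
      (if component {a, c} i = component {a, c} _ then 1 else 0), key]
    by_cases hi : component {a, c} i ∈ T
    · simp only [hi, not_true_eq_false, false_and, if_false, if_true]
      rfl
    · rw [if_neg hi, basisElt_apply]
      simp [hi]
  · split_ifs
    · rfl
    · exact basisElt_apply_of_ne _ _ h

/-! ### Bridges and surgery -/

section Reconnect

variable {X : Type*} {c : X → X}

theorem reconnect_comm (p q : X) : reconnect c p q = reconnect c q p := by
  funext x
  unfold reconnect; grind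

theorem reconnect_partner_partner (hc : IsPairing c) {p q : X} (hpq : q ≠ p)
    (hcq : q ≠ c p) : reconnect c (c p) (c q) = reconnect c p q := by
  have h2 := hc.apply_apply
  have hne := hc.ne
  funext x
  have := h2 p
  have := h2 q
  unfold reconnect; grind

/-- Surgery is reversed by surgery. -/
theorem reconnect_dual (hc : IsPairing c) {p q : X} (hcq : q ≠ c p) :
    reconnect (reconnect c p q) p (c p) = c := by
  have h2 := hc.apply_apply
  have hne := hc.ne
  have e1 := reconnect_left c p q
  have e2 := reconnect_partner_left hc hcq
  funext x
  rw [show reconnect (reconnect c p q) p (c p) x = (if x = p then c p else if x = c p then p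
    else if x = reconnect c p q p then reconnect c p q (c p)
    else if x = reconnect c p q (c p) then reconnect c p q p else reconnect c p q x) from rfl,
    e1, e2]
  have := h2 p
  have := h2 q
  have := h2 x
  unfold reconnect; grind

end Reconnect

theorem arcThrough_left (a : Matching n) (α : Arc a) : arcThrough a α.left = α := by
  have h : α.left < a.partner α.left := α.2
  exact dif_pos h

theorem arcThrough_partner (a : Matching n) (i : Fin (2 * n)) :
    arcThrough a (a.partner i) = arcThrough a i := by
  have h1 := a.partner_partner i
  have h2 := a.partner_ne i
  unfold arcThrough
  apply Subtype.ext
  grind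

theorem arcThrough_left_eq (a : Matching n) (i : Fin (2 * n)) :
    (arcThrough a i).left = i ∨ (arcThrough a i).left = a.partner i := by
  by_cases h : i < a.partner i
  · left
    have : arcThrough a i = ⟨i, h⟩ := dif_pos h
    rw [this]
    rfl
  · right
    have : arcThrough a i = ⟨a.partner i, _⟩ := dif_neg h
    rw [this]
    rfl

theorem arcThrough_eq_iff {a : Matching n} {i j : Fin (2 * n)} :
    arcThrough a i = arcThrough a j ↔ j = i ∨ j = a.partner i := by
  constructor
  · intro h
    have h1 := arcThrough_left_eq a i
    have h2 := arcThrough_left_eq a j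
    rw [h] at h1
    have := a.partner_partner i
    have := a.partner_partner j
    grind
  · rintro (rfl | rfl)
    · rfl
    · exact (arcThrough_partner a i).symm

theorem component_arcThrough {S : Set (Matching n)} {a : Matching n} (ha : a ∈ S)
    (i : Fin (2 * n)) : component S (arcThrough a i).left = component S i := by
  rcases arcThrough_left_eq a i with h | h
  · rw [h]
  · rw [h, component_partner ha]

theorem Bridge.fst_ne_snd {a : Matching n} (γ : Bridge a) : γ.fst ≠ γ.snd := fun h =>
  absurd γ.lt (by rw [h]; exact lt_irrefl _)

theorem Bridge.joins_left {a : Matching n} (γ : Bridge a) :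
    γ.Joins γ.fst.left γ.snd.left :=
  Or.inl ⟨(arcThrough_left _ _).symm, (arcThrough_left _ _).symm⟩

theorem Bridge.Joins.arcThrough_ne {a : Matching n} {γ : Bridge a} {i j : Fin (2 * n)}
    (h : γ.Joins i j) : arcThrough a i ≠ arcThrough a j := by
  have := γ.fst_ne_snd
  rcases h with ⟨h1, h2⟩ | ⟨h1, h2⟩ <;> grind

theorem Bridge.Joins.ne {a : Matching n} {γ : Bridge a} {i j : Fin (2 * n)}
    (h : γ.Joins i j) : j ≠ i := fun hij => h.arcThrough_ne (by rw [hij])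

theorem Bridge.Joins.ne_partner {a : Matching n} {γ : Bridge a} {i j : Fin (2 * n)}
    (h : γ.Joins i j) : j ≠ a.partner i := fun hij =>
  h.arcThrough_ne (by rw [hij, arcThrough_partner])

/-- The surgery along a bridge reconnects its two arcs, in one of the two possible ways. -/
theorem Bridge.Joins.surger_partner {a : Matching n} {γ : Bridge a} {i j : Fin (2 * n)}
    (h : γ.Joins i j) : (surger γ).partner = reconnect a.partner i j ∨
      (surger γ).partner = reconnect a.partner i (a.partner j) := by
  have h2 := a.partner_partner
  have key : ∀ u v, surgeryFun a.partner u v = reconnect a.partner u v ∨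
      surgeryFun a.partner u v = reconnect a.partner u (a.partner v) := by
    intro u v
    by_cases huv : a.partner u < v
    · right
      funext x
      simp only [surgeryFun, reconnect, if_pos huv, h2]
    · left
      funext x
      simp only [surgeryFun, reconnect, if_neg huv]
      split_ifs <;> rfl
  have hij := h.ne
  have hij' := h.ne_partner
  have hij2 : a.partner j ≠ i := fun h => hij' (by rw [← h, h2])
  have hij3 : a.partner j ≠ a.partner i := fun h => hij (by rw [← h2 j, h, h2])
  have e1 := reconnect_partner_partner a.isPairing hij hij'
  have e2 := reconnect_partner_partner a.isPairing hij2 hij3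
  rw [h2] at e2
  have c1 := reconnect_comm (c := a.partner) i j
  have c2 := reconnect_comm (c := a.partner) (a.partner i) (a.partner j)
  have c3 := reconnect_comm (c := a.partner) i (a.partner j)
  have c4 := reconnect_comm (c := a.partner) (a.partner i) j
  have hk := key γ.fst.left γ.snd.left
  change (surger γ).partner = _ ∨ (surger γ).partner = _ at hk
  rcases h with ⟨hi, hj⟩ | ⟨hi, hj⟩
  · have hi' := arcThrough_left_eq a i
    have hj' := arcThrough_left_eq a j
    rw [← hi] at hi'
    rw [← hj] at hj'
    rcases hi' with hi' | hi' <;> rcases hj' with hj' | hj' <;> rw [hi', hj'] at hk <;>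
      (try simp only [h2] at hk) <;> grind
  · have hi' := arcThrough_left_eq a i
    have hj' := arcThrough_left_eq a j
    rw [← hj] at hi'
    rw [← hi] at hj'
    rcases hi' with hi' | hi' <;> rcases hj' with hj' | hj' <;> rw [hi', hj'] at hk <;>
      (try simp only [h2] at hk) <;> grind

/-- Exactly one of the three perfect matchings of four points on a line has a crossing. -/
theorem not_noncrossing_reconnect {a e e' : Matching n} {p q : Fin (2 * n)} (hpq : q ≠ p)
    (haq : q ≠ a.partner p) (he : e.partner = reconnect a.partner p q)
    (he' : e'.partner = reconnect a.partner p (a.partner q)) : False := by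
  have h2 := a.partner_partner
  -- the conclusion when the pairs are `{p, x}, {q, y}`, `{p, q}, {x, y}` and `{p, y}, {q, x}`
  have main : ∀ p x q y : Fin (2 * n), p < x → p < q → p < y → x ≠ q → x ≠ y → q ≠ y →
      a.partner p = x → a.partner q = y → a.partner y = q → e.partner p = q → e.partner x = y →
      e.partner y = x → e'.partner p = y → e'.partner x = q → e'.partner q = x → False := by
    intro p x q y h1 h2 h3 h4 h5 h6 a1 a2 a3 e1 e2 e3 f1 f2 f3
    have n1 := a.noncrossing p q
    have n2 := a.noncrossing p y
    have n3 := e.noncrossing p x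
    have n4 := e.noncrossing p y
    have n5 := e'.noncrossing p x
    have n6 := e'.noncrossing p q
    rw [a1, a2] at n1
    rw [a1, a3] at n2
    rw [e1, e2] at n3
    rw [e1, e3] at n4
    rw [f1, f2] at n5
    rw [f1, f3] at n6
    omega
  have np := a.partner_ne p
  have nq := a.partner_ne q
  have hpq2 : a.partner q ≠ p := fun h => haq (by rw [← h, h2])
  have hpq3 : a.partner q ≠ a.partner p := fun h => hpq (by rw [← h2 q, h, h2])
  have f1 : e.partner p = q := by rw [he, reconnect_left]
  have f4 : e.partner q = p := by rw [he, reconnect_right]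
  have f2 : e.partner (a.partner p) = a.partner q := by
    rw [he, reconnect_partner_left a.isPairing haq]
  have f3 : e.partner (a.partner q) = a.partner p := by
    rw [he, reconnect_partner_right a.isPairing haq]
  have g1 : e'.partner p = a.partner q := by rw [he', reconnect_left]
  have g4 : e'.partner (a.partner q) = p := by rw [he', reconnect_right]
  have g2 : e'.partner (a.partner p) = q := by
    rw [he', reconnect_partner_left a.isPairing hpq3, h2]
  have g3 : e'.partner q = a.partner p := by
    have := reconnect_partner_right (p := p) a.isPairing hpq3
    rwa [h2, ← he'] at this
  have hp := h2 p
  have hq := h2 q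
  have hmin : (p < a.partner p ∧ p < q ∧ p < a.partner q) ∨
      (a.partner p < p ∧ a.partner p < a.partner q ∧ a.partner p < q) ∨
      (q < a.partner q ∧ q < p ∧ q < a.partner p) ∨
      (a.partner q < q ∧ a.partner q < a.partner p ∧ a.partner q < p) := by omega
  rcases hmin with ⟨l1, l2, l3⟩ | ⟨l1, l2, l3⟩ | ⟨l1, l2, l3⟩ | ⟨l1, l2, l3⟩
  · exact main p _ q _ l1 l2 l3 haq.symm hpq3.symm nq.symm rfl rfl hq f1 f2 f3 g1 g2 g3
  · exact main _ p _ q l1 l2 l3 hpq2.symm hpq.symm nq hp hq rfl f2 f1 f4 g2 g1 g4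
  · exact main q _ p _ l1 l2 l3 hpq2 hpq3 np.symm rfl rfl hp f4 f3 f2 g3 g4 g1
  · exact main _ q _ p l1 l2 l3 haq hpq np hq hp rfl f3 f4 f1 g4 g3 g2

/-- Two crossingless matchings which differ in two arcs are related by a bridge. -/
theorem exists_bridge {a e : Matching n} {p q : Fin (2 * n)} (hpq : q ≠ p)
    (haq : q ≠ a.partner p) (he : e.partner = reconnect a.partner p q) :
    ∃ γ : Bridge a, γ.Joins p q ∧ surger γ = e := by
  have h2 := a.partner_partner
  have f1 : e.partner p = q := by rw [he, reconnect_left]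
  have f4 : e.partner q = p := by rw [he, reconnect_right]
  have f2 : e.partner (a.partner p) = a.partner q := by
    rw [he, reconnect_partner_left a.isPairing haq]
  have f3 : e.partner (a.partner q) = a.partner p := by
    rw [he, reconnect_partner_right a.isPairing haq]
  -- the other arcs of `a` are arcs of `e`, so they do not cross the arc `{p, q}` of `e`
  have hsep : ∀ x, x < a.partner x → x ≠ p → x ≠ q → x ≠ a.partner p → x ≠ a.partner q →
      ((x < p ∧ p < a.partner x) ↔ (x < q ∧ q < a.partner x)) := by
    intro x hx x1 x2 x3 x4
    have fx : e.partner x = a.partner x := by rw [he, reconnect_of_ne x1 x2 x3 x4]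
    have n1 := e.noncrossing x p
    have n2 := e.noncrossing x q
    have n3 := e.noncrossing p x
    have n4 := e.noncrossing q x
    rw [fx, f1] at n1 n3
    rw [fx, f4] at n2 n4
    have y1 : a.partner x ≠ q := fun h => x4 (by rw [← h, h2])
    have y2 : a.partner x ≠ p := fun h => x3 (by rw [← h, h2])
    omega
  -- an arc encloses another one if and only if it encloses one of its endpoints
  have hin : ∀ (i : Fin (2 * n)) (ε : Arc a), ε ≠ arcThrough a i →
      (ε.Encloses (arcThrough a i) ↔ ε.left < i ∧ i < a.partner ε.left) ∧
        ε.left ≠ i ∧ ε.left ≠ a.partner i := by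
    intro i ε hε
    have x1 : ε.left ≠ i := fun h => hε (by rw [← h, arcThrough_left])
    have x2 : ε.left ≠ a.partner i := fun h => hε (by
      rw [← arcThrough_partner, ← h, arcThrough_left])
    refine ⟨?_, x1, x2⟩
    have hε' : ε.left < a.partner ε.left := ε.2
    have n1 := a.noncrossing ε.left i
    have n2 := a.noncrossing ε.left (a.partner i)
    have n3 := a.noncrossing i ε.left
    have n4 := a.noncrossing (a.partner i) ε.left
    rw [h2] at n2 n4
    have y1 : a.partner ε.left ≠ i := fun h => x2 (by rw [← h, h2])
    have y2 : a.partner ε.left ≠ a.partner i := fun h => x1 (by rw [← h2 i, ← h, h2])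
    unfold Arc.Encloses
    change _ ∧ a.partner (arcThrough a i).left < a.partner ε.left ↔ _
    have hl : (arcThrough a i).left < a.partner (arcThrough a i).left := (arcThrough a i).2
    rcases arcThrough_left_eq a i with h | h <;> rw [h] at hl ⊢ <;> (try rw [h2] at hl ⊢) <;> omega
  have hadj : ∀ ε : Arc a, ε ≠ arcThrough a p → ε ≠ arcThrough a q →
      (ε.Encloses (arcThrough a p) ↔ ε.Encloses (arcThrough a q)) := by
    intro ε hp hq
    obtain ⟨hp1, hp2, hp3⟩ := hin p ε hp
    obtain ⟨hq1, hq2, hq3⟩ := hin q ε hq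
    rw [hp1, hq1]
    exact hsep _ ε.2 hp2 hq2 hp3 hq3
  have hne : arcThrough a p ≠ arcThrough a q := by
    rw [Ne, arcThrough_eq_iff]
    tauto
  have hne' : (arcThrough a p).left ≠ (arcThrough a q).left := fun h => hne (Subtype.ext h)
  obtain ⟨γ, hγ⟩ : ∃ γ : Bridge a, γ.Joins p q := by
    rcases lt_or_gt_of_ne hne' with h | h
    · exact ⟨⟨_, _, h, hadj⟩, Or.inl ⟨rfl, rfl⟩⟩
    · exact ⟨⟨_, _, h, fun ε h1 h2 => (hadj ε h2 h1).symm⟩, Or.inr ⟨rfl, rfl⟩⟩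
  refine ⟨γ, hγ, ?_⟩
  rcases hγ.surger_partner with h | h
  · exact Matching.ext (h.trans he.symm)
  · exact (not_noncrossing_reconnect hpq haq he h).elim

/-- The arcs which are changed by the surgery along `γ` are the two arcs connected by `γ`. -/
theorem surger_partner_ne_iff {a : Matching n} (γ : Bridge a) (x : Fin (2 * n)) :
    (surger γ).partner x ≠ a.partner x ↔
      arcThrough a x = γ.fst ∨ arcThrough a x = γ.snd := by
  have hj := γ.joins_left
  have h1 := hj.ne
  have h3 := hj.ne_partner
  have h2 := a.partner_partner
  have ha : ∀ α : Arc a, arcThrough a x = α ↔ (x = α.left ∨ x = a.partner α.left) := by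
    intro α
    rw [eq_comm, ← arcThrough_left a α, arcThrough_eq_iff, arcThrough_left]
  rw [ha, ha]
  have := h2 x
  have := h2 γ.fst.left
  have := h2 γ.snd.left
  have := a.partner_ne γ.fst.left
  have := a.partner_ne γ.snd.left
  rcases hj.surger_partner with h | h <;> rw [h] <;> unfold reconnect <;> grind

theorem surger_ne {a : Matching n} (γ : Bridge a) : surger γ ≠ a := fun h =>
  (surger_partner_ne_iff γ γ.fst.left).2 (Or.inl (arcThrough_left _ _)) (by rw [h])

/-- A bridge is determined by the surgery along it. -/
theorem surger_injective {a : Matching n} : Function.Injective (surger (a := a)) := by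
  intro γ η h
  have key : ∀ α : Arc a, (α = γ.fst ∨ α = γ.snd) ↔ (α = η.fst ∨ α = η.snd) := by
    intro α
    have h1 := surger_partner_ne_iff γ α.left
    have h2 := surger_partner_ne_iff η α.left
    rw [arcThrough_left] at h1 h2
    rw [← h1, ← h2, h]
  have k1 := key γ.fst
  have k2 := key γ.snd
  have k3 := key η.fst
  have k4 := key η.snd
  have l1 := γ.lt
  have l2 := η.lt
  have n1 := γ.fst_ne_snd
  have n2 := η.fst_ne_snd
  have l3 : ∀ α β : Arc a, α.left < β.left → ¬ β.left < α.left := fun α β h => not_lt.2 h.le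
  ext <;> grind

theorem exists_dual_bridge {a : Matching n} (γ : Bridge a) :
    ∃ γd : Bridge (surger γ), surger γd = a := by
  have hj := γ.joins_left
  have key : ∀ q : Fin (2 * n), q ≠ a.partner γ.fst.left →
      (surger γ).partner = reconnect a.partner γ.fst.left q →
      ∃ γd : Bridge (surger γ), surger γd = a := by
    intro q h2 h
    have hd := reconnect_dual a.isPairing h2
    rw [← h] at hd
    obtain ⟨γd, -, hγd⟩ := exists_bridge (a := surger γ) (e := a) (p := γ.fst.left)
      (q := a.partner γ.fst.left) (a.partner_ne _) (by rw [h, reconnect_left]; exact h2.symm)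
      hd.symm
    exact ⟨γd, hγd⟩
  have h2 := a.partner_partner
  rcases hj.surger_partner with h | h
  · exact key _ hj.ne_partner h
  · exact key _ (fun h => hj.ne (by rw [← h2 γ.snd.left, h, h2])) h

/-! ### The effect of surgery on circles -/

theorem component_pair_eq_iff {a c : Matching n} {i j : Fin (2 * n)} :
    component {a, c} i = component {a, c} j ↔ orbitSetoid {a.partner, c.partner} i j := by
  rw [component_eq_iff, joinSetoid_eq_orbitSetoid, Set.image_pair]

/-- A form of `Bridge.Joins.surger_partner` in which the reconnected points are named. -/
theorem Bridge.Joins.exists_reconnect {a : Matching n} {γ : Bridge a} {i j : Fin (2 * n)}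
    (h : γ.Joins i j) : ∃ k, (k = j ∨ k = a.partner j) ∧ k ≠ i ∧ k ≠ a.partner i ∧
      (surger γ).partner = reconnect a.partner i k := by
  have h2 := a.partner_partner
  rcases h.surger_partner with h' | h'
  · exact ⟨j, Or.inl rfl, h.ne, h.ne_partner, h'⟩
  · exact ⟨_, Or.inr rfl, fun hk => h.ne_partner (by rw [← hk, h2]),
      fun hk => h.ne (by rw [← h2 j, hk, h2]), h'⟩

theorem circles_surger_of_eq {a : Matching n} {γ : Bridge a} {i j : Fin (2 * n)}
    (h : γ.Joins i j) {c : Matching n} (hc : component {a, c} i = component {a, c} j) :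
    circles (surger γ) c = circles a c + 1 := by
  obtain ⟨k, hk, hki, hka, hs⟩ := h.exists_reconnect
  have hck : component {a, c} i = component {a, c} k := by
    rcases hk with rfl | rfl
    · exact hc
    · rw [hc, component_partner (by simp)]
  have hκ : colour k = !colour i := by
    rw [← (surger γ).colour_partner, hs, reconnect_left]
  have := classCount_reconnect_of_orbitSetoid c.isPairing a.isPairing hki hka c.colour_partner
    a.colour_partner hκ (P := Set.univ) (Set.mem_univ _) (Set.mem_univ _)
    (component_pair_eq_iff.1 hck)
  rwa [← hs, classCount_univ_pair, classCount_univ_pair] at this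

theorem circles_surger_of_ne {a : Matching n} {γ : Bridge a} {i j : Fin (2 * n)}
    (h : γ.Joins i j) {c : Matching n} (hc : component {a, c} i ≠ component {a, c} j) :
    circles (surger γ) c + 1 = circles a c := by
  obtain ⟨k, hk, hki, hka, hs⟩ := h.exists_reconnect
  have hck : component {a, c} i ≠ component {a, c} k := by
    rcases hk with rfl | rfl
    · exact hc
    · rwa [component_partner (by simp)]
  have := classCount_reconnect_of_not_orbitSetoid c.isPairing a.isPairing hki hka
    (P := Set.univ) (Set.mem_univ _) (Set.mem_univ _) (fun h => hck (component_pair_eq_iff.2 h))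
  rwa [← hs, classCount_univ_pair, classCount_univ_pair] at this

theorem circles_surger {a : Matching n} (γ : Bridge a) (c : Matching n) :
    circles (surger γ) c = circles a c + 1 ∨ circles (surger γ) c + 1 = circles a c := by
  by_cases h : component {a, c} γ.fst.left = component {a, c} γ.snd.left
  · exact Or.inl (circles_surger_of_eq γ.joins_left h)
  · exact Or.inr (circles_surger_of_ne γ.joins_left h)

theorem component_self_eq_iff {a : Matching n} {i j : Fin (2 * n)} :
    component {a, a} i = component {a, a} j ↔ j = i ∨ j = a.partner i := by
  constructor
  · intro h
    have := (orbitSetoid_mem_iff (P := {i, a.partner i}) ?_ (component_pair_eq_iff.1 h)).1 (by simp)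
    · simpa using this
    · intro f hf z
      have hf' : f = a.partner := by simpa using hf
      subst hf'
      have := a.partner_partner z
      have := a.partner_partner i
      simp only [Set.mem_insert_iff, Set.mem_singleton_iff]
      grind
  · rintro (rfl | rfl)
    · rfl
    · rw [component_partner (by simp)]

theorem circles_self_surger {a : Matching n} (γ : Bridge a) :
    circles a (surger γ) + 1 = n := by
  rw [circles_comm, circles_surger_of_ne γ.joins_left, circles_self]
  rw [Ne, component_self_eq_iff]
  rintro (h | h)
  · exact γ.joins_left.ne h
  · exact γ.joins_left.ne_partner h

/-! ### Shortcuts -/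

/-- `{p, q}` is an arc of `c`, but not of `a`, inside which `a` and `c` agree. -/
structure IsShortcut (a c : Matching n) (p q : Fin (2 * n)) : Prop where
  lt : p < q
  partner_eq : c.partner p = q
  partner_ne : a.partner p ≠ q
  inside : ∀ y, p < y → y < q → p < c.partner y ∧ c.partner y < q ∧ a.partner y = c.partner y

/-- A shortest arc of `c` which is not an arc of `a` is a shortcut. -/
theorem exists_isShortcut {a c : Matching n} (h : a ≠ c) : ∃ p q, IsShortcut a c p q := by
  have hex : ∃ k : ℕ, ∃ p, p < c.partner p ∧ a.partner p ≠ c.partner p ∧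
      (c.partner p).val - p.val = k := by
    obtain ⟨i, hi⟩ : ∃ i, a.partner i ≠ c.partner i := by
      by_contra hcon
      push Not at hcon
      exact h (Matching.ext (funext hcon))
    rcases lt_or_gt_of_ne (c.partner_ne i) with hlt | hlt
    · refine ⟨_, c.partner i, by rwa [c.partner_partner], ?_, rfl⟩
      rw [c.partner_partner]
      intro hcon
      exact hi (by rw [← hcon, a.partner_partner, hcon])
    · exact ⟨_, i, hlt, hi, rfl⟩
  obtain ⟨p, hp, hne, hk⟩ := Nat.find_spec hex
  have hmin : ∀ x, x < c.partner x → a.partner x ≠ c.partner x →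
      (c.partner p).val - p.val ≤ (c.partner x).val - x.val := by
    intro x hx hx'
    rw [hk]
    exact Nat.find_min' hex ⟨x, hx, hx', rfl⟩
  refine ⟨p, c.partner p, hp, rfl, hne, fun y hy1 hy2 => ?_⟩
  have n1 := c.noncrossing p y
  have n2 := c.noncrossing (c.partner y) p
  have c1 := c.partner_partner y
  have c2 := c.partner_partner p
  have c3 := c.partner_ne y
  have hin : p < c.partner y ∧ c.partner y < c.partner p := by
    have : c.partner y ≠ p := fun h => by rw [← c1, h] at hy2; exact lt_irrefl _ hy2
    have : c.partner y ≠ c.partner p := fun h => by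
      rw [← c1, h, c2] at hy1; exact lt_irrefl _ hy1
    rw [c1] at n2
    constructor <;> omega
  refine ⟨hin.1, hin.2, ?_⟩
  by_contra hay
  rcases lt_or_gt_of_ne c3 with hlt | hlt
  · have := hmin (c.partner y) (by rwa [c1]) (by
      rw [c1]
      intro hcon
      exact hay (by rw [← hcon, a.partner_partner, hcon]))
    rw [c1] at this
    omega
  · have := hmin y hlt hay
    omega

/-- Surgery near a segment of the line inside which the matching is closed. -/
theorem exists_bridge_of_closed (x : Matching n) {p q : Fin (2 * n)} (hpq : p < q)
    (hne : x.partner p ≠ q)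
    (h : ∀ y, p < y → y < q → p < x.partner y ∧ x.partner y < q) :
    ∃ δ : Bridge x, δ.Joins p q ∧ (surger δ).partner = reconnect x.partner p q := by
  have h2 := x.partner_partner
  let e : Matching n :=
    { partner := reconnect x.partner p q
      partner_partner := reconnect_reconnect x.isPairing hpq.ne' hne.symm
      partner_ne := (x.isPairing.reconnect hpq.ne' hne.symm).ne
      noncrossing := by
        intro k l
        have hp1 := h (x.partner p)
        have hq1 := h (x.partner q)
        have hk1 := h k
        have hl1 := h l
        have hk2 := h (x.partner k)
        have hl2 := h (x.partner l)
        have a1 := h2 p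
        have a2 := h2 q
        have a3 := h2 k
        have a4 := h2 l
        rw [a1] at hp1
        rw [a2] at hq1
        rw [a3] at hk2
        rw [a4] at hl2
        have b1 := x.partner_ne k
        have b2 := x.partner_ne l
        have b3 := x.partner_ne p
        have b4 := x.partner_ne q
        have c1 := x.noncrossing k l
        have c2 := x.noncrossing k p
        have c3 := x.noncrossing k q
        have c4 := x.noncrossing l p
        have c5 := x.noncrossing l q
        have c6 := x.noncrossing p k
        have c7 := x.noncrossing q k
        have c8 := x.noncrossing p l
        have c9 := x.noncrossing q l
        have d1 := x.noncrossing (x.partner p) k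
        have d2 := x.noncrossing (x.partner q) k
        have d3 := x.noncrossing (x.partner p) l
        have d4 := x.noncrossing (x.partner q) l
        have d5 := x.noncrossing k (x.partner p)
        have d6 := x.noncrossing k (x.partner q)
        have d7 := x.noncrossing l (x.partner p)
        have d8 := x.noncrossing l (x.partner q)
        have e1 := x.noncrossing p q
        have e2 := x.noncrossing q p
        have e3 := x.noncrossing (x.partner p) q
        have e4 := x.noncrossing (x.partner q) p
        rw [a1] at d1 d3 d5 d7 e3
        rw [a2] at d2 d4 d6 d8 e4
        clear h h2
        unfold reconnect
        split_ifs <;> grind }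
  obtain ⟨δ, hδ, hδe⟩ := exists_bridge (a := x) (e := e) hpq.ne' hne.symm rfl
  exact ⟨δ, hδ, by rw [hδe]⟩

theorem Bridge.Joins.symm {a : Matching n} {γ : Bridge a} {i j : Fin (2 * n)}
    (h : γ.Joins i j) : γ.Joins j i :=
  Or.comm.1 h

theorem Bridge.Joins.congr {a : Matching n} {γ : Bridge a} {i j i' j' : Fin (2 * n)}
    (h : γ.Joins i j) (hi : arcThrough a i' = arcThrough a i)
    (hj : arcThrough a j' = arcThrough a j) : γ.Joins i' j' := by
  unfold Bridge.Joins at *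
  rw [hi, hj]
  exact h

theorem Bridge.Joins.eq {a : Matching n} {γ η : Bridge a} {i j : Fin (2 * n)}
    (hγ : γ.Joins i j) (hη : η.Joins i j) : γ = η := by
  have l1 := γ.lt
  have l2 := η.lt
  have l3 : ∀ α β : Arc a, α.left < β.left → ¬ β.left < α.left := fun α β h => not_lt.2 h.le
  unfold Bridge.Joins at hγ hη
  ext <;> grind

/-- A bridge which creates the arc `{p, q}` connects the arcs through `p` and `q`. -/
theorem Bridge.joins_of_surger_partner {a : Matching n} {γ : Bridge a} {p q : Fin (2 * n)}
    (h : (surger γ).partner p = q) (hne : a.partner p ≠ q) : γ.Joins p q := by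
  have h1 := (surger_partner_ne_iff γ p).1 (by rw [h]; exact hne.symm)
  have hq : (surger γ).partner q = p := by rw [← h, (surger γ).partner_partner]
  have h2 := (surger_partner_ne_iff γ q).1 (by
    rw [hq]
    intro hcon
    exact hne (by rw [hcon, a.partner_partner]))
  have h3 : arcThrough a p ≠ arcThrough a q := by
    rw [Ne, arcThrough_eq_iff]
    rintro (h4 | h4)
    · exact (surger γ).partner_ne p (by rw [h, h4])
    · exact hne h4.symm
  unfold Bridge.Joins
  grind

theorem IsShortcut.exists_bridge {a c : Matching n} {p q : Fin (2 * n)}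
    (h : IsShortcut a c p q) :
    ∃ δ : Bridge a, δ.Joins p q ∧ (surger δ).partner = reconnect a.partner p q :=
  exists_bridge_of_closed a h.lt h.partner_ne fun y h1 h2 => by
    obtain ⟨h3, h4, h5⟩ := h.inside y h1 h2
    rw [h5]
    exact ⟨h3, h4⟩

theorem IsShortcut.circles {a c : Matching n} {p q : Fin (2 * n)} (h : IsShortcut a c p q)
    {δ : Bridge a} (hδ : δ.Joins p q) : circles (surger δ) c = circles a c + 1 := by
  refine circles_surger_of_eq hδ ?_
  rw [← h.partner_eq, component_partner (by simp)]

/-- A surgery which splits a circle of `W(a)c` does not affect the arcs inside a shortcut, because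
these form circles with only one arc of `a`. -/
theorem IsShortcut.surger {a c : Matching n} {p q : Fin (2 * n)} (h : IsShortcut a c p q)
    {γ : Bridge a} (hγ : KhovanovArc.circles (surger γ) c = KhovanovArc.circles a c + 1)
    (hne : (surger γ).partner p ≠ q) : IsShortcut (surger γ) c p q := by
  refine ⟨h.lt, h.partner_eq, hne, fun y h1 h2 => ?_⟩
  obtain ⟨h3, h4, h5⟩ := h.inside y h1 h2
  refine ⟨h3, h4, ?_⟩
  rw [← h5]
  by_contra hcon
  have hy := (surger_partner_ne_iff γ y).1 hcon
  have hcomp : component {a, c} γ.fst.left = component {a, c} γ.snd.left := by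
    by_contra hcomp
    have := circles_surger_of_ne γ.joins_left hcomp
    omega
  have hcl : ∀ z, component {a, c} y = component {a, c} z → z = y ∨ z = a.partner y := by
    intro z hz
    have := (orbitSetoid_mem_iff (P := {y, a.partner y}) ?_ (component_pair_eq_iff.1 hz)).1
      (by simp)
    · simpa using this
    · have := a.partner_partner y
      have := c.partner_partner y
      rintro f (rfl | rfl) z
      · have := a.partner_partner z
        simp only [Set.mem_insert_iff, Set.mem_singleton_iff]
        grind
      · have := c.partner_partner z
        simp only [Set.mem_insert_iff, Set.mem_singleton_iff]
        grind
  have hfs := γ.fst_ne_snd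
  rcases hy with hy | hy
  · have := hcl γ.snd.left (by rw [← hcomp, ← hy, component_arcThrough (by simp)])
    rw [← arcThrough_eq_iff, arcThrough_left] at this
    exact hfs (hy.symm.trans this)
  · have := hcl γ.fst.left (by rw [hcomp, ← hy, component_arcThrough (by simp)])
    rw [← arcThrough_eq_iff, arcThrough_left] at this
    exact hfs (this.symm.trans hy)

/-- An arc has an endpoint outside of a given pair of points which is not joined by an arc. -/
theorem exists_arcThrough_eq {a : Matching n} {p q : Fin (2 * n)} (hne : a.partner p ≠ q)
    (α : Arc a) : ∃ i, arcThrough a i = α ∧ i ≠ p ∧ i ≠ q := by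
  by_cases h : α.left ≠ p ∧ α.left ≠ q
  · exact ⟨α.left, arcThrough_left a α, h⟩
  · refine ⟨a.partner α.left, by rw [arcThrough_partner, arcThrough_left], ?_⟩
    have h1 := a.partner_ne α.left
    have h2 := a.partner_partner α.left
    grind

/-- Surgeries at two disjoint pairs of points commute, unless the second one becomes a trivial one after
the first one. -/
theorem reconnect_square {X : Type*} {f : X → X} (hf : IsPairing f) {i j p q : X} (hip : i ≠ p)
    (hiq : i ≠ q) (hjp : j ≠ p) (hjq : j ≠ q) (hij : j ≠ i) (hfij : j ≠ f i) (hpq : q ≠ p)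
    (hfpq : q ≠ f p) (h1 : ¬ (i = f p ∧ j = f q)) (h2 : ¬ (i = f q ∧ j = f p)) :
    reconnect (reconnect f i j) p q = reconnect (reconnect f p q) i j := by
  have happ := hf.apply_apply
  have hne := hf.ne
  funext x
  have := happ p
  have := happ q
  have := happ i
  have := happ j
  have := happ x
  have := hne p
  have := hne q
  have := hne i
  have := hne j
  have := hne x
  clear happ hne hf
  unfold reconnect
  grind (splits := 40)

/-- The form of `reconnect_square` in which the surgery at the arcs through `i` and `j` creates the arc
`{i, f j}`. -/
theorem reconnect_square' {X : Type*} {f : X → X} (hf : IsPairing f) {i j p q : X} (hip : i ≠ p)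
    (hiq : i ≠ q) (hjp : j ≠ p) (hjq : j ≠ q) (hij : j ≠ i) (hfij : j ≠ f i) (hpq : q ≠ p)
    (hfpq : q ≠ f p) (h1 : ¬ (i = f p ∧ j = f q)) (h2 : ¬ (i = f q ∧ j = f p)) :
    reconnect (reconnect f i (f j)) p q
      = reconnect (reconnect f p q) i (reconnect f p q j) := by
  have happ := hf.apply_apply
  have hne := hf.ne
  funext x
  have := happ p
  have := happ q
  have := happ i
  have := happ j
  have := happ x
  have := hne p
  have := hne q
  have := hne i
  have := hne j
  have := hne x
  clear happ hne hf
  unfold reconnect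
  grind (splits := 40)

/-- Any two bridges on `a` towards `c`, one of which is a shortcut, can be drawn without
intersection, and the surgeries along both get two steps closer to `c`. -/
theorem exists_square {a c : Matching n} {p q : Fin (2 * n)} (h : IsShortcut a c p q)
    {γ δ : Bridge a} (hδ : δ.Joins p q) (hγ : circles (surger γ) c = circles a c + 1)
    (hne : γ ≠ δ) : ∃ (δ' : Bridge (surger γ)) (γ' : Bridge (surger δ)), surger δ' = surger γ' ∧
      circles (surger δ') c = circles a c + 2 ∧
      Relation (hBridge γ * hBridge δ' - hBridge δ * hBridge γ') := by
  have h2 := a.partner_partner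
  obtain ⟨δ₁, hδ₁, hδp⟩ := h.exists_bridge
  obtain rfl := hδ.eq hδ₁
  have hpq : (surger γ).partner p ≠ q := fun hcon =>
    hne ((Bridge.joins_of_surger_partner hcon h.partner_ne).eq hδ)
  have hγs := h.surger hγ hpq
  obtain ⟨δ', hδ', hδ'p⟩ := hγs.exists_bridge
  -- as `{p, q}` is not an arc of `a`, the ends of `γ` can be slid to points different from `p`, `q`
  obtain ⟨i, hi, hip, hiq⟩ := exists_arcThrough_eq h.partner_ne γ.fst
  obtain ⟨j, hj, hjp, hjq⟩ := exists_arcThrough_eq h.partner_ne γ.snd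
  have hij : γ.Joins i j := Or.inl ⟨hi.symm, hj.symm⟩
  have ap : ∀ {x y}, x = a.partner y → arcThrough a y = arcThrough a x := by
    rintro x y rfl
    exact (arcThrough_partner a y).symm
  have k1 : ¬ (i = a.partner p ∧ j = a.partner q) := fun hcon =>
    hne ((hij.congr (ap hcon.1) (ap hcon.2)).eq hδ)
  have k2 : ¬ (i = a.partner q ∧ j = a.partner p) := fun hcon =>
    hne ((hij.congr (ap hcon.1) (ap hcon.2)).eq hδ.symm)
  obtain ⟨γ', hγ', hγ'e⟩ : ∃ γ' : Bridge (surger δ), γ'.Joins i j ∧ surger γ' = surger δ' := by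
    rcases hij.surger_partner with hs | hs
    · have key := reconnect_square a.isPairing hip hiq hjp hjq hij.ne hij.ne_partner h.lt.ne'
        h.partner_ne.symm k1 k2
      rw [← hs, ← hδp, ← hδ'p] at key
      refine exists_bridge hij.ne ?_ key
      intro hcon
      rw [hδp] at hcon
      unfold reconnect at hcon
      have := h2 i
      have := h2 p
      have := h2 q
      have := hij.ne_partner
      grind
    · have key := reconnect_square' a.isPairing hip hiq hjp hjq hij.ne hij.ne_partner h.lt.ne'
        h.partner_ne.symm k1 k2
      rw [← hs, ← hδp, ← hδ'p] at key
      have hne1 : j ≠ (surger δ).partner i := by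
        intro hcon
        rw [hδp] at hcon
        unfold reconnect at hcon
        have := h2 i
        have := h2 p
        have := h2 q
        have := hij.ne_partner
        grind
      have hji : (surger δ).partner j ≠ (surger δ).partner i := by
        intro hcon
        apply hij.ne
        rw [← (surger δ).partner_partner j, hcon, (surger δ).partner_partner]
      obtain ⟨γ', hγ', hγ'e⟩ := exists_bridge (p := i) (q := (surger δ).partner j)
        (fun hcon => hne1 (by rw [← hcon, (surger δ).partner_partner])) hji key
      exact ⟨γ', hγ'.congr rfl (arcThrough_partner _ j).symm, hγ'e⟩
  refine ⟨δ', γ', hγ'e.symm, ?_, ?_⟩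
  · rw [hγs.circles hδ', hγ]
  · exact Relation.twoBridges γ δ hne i j p q hip hiq hjp hjq hij hδ δ' γ' hδ' hγ' hγ'e.symm

/-! ### The product of a bridge and its dual -/

/-- Labellings of the circles which bound spheres, all but one of which have a single boundary circle,
while the remaining one has the boundary circles `α` and `β`: each sphere gets exactly one dot, from a
circle with label `+`. -/
theorem forall_ncard_fiber_eq_one_iff {A B : Type*} {f : A → B}
    (hf : Function.Surjective f) {α β : A} (hne : α ≠ β)
    (h : ∀ C D, f C = f D ↔ C = D ∨ (C = α ∧ D = β) ∨ (C = β ∧ D = α)) (U : Set A) :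
    (∀ k, {C | C ∉ U ∧ f C = k}.ncard = 1) ↔ U = {α} ∨ U = {β} := by
  simp only [Set.ncard_eq_one, Set.ext_iff, Set.mem_ofPred_eq, Set.mem_singleton_iff]
  constructor
  · intro hU
    obtain ⟨x, hx⟩ := hU (f α)
    have hxx := (hx x).2 rfl
    have hα := hx α
    have hβ := hx β
    have hfβ : f β = f α := (h _ _).2 (Or.inr (Or.inr ⟨rfl, rfl⟩))
    have hother : ∀ C, C ≠ α → C ≠ β → C ∉ U := by
      intro C h1 h2 hC
      obtain ⟨y, hy⟩ := hU (f C)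
      obtain ⟨hy1, hy2⟩ := (hy y).2 rfl
      rw [h] at hy2
      grind
    have hxα : x = α ∨ x = β := by
      have := (h x α).1 hxx.2
      grind
    rcases hxα with rfl | rfl
    · right
      intro C
      grind
    · left
      intro C
      grind
  · rintro hU k
    obtain ⟨D, rfl⟩ := hf k
    rcases hU with hU | hU
    · refine ⟨if D = α then β else D, fun C => ?_⟩
      rw [h, hU]
      grind
    · refine ⟨if D = β then α else D, fun C => ?_⟩
      rw [h, hU]
      grind

/-- The minimal cobordism for the product of `h_γ` with its dual connects only the two circles which
contain the arcs joined by `γ`. -/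
theorem component_surger_eq_iff {a : Matching n} (γ : Bridge a) {i j : Fin (2 * n)} :
    component {a, surger γ, a} i = component {a, surger γ, a} j ↔
      component {a, a} i = component {a, a} j ∨
      (component {a, a} i = component {a, a} γ.fst.left ∧
        component {a, a} j = component {a, a} γ.snd.left) ∨
      (component {a, a} i = component {a, a} γ.snd.left ∧
        component {a, a} j = component {a, a} γ.fst.left) := by
  obtain ⟨k, hk, hki, hka, hs⟩ := γ.joins_left.exists_reconnect
  have hk' : component {a, a} k = component {a, a} γ.snd.left := by
    rcases hk with rfl | rfl
    · rfl
    · exact component_partner (by simp) _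
  have hm := mergeSetoid_reconnect a.isPairing hki hka {a.partner}
  rw [← hs] at hm
  have hni : ¬ orbitSetoid {a.partner, a.partner} γ.fst.left k := by
    rw [← component_pair_eq_iff, component_self_eq_iff]
    tauto
  rw [mergeSetoid_eq_self (r := orbitSetoid {(surger γ).partner, a.partner})] at hm
  · have e : ({a, surger γ, a} : Set (Matching n)) = {surger γ, a} := by
      ext x; simp only [Set.mem_insert_iff, Set.mem_singleton_iff]; tauto
    rw [component_eq_congr e, component_pair_eq_iff, ← hm, mergeSetoid_apply,
      ← component_pair_eq_iff, ← component_pair_eq_iff, ← component_pair_eq_iff,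
      ← component_pair_eq_iff, ← component_pair_eq_iff, hk']
  · rw [hs]
    exact orbitSetoid_reconnect_of_not a.isPairing a.isPairing hki hka hni

/-- The product of a bridge and its dual is the comultiplication of the circle that consists of the
two arcs joined by the bridge. -/
theorem basisElt_mul_dual {a : Matching n} (γ : Bridge a) :
    basisElt a (surger γ) ∅ * basisElt (surger γ) a ∅
      = basisElt a a {component {a, a} γ.fst.left} + basisElt a a {component {a, a} γ.snd.left} := by
  have hc := circles_self_surger γ
  have hcard : Nat.card (Cobordism a (surger γ) a) = circles a (surger γ) := by
    have : ({a, surger γ, a} : Set (Matching n)) = {a, surger γ} := by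
      ext x; simp only [Set.mem_insert_iff, Set.mem_singleton_iff]; tauto
    exact congrArg (fun S => Nat.card (Components S)) this
  have hχ : ∀ K : Cobordism a (surger γ) a, closedEuler K = 2 := by
    have h1 := sum_closedEuler_univ a (surger γ) a
    have h3 : ∑ K : Cobordism a (surger γ) a, (2 - closedEuler K) = 0 := by
      rw [Finset.sum_sub_distrib, h1, circles_self, circles_comm (surger γ) a]
      simp only [Finset.sum_const, Finset.card_univ, nsmul_eq_mul]
      rw [← Nat.card_eq_fintype_card, hcard]
      ring
    have h4 : ∀ K ∈ Finset.univ, 0 ≤ 2 - closedEuler (a := a) (b := surger γ) (c := a) K :=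
      fun K _ => by have := closedEuler_le K; omega
    intro K
    have := (Finset.sum_eq_zero_iff_of_nonneg h4).1 h3 K (Finset.mem_univ _)
    omega
  have hne : component {a, a} γ.fst.left ≠ component {a, a} γ.snd.left := by
    rw [Ne, component_self_eq_iff]
    have := γ.joins_left.ne
    have := γ.joins_left.ne_partner
    tauto
  have hval : ∀ d : ℕ, closedValue 2 d = if d = 1 then 1 else 0 := by
    intro d
    simp [closedValue]
  have hsurj : Function.Surjective
      (Components.map (S := {a, a}) (T := {a, surger γ, a}) (by grind)) := by
    intro K
    obtain ⟨i, rfl⟩ := component_surjective _ K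
    exact ⟨component _ i, rfl⟩
  refine basisElt_mul_basisElt_eq (fun U => ?_) fun a' c' U h => ?_
  · have key := forall_ncard_fiber_eq_one_iff hsurj hne (by
      intro C D
      obtain ⟨i, rfl⟩ := component_surjective _ C
      obtain ⟨j, rfl⟩ := component_surjective _ D
      exact component_surger_eq_iff γ) U
    have hdots : ∀ K, dots (a := a) (b := surger γ) (c := a) ∅ ∅ U K
        = {C | C ∉ U ∧ Components.map (S := {a, a}) (T := {a, surger γ, a}) (by grind) C
          = K}.ncard := by
      intro K
      unfold dots
      simp only [Set.mem_empty_iff_false, false_and, Set.ofPred_false, Set.ncard_empty, zero_add]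
      congr 1
      ext C
      simp only [Set.mem_ofPred_eq]
      rw [bounds_iff]
    have hsc : structureConst (a := a) (b := surger γ) (c := a) ∅ ∅ U
        = if U = {component {a, a} γ.fst.left} ∨ U = {component {a, a} γ.snd.left} then 1 else 0 := by
      unfold structureConst
      simp only [hχ, hval, hdots]
      split_ifs with hall
      · exact Finset.prod_eq_one fun K _ => if_pos (key.2 hall K)
      · rw [← key] at hall
        push Not at hall
        obtain ⟨K, hK⟩ := hall
        exact Finset.prod_eq_zero (Finset.mem_univ K) (if_neg hK)
    rw [hsc]
    change _ = basisElt a a _ a a U + basisElt a a _ a a U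
    rw [basisElt_apply, basisElt_apply]
    have : ({component {a, a} γ.fst.left} : Set (Circle a a)) ≠ {component {a, a} γ.snd.left} :=
      fun h => hne (Set.singleton_injective h)
    split_ifs <;> simp_all
  · change basisElt a a _ a' c' U + basisElt a a _ a' c' U = 0
    rw [basisElt_apply_of_ne _ _ h, basisElt_apply_of_ne _ _ h, add_zero]

/-! ### The unit, the augmentation and the natural map -/

/-- The additive map on `H^n` with given values on the basis. -/
def ArcAlgebra.lift {M : Type*} [AddCommGroup M] (f : ∀ a b : Matching n, Set (Circle a b) → M) :
    ArcAlgebra n →+ M where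
  toFun x := ∑ a, ∑ b, ∑ S, x a b S • f a b S
  map_zero' := by
    refine Finset.sum_eq_zero fun a _ => Finset.sum_eq_zero fun b _ =>
      Finset.sum_eq_zero fun S _ => ?_
    change (0 : ℤ) • _ = _
    rw [zero_smul]
  map_add' x y := by
    simp only [← Finset.sum_add_distrib]
    refine Finset.sum_congr rfl fun a _ => Finset.sum_congr rfl fun b _ =>
      Finset.sum_congr rfl fun S _ => ?_
    change (x a b S + y a b S) • _ = _
    rw [add_smul]

theorem ArcAlgebra.lift_basisElt {M : Type*} [AddCommGroup M]
    (f : ∀ a b : Matching n, Set (Circle a b) → M) (a b : Matching n) (S : Set (Circle a b)) :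
    ArcAlgebra.lift f (basisElt a b S) = f a b S := by
  change ∑ a', ∑ b', ∑ S', basisElt a b S a' b' S' • f a' b' S' = _
  rw [Finset.sum_eq_single a, Finset.sum_eq_single b, Finset.sum_eq_single S]
  · rw [basisElt_apply, if_pos rfl, one_smul]
  · intro S' _ h
    rw [basisElt_apply, if_neg h, zero_smul]
  · simp
  · intro b' _ h
    exact Finset.sum_eq_zero fun S' _ => by
      rw [basisElt_apply_of_ne _ _ (Or.inr h), zero_smul]
  · simp
  · intro a' _ h
    exact Finset.sum_eq_zero fun b' _ => Finset.sum_eq_zero fun S' _ => by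
      rw [basisElt_apply_of_ne _ _ (Or.inl h), zero_smul]
  · simp

theorem ArcAlgebra.sum_apply {ι : Type*} (s : Finset ι) (f : ι → ArcAlgebra n) (a b : Matching n)
    (S : Set (Circle a b)) : (∑ i ∈ s, f i) a b S = ∑ i ∈ s, f i a b S :=
  map_sum (⟨⟨fun x => x a b S, rfl⟩, fun _ _ => rfl⟩ : ArcAlgebra n →+ ℤ) f s

theorem ArcAlgebra.smul_apply (k : ℤ) (x : ArcAlgebra n) (a b : Matching n)
    (S : Set (Circle a b)) : (k • x) a b S = k * x a b S := by
  rw [← smul_eq_mul]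
  exact map_zsmul (⟨⟨fun x => x a b S, rfl⟩, fun _ _ => rfl⟩ : ArcAlgebra n →+ ℤ) k x

theorem ArcAlgebra.lift_basis (x : ArcAlgebra n) : ArcAlgebra.lift basisElt x = x := by
  funext a b S
  change (∑ a', ∑ b', ∑ S', x a' b' S' • basisElt a' b' S' : ArcAlgebra n) a b S = _
  simp only [ArcAlgebra.sum_apply, ArcAlgebra.smul_apply]
  rw [Finset.sum_eq_single a, Finset.sum_eq_single b, Finset.sum_eq_single S]
  · rw [basisElt_apply, if_pos rfl, mul_one]
  · intro S' _ h
    rw [basisElt_apply, if_neg h.symm, mul_zero]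
  · simp
  · intro b' _ h
    exact Finset.sum_eq_zero fun S' _ => by
      rw [basisElt_apply_of_ne _ _ (Or.inr h.symm), mul_zero]
  · simp
  · intro a' _ h
    exact Finset.sum_eq_zero fun b' _ => Finset.sum_eq_zero fun S' _ => by
      rw [basisElt_apply_of_ne _ _ (Or.inl h.symm), mul_zero]
  · simp

theorem ArcAlgebra.addHom_ext {M : Type*} [AddCommGroup M] {f g : ArcAlgebra n →+ M}
    (h : ∀ a b S, f (basisElt a b S) = g (basisElt a b S)) : f = g := by
  ext x
  rw [← ArcAlgebra.lift_basis x]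
  change f (∑ a, ∑ b, ∑ S, x a b S • basisElt a b S) = g (∑ a, ∑ b, ∑ S, x a b S • basisElt a b S)
  simp only [map_sum, map_zsmul, h]

theorem ofIdempotents_single (e : Matching n) :
    ofIdempotents (Pi.single e 1) = basisElt e e ∅ := by
  unfold ofIdempotents
  rw [Finset.sum_eq_single e]
  · rw [Pi.single_eq_same, one_smul]
  · intro b _ h
    rw [Pi.single_eq_of_ne h, zero_smul]
  · simp

theorem ofIdempotents_mul_basisElt (r : Matching n → ℤ) (a b : Matching n) (S : Set (Circle a b)) :
    ofIdempotents r * basisElt a b S = r a • basisElt a b S := by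
  unfold ofIdempotents
  rw [Finset.sum_mul, Finset.sum_eq_single a]
  · rw [smul_mul_assoc, basisElt_idem_mul]
  · intro c _ h
    rw [smul_mul_assoc, basisElt_mul_basisElt_of_ne _ _ h, smul_zero]
  · simp

theorem basisElt_mul_ofIdempotents (r : Matching n → ℤ) (a b : Matching n) (S : Set (Circle a b)) :
    basisElt a b S * ofIdempotents r = r b • basisElt a b S := by
  unfold ofIdempotents
  rw [Finset.mul_sum, Finset.sum_eq_single b]
  · rw [mul_smul_comm, basisElt_mul_idem]
  · intro c _ h
    rw [mul_smul_comm, basisElt_mul_basisElt_of_ne _ _ h.symm, smul_zero]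
  · simp

theorem ofIdempotents_one_mul (x : ArcAlgebra n) : ofIdempotents 1 * x = x :=
  DFunLike.congr_fun (ArcAlgebra.addHom_ext (f := AddMonoidHom.mulLeft (ofIdempotents 1))
    (g := AddMonoidHom.id _) fun a b S => by
      change ofIdempotents 1 * basisElt a b S = basisElt a b S
      rw [ofIdempotents_mul_basisElt, Pi.one_apply, one_smul]) x

theorem mul_ofIdempotents_one (x : ArcAlgebra n) : x * ofIdempotents 1 = x :=
  DFunLike.congr_fun (ArcAlgebra.addHom_ext (f := AddMonoidHom.mulRight (ofIdempotents 1))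
    (g := AddMonoidHom.id _) fun a b S => by
      change basisElt a b S * ofIdempotents 1 = basisElt a b S
      rw [basisElt_mul_ofIdempotents, Pi.one_apply, one_smul]) x

/-- The unital ring `H^n`, with unit the sum of the elementary idempotents. It is not declared as an
instance, because `ArcAlgebra n` already carries the structure of a nonunital nonassociative ring. -/
@[reducible]
def arcRing (n : ℕ) : Ring (ArcAlgebra n) where
  __ := (inferInstance : NonUnitalNonAssocRing (ArcAlgebra n))
  one := ofIdempotents 1
  mul_assoc := ArcAlgebra.mul_assoc
  one_mul := ofIdempotents_one_mul
  mul_one := mul_ofIdempotents_one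

/-- The augmentation of `H^n`, which reads off the coefficients of the idempotents `1_a`. -/
def augmentation (x : ArcAlgebra n) : Matching n → ℤ := fun a => x a a ∅

theorem ofIdempotents_apply (r : Matching n → ℤ) (a b : Matching n) (S : Set (Circle a b)) :
    ofIdempotents r a b S = if degree a b S = 0 then r a else 0 := by
  unfold ofIdempotents
  simp only [ArcAlgebra.sum_apply, ArcAlgebra.smul_apply]
  split_ifs with h
  · obtain ⟨rfl, rfl⟩ := degree_eq_zero_iff.1 h
    rw [Finset.sum_eq_single a]
    · rw [basisElt_apply, if_pos rfl, mul_one]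
    · intro b _ hb
      rw [basisElt_apply_of_ne _ _ (Or.inl hb.symm), mul_zero]
    · simp
  · refine Finset.sum_eq_zero fun c _ => ?_
    by_cases hc : a = c ∧ b = c
    · obtain ⟨rfl, rfl⟩ := hc
      rw [basisElt_apply, if_neg, mul_zero]
      exact fun hS => h (degree_eq_zero_iff.2 ⟨rfl, hS⟩)
    · rw [basisElt_apply_of_ne _ _ (by tauto), mul_zero]

theorem ofIdempotents_augmentation (x : ArcAlgebra n) :
    ofIdempotents (augmentation x) = degreeZeroPart x := by
  funext a b S
  rw [ofIdempotents_apply, degreeZeroPart]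
  split_ifs with h
  · obtain ⟨rfl, rfl⟩ := degree_eq_zero_iff.1 h
    rfl
  · rfl

theorem augmentation_mul (x y : ArcAlgebra n) :
    augmentation (x * y) = augmentation x * augmentation y := by
  funext a
  -- factors of nonnegative degrees with product of degree zero have degree zero
  have key : ∀ (b : Matching n) (S : Set (Circle a b)) (T : Set (Circle b a)),
      ¬ (a = b ∧ S = ∅) ∨ ¬ (b = a ∧ T = ∅) →
        structureConst S T (∅ : Set (Circle a a)) = 0 := by
    intro b S T h
    by_contra hne
    have h1 := degree_add hne
    have h2 := degree_nonneg a b S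
    have h3 := degree_nonneg b a T
    rw [degree_eq_zero_iff.2 ⟨rfl, rfl⟩] at h1
    rw [← degree_eq_zero_iff, ← degree_eq_zero_iff] at h
    omega
  change (x * y) a a ∅ = x a a ∅ * y a a ∅
  rw [ArcAlgebra.mul_apply, Finset.sum_eq_single a, Finset.sum_eq_single ∅,
    Finset.sum_eq_single ∅]
  · rw [← basisElt_mul_basisElt_apply, basisElt_idem_mul, basisElt_apply, if_pos rfl, mul_one]
  · intro T _ h
    rw [key a ∅ T (by tauto), mul_zero]
  · simp
  · intro S _ h
    exact Finset.sum_eq_zero fun T _ => by rw [key a S T (by tauto), mul_zero]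
  · simp
  · intro b _ h
    exact Finset.sum_eq_zero fun S _ => Finset.sum_eq_zero fun T _ => by
      rw [key b S T (by tauto), mul_zero]
  · simp

theorem augmentation_ofIdempotents (r : Matching n → ℤ) : augmentation (ofIdempotents r) = r := by
  funext a
  change ofIdempotents r a a ∅ = r a
  rw [ofIdempotents_apply, if_pos (degree_eq_zero_iff.2 ⟨rfl, rfl⟩)]

theorem ofIdempotents_add (r r' : Matching n → ℤ) :
    ofIdempotents (r + r') = ofIdempotents r + ofIdempotents r' := by
  unfold ofIdempotents
  rw [← Finset.sum_add_distrib]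
  exact Finset.sum_congr rfl fun a _ => add_smul _ _ _

theorem ofIdempotents_mul (r r' : Matching n → ℤ) :
    ofIdempotents (r * r') = ofIdempotents r * ofIdempotents r' := by
  conv_rhs => rw [ofIdempotents, Finset.sum_mul]
  refine Finset.sum_congr rfl fun a _ => ?_
  rw [smul_mul_assoc, basisElt_mul_ofIdempotents, smul_smul, Pi.mul_apply]

theorem isAugmentedAlgebra : LinQuad.IsAugmentedAlgebra (ofIdempotents (n := n)) augmentation where
  mul_assoc := ArcAlgebra.mul_assoc
  one_mul := ofIdempotents_one_mul
  mul_one := mul_ofIdempotents_one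
  map_add := ofIdempotents_add
  map_mul := ofIdempotents_mul
  aug_add _ _ := rfl
  aug_mul := augmentation_mul
  aug_map := augmentation_ofIdempotents

/-- The generators are basis elements of positive degree. -/
theorem Gen.toArcAlgebra_eq (g : Gen n) : ∃ S, g.toArcAlgebra = basisElt g.left g.right S ∧
    ¬ (g.left = g.right ∧ S = ∅) := by
  cases g with
  | bridge a γ => exact ⟨∅, rfl, fun h => surger_ne γ h.1.symm⟩
  | arc a α => exact ⟨_, rfl, fun h => Set.singleton_ne_empty _ h.2⟩

theorem augmentation_toArcAlgebra (g : Gen n) : augmentation g.toArcAlgebra = 0 := by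
  obtain ⟨S, hg, hne⟩ := g.toArcAlgebra_eq
  funext a
  change g.toArcAlgebra a a ∅ = 0
  rw [hg]
  by_cases h : a = g.left ∧ a = g.right
  · generalize g.left = b at *
    generalize g.right = c at *
    obtain ⟨rfl, rfl⟩ := h
    rw [basisElt_apply, if_neg]
    exact fun hS => hne ⟨rfl, hS.symm⟩
  · rw [basisElt_apply_of_ne _ _ (by tauto)]

theorem left_idem_toArcAlgebra (g : Gen n) :
    ofIdempotents (Pi.single g.left 1) * g.toArcAlgebra = g.toArcAlgebra := by
  obtain ⟨S, hg, -⟩ := g.toArcAlgebra_eq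
  rw [hg, ofIdempotents_single, basisElt_idem_mul]

theorem right_idem_toArcAlgebra (g : Gen n) :
    g.toArcAlgebra * ofIdempotents (Pi.single g.right 1) = g.toArcAlgebra := by
  obtain ⟨S, hg, -⟩ := g.toArcAlgebra_eq
  rw [hg, ofIdempotents_single, basisElt_mul_idem]

/-- The natural map `T(V) → H^n` as a homomorphism of unital rings. -/
def naturalRingHom (n : ℕ) :
    letI := arcRing n
    TV n →+* ArcAlgebra n :=
  letI := arcRing n
  RingQuot.lift ⟨(FreeAlgebra.lift ℤ (Sum.elim (fun e => basisElt e e ∅)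
    Gen.toArcAlgebra)).toRingHom, by
      have hι : ∀ z, (FreeAlgebra.lift ℤ (Sum.elim (fun e : Matching n => basisElt e e ∅)
          Gen.toArcAlgebra)).toRingHom (FreeAlgebra.ι ℤ z)
          = Sum.elim (fun e => basisElt e e ∅) Gen.toArcAlgebra z :=
        fun z => FreeAlgebra.lift_ι_apply _ z
      intro x y h
      induction h with
      | idem e =>
        rw [map_mul, hι]
        exact basisElt_idem_mul _
      | orth e f h =>
        rw [map_mul, hι, hι, map_zero]
        exact basisElt_mul_basisElt_of_ne _ _ h
      | one =>
        rw [map_sum, map_one]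
        simp only [hι]
        change ∑ e, basisElt e e ∅ = ofIdempotents 1
        unfold ofIdempotents
        exact Finset.sum_congr rfl fun a _ => (one_smul _ _).symm
      | left g =>
        rw [map_mul, hι, hι]
        simpa [ofIdempotents_single] using left_idem_toArcAlgebra g
      | right g =>
        rw [map_mul, hι, hι]
        simpa [ofIdempotents_single] using right_idem_toArcAlgebra g⟩

/-- The natural map `T(V) → H^n`. -/
def naturalMap (n : ℕ) : TV n →ₙ+* ArcAlgebra n where
  toFun := naturalRingHom n
  map_mul' := letI := arcRing n; map_mul (naturalRingHom n)
  map_zero' := letI := arcRing n; map_zero (naturalRingHom n)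
  map_add' := letI := arcRing n; map_add (naturalRingHom n)

theorem naturalMap_idem (e : Matching n) :
    naturalMap n (LinQuad.idem _ _ e) = basisElt e e ∅ := by
  let _ := arcRing n
  exact (RingQuot.lift_mkRingHom_apply _ _ _).trans (FreeAlgebra.lift_ι_apply _ _)

theorem naturalMap_gen (g : Gen n) : naturalMap n (LinQuad.gen _ _ g) = g.toArcAlgebra := by
  let _ := arcRing n
  exact (RingQuot.lift_mkRingHom_apply _ _ _).trans (FreeAlgebra.lift_ι_apply _ _)

theorem naturalMap_hBridge {a : Matching n} (γ : Bridge a) :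
    naturalMap n (hBridge γ) = basisElt a (surger γ) ∅ :=
  naturalMap_gen _

theorem naturalMap_hArc {a : Matching n} (i : Fin (2 * n)) :
    naturalMap n (hArc (arcThrough a i)) = basisElt a a {component {a, a} i} := by
  rw [← component_arcThrough (a := a) (by simp)]
  exact naturalMap_gen _

/-! ### The relations hold in the arc algebra -/

theorem basisElt_empty_congr {a b c : Matching n} (h : b = c) :
    basisElt a b ∅ = basisElt a c ∅ := by
  subst h; rfl

theorem eq_of_circles {a c : Matching n} (h : circles a c = n) : a = c := by
  by_contra hne
  exact absurd (circles_lt hne) (by omega)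

/-- Two composable bridges which are not dual to each other decrease the number of circles by
two. -/
theorem circles_surger_surger {a : Matching n} {γ : Bridge a} {η : Bridge (surger γ)}
    (h : surger η ≠ a) : circles a (surger η) + 2 = n := by
  have h1 := circles_self_surger γ
  have h2 := circles_surger η a
  have h3 := circles_lt h
  rw [circles_comm (surger γ), circles_comm (surger η)] at h2
  rw [circles_comm] at h3
  omega

theorem hBridge_mul_hBridge {a : Matching n} {γ : Bridge a} {η : Bridge (surger γ)}
    (h : surger η ≠ a) :
    naturalMap n (hBridge γ * hBridge η) = basisElt a (surger η) ∅ := by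
  rw [map_mul, naturalMap_hBridge, naturalMap_hBridge]
  refine basisElt_mul_basisElt_empty ?_
  have h1 := circles_self_surger γ
  have h2 := circles_self_surger η
  have h3 := circles_surger_surger h
  omega

/-- The bridge which a bridge `η ≠ γ` gives after surgery along `γ` is not dual to `γ`. -/
theorem surger_ne_of_joins {a : Matching n} {γ η : Bridge a} (hne : γ ≠ η) {i j k l : Fin (2 * n)}
    (hγ : γ.Joins i j) (hη : η.Joins k l) {η' : Bridge (surger γ)} (hη' : η'.Joins k l) : surger η' ≠ a := by
  intro h
  have key : ∀ x, (arcThrough (surger γ) x = η'.fst ∨ arcThrough (surger γ) x = η'.snd) →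
      arcThrough a x = arcThrough a i ∨ arcThrough a x = arcThrough a j := by
    intro x hx
    rw [← surger_partner_ne_iff, h, ne_comm, surger_partner_ne_iff] at hx
    rcases hγ with ⟨h1, h2⟩ | ⟨h1, h2⟩ <;> rw [h1, h2] at hx <;> tauto
  have hk := key k (by rcases hη' with ⟨h1, h2⟩ | ⟨h1, h2⟩ <;> simp [h1, h2])
  have hl := key l (by rcases hη' with ⟨h1, h2⟩ | ⟨h1, h2⟩ <;> simp [h1, h2])
  have hkl := hη.arcThrough_ne
  apply hne
  rcases hk with hk | hk <;> rcases hl with hl | hl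
  · exact absurd (hk.trans hl.symm) hkl
  · exact hγ.eq (hη.congr hk.symm hl.symm)
  · exact hγ.eq (hη.symm.congr hl.symm hk.symm)
  · exact absurd (hk.trans hl.symm) hkl

theorem naturalMap_eq_zero_of_relation {r : TV n} (h : Relation r) : naturalMap n r = 0 := by
  induction h with
  | @twoBridges a γ η hne i j k l _ _ _ _ hγ hη η' γ' hη' hγ' ht =>
    have h1 := surger_ne_of_joins hne hγ hη hη'
    rw [map_sub, hBridge_mul_hBridge h1, hBridge_mul_hBridge (ht ▸ h1), sub_eq_zero]
    exact basisElt_empty_congr ht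
  | @bridgeArc a γ i =>
    rw [map_sub, map_mul, map_mul, naturalMap_hArc, naturalMap_hArc, naturalMap_hBridge,
      basisElt_arc_mul, basisElt_mul_arc, sub_self]
  | @twoArcs a α₁ α₂ =>
    rw [← arcThrough_left a α₁, ← arcThrough_left a α₂, map_sub, map_mul, map_mul,
      naturalMap_hArc, naturalMap_hArc, basisElt_arc_mul, basisElt_mul_arc, sub_self]
  | @arcSquare a α =>
    rw [← arcThrough_left a α, map_mul, naturalMap_hArc, basisElt_arc_mul,
      if_pos (Set.mem_singleton _)]
  | @dualBridge a γ γd hd =>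
    rw [← arcThrough_left a γ.fst, ← arcThrough_left a γ.snd, map_sub, map_sub, map_mul,
      naturalMap_hArc, naturalMap_hArc, naturalMap_hBridge, naturalMap_hBridge,
      basisElt_empty_congr hd, basisElt_mul_dual, sub_sub, sub_eq_zero]

end KhovanovArc

/-! ### The tensor algebra -/

namespace LinQuad

variable {E G : Type} [Fintype E] (s t : G → E)

theorem idem_mul_idem (e : E) : idem s t e * idem s t e = idem s t e := by
  unfold idem
  exact (map_mul _ _ _).symm.trans (RingQuot.mkRingHom_rel (.idem e))

theorem idem_mul_idem_of_ne {e f : E} (h : e ≠ f) : idem s t e * idem s t f = 0 := by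
  unfold idem
  exact (map_mul _ _ _).symm.trans ((RingQuot.mkRingHom_rel (.orth e f h)).trans (map_zero _))

theorem sum_idem : ∑ e, idem s t e = 1 := by
  unfold idem
  exact (map_sum _ _ _).symm.trans ((RingQuot.mkRingHom_rel .one).trans (map_one _))

theorem idem_mul_gen (g : G) : idem s t (s g) * gen s t g = gen s t g := by
  unfold idem gen
  exact (map_mul _ _ _).symm.trans (RingQuot.mkRingHom_rel (.left g))

theorem gen_mul_idem (g : G) : gen s t g * idem s t (t g) = gen s t g := by
  unfold idem gen
  exact (map_mul _ _ _).symm.trans (RingQuot.mkRingHom_rel (.right g))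

theorem gen_mul_gen_of_ne {g h : G} (hne : t g ≠ s h) : gen s t g * gen s t h = 0 := by
  rw [← gen_mul_idem, ← idem_mul_gen s t h, mul_assoc, ← mul_assoc (idem s t _),
    idem_mul_idem_of_ne s t hne, zero_mul, mul_zero]

/-- The tensor algebra is generated by the idempotents and the elements of `G`. -/
theorem mem_of_subring (A : Subring (TensorAlg s t)) (hi : ∀ e, idem s t e ∈ A)
    (hg : ∀ g, gen s t g ∈ A) (x : TensorAlg s t) : x ∈ A := by
  obtain ⟨y, rfl⟩ : ∃ y, RingQuot.mkRingHom (TensorRel s t) y = x :=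
    RingQuot.mkRingHom_surjective _ x
  induction y using FreeAlgebra.induction with
  | grade0 r => exact (map_intCast (RingQuot.mkRingHom (TensorRel s t)) r) ▸ intCast_mem A r
  | grade1 z =>
    cases z with
    | inl e => exact hi e
    | inr g => exact hg g
  | mul x y hx hy => exact (map_mul (RingQuot.mkRingHom (TensorRel s t)) x y) ▸ A.mul_mem hx hy
  | add x y hx hy => exact (map_add (RingQuot.mkRingHom (TensorRel s t)) x y) ▸ A.add_mem hx hy

end LinQuad

namespace KhovanovArc

variable {n : ℕ}

/-! ### Geodesics in the tensor algebra -/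

theorem exists_shortcut_bridge {a c : Matching n} (h : a ≠ c) :
    ∃ (δ : Bridge a) (p q : Fin (2 * n)), IsShortcut a c p q ∧ δ.Joins p q := by
  obtain ⟨p, q, hpq⟩ := exists_isShortcut h
  obtain ⟨δ, hδ, -⟩ := hpq.exists_bridge
  exact ⟨δ, p, q, hpq, hδ⟩

/-- A bridge on `a ≠ c` whose surgery leads one step closer to `c`. -/
def shortcut {a c : Matching n} (h : a ≠ c) : Bridge a := (exists_shortcut_bridge h).choose

theorem exists_shortcut_joins {a c : Matching n} (h : a ≠ c) :
    ∃ p q, IsShortcut a c p q ∧ (shortcut h).Joins p q :=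
  (exists_shortcut_bridge h).choose_spec

theorem circles_shortcut {a c : Matching n} (h : a ≠ c) :
    circles (surger (shortcut h)) c = circles a c + 1 := by
  obtain ⟨p, q, hpq, hδ⟩ := exists_shortcut_joins h
  exact hpq.circles hδ

/-- The product of the bridges on a shortest path of surgeries from `a` to `c`. -/
def geodesic (a c : Matching n) : TV n :=
  if h : a = c then LinQuad.idem _ _ a
  else hBridge (shortcut h) * geodesic (surger (shortcut h)) c
termination_by n - circles a c
decreasing_by
  have := circles_shortcut h
  have := circles_lt h
  omega

theorem geodesic_self (a : Matching n) : geodesic a a = LinQuad.idem _ _ a := by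
  rw [geodesic, dif_pos rfl]

theorem geodesic_of_ne {a c : Matching n} (h : a ≠ c) :
    geodesic a c = hBridge (shortcut h) * geodesic (surger (shortcut h)) c := by
  rw [geodesic, dif_neg h]

/-- Induction along geodesics to `c`. -/
theorem geodesic_induction {c : Matching n} {P : Matching n → Prop} (base : P c)
    (step : ∀ a (h : a ≠ c), P (surger (shortcut h)) → P a) (a : Matching n) : P a := by
  induction hk : n - circles a c using Nat.strong_induction_on generalizing a with
  | _ k ih =>
    by_cases h : a = c
    · rw [h]; exact base
    · refine step a h (ih _ ?_ _ rfl)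
      have := circles_shortcut h
      have := circles_lt h
      omega

theorem idem_mul_geodesic (a c : Matching n) :
    LinQuad.idem _ _ a * geodesic a c = geodesic a c := by
  by_cases h : a = c
  · subst h
    rw [geodesic_self, LinQuad.idem_mul_idem]
  · rw [geodesic_of_ne h, ← mul_assoc]
    exact congrArg (· * _) (LinQuad.idem_mul_gen _ _ (Gen.bridge a _))

theorem naturalMap_geodesic (a c : Matching n) :
    naturalMap n (geodesic a c) = basisElt a c ∅ := by
  induction a using geodesic_induction (c := c) with
  | base => rw [geodesic_self, naturalMap_idem]
  | step a h ih =>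
    rw [geodesic_of_ne h, map_mul, ih, naturalMap_hBridge]
    refine basisElt_mul_basisElt_empty ?_
    have := circles_self_surger (shortcut h)
    have := circles_shortcut h
    omega

/-- The arc through a point, as a generator of `T(V)`. -/
def dot (a : Matching n) (i : Fin (2 * n)) : TV n := hArc (arcThrough a i)

theorem dot_partner (a : Matching n) (i : Fin (2 * n)) : dot a (a.partner i) = dot a i := by
  rw [dot, arcThrough_partner, dot]

theorem idem_mul_dot (a : Matching n) (i : Fin (2 * n)) :
    LinQuad.idem _ _ a * dot a i = dot a i :=
  LinQuad.idem_mul_gen _ _ (Gen.arc a _)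

theorem dot_mul_idem (a : Matching n) (i : Fin (2 * n)) :
    dot a i * LinQuad.idem _ _ a = dot a i :=
  LinQuad.gen_mul_idem _ _ (Gen.arc a _)

theorem hBridge_mul_idem {a : Matching n} (γ : Bridge a) :
    hBridge γ * LinQuad.idem _ _ (surger γ) = hBridge γ :=
  LinQuad.gen_mul_idem _ _ (Gen.bridge a γ)

/-- A point on the component `C`. -/
def basePoint {S : Set (Matching n)} (C : Components S) : Fin (2 * n) := Quotient.out C

theorem component_basePoint {S : Set (Matching n)} (C : Components S) :
    component S (basePoint C) = C :=
  Quotient.out_eq C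

/-! ### The inverse of the natural map modulo the relations -/

section Presented

variable {R : Type*} [Ring R] (f : TV n →+* R)

/-- Modulo the relations, all shortest paths of surgeries from `a` to `c` have the same product. -/
theorem map_hBridge_mul_geodesic (hf : ∀ r, Relation r → f r = 0) {a c : Matching n}
    (γ : Bridge a) (hγ : circles (surger γ) c = circles a c + 1) :
    f (hBridge γ * geodesic (surger γ) c) = f (geodesic a c) := by
  induction hk : n - circles a c using Nat.strong_induction_on generalizing a with
  | _ k ih =>
    have hle := circles_le (surger γ) c
    have hac : a ≠ c := by
      rintro rfl
      rw [circles_self] at hγ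
      omega
    rw [geodesic_of_ne hac]
    by_cases hne : γ = shortcut hac
    · rw [hne]
    -- both geodesics may be continued through the fourth corner of a square
    obtain ⟨p, q, hpq, hδ⟩ := exists_shortcut_joins hac
    have hδc := circles_shortcut hac
    obtain ⟨δ', γ', ht, hc, hrel⟩ := exists_square hpq hδ hγ hne
    have h1 := ih _ (by omega) δ' (by omega) rfl
    have h2 := ih _ (by omega) γ' (by rw [hδc, ← ht, hc]) rfl
    have h3 := hf _ hrel
    rw [map_sub, sub_eq_zero] at h3
    change f (hBridge γ * hBridge δ') = f (hBridge (shortcut hac) * hBridge γ') at h3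
    rw [map_mul, ← h1, ← map_mul, ← mul_assoc, map_mul, h3, map_mul f _ (geodesic _ c), ← h2,
      ← map_mul, ← map_mul, ht, mul_assoc]

theorem map_hBridge_mul_dot (hf : ∀ r, Relation r → f r = 0) {a : Matching n} (γ : Bridge a)
    (i : Fin (2 * n)) : f (hBridge γ) * f (dot (surger γ) i) = f (dot a i) * f (hBridge γ) := by
  rw [← map_mul, ← map_mul, ← sub_eq_zero, ← map_sub]
  exact hf _ (.bridgeArc γ i)

theorem map_dot_comm (hf : ∀ r, Relation r → f r = 0) (a : Matching n) (i j : Fin (2 * n)) :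
    f (dot a i) * f (dot a j) = f (dot a j) * f (dot a i) := by
  rw [← map_mul, ← map_mul, ← sub_eq_zero, ← map_sub]
  exact hf _ (.twoArcs _ _)

theorem pairwise_commute_dot (hf : ∀ r, Relation r → f r = 0) (a c : Matching n)
    (S : Set (Circle a c)) : S.Pairwise (Function.onFun Commute fun C => f (dot a (basePoint C))) :=
  fun _ _ _ _ _ => map_dot_comm f hf a _ _

theorem map_dot_mul_geodesic (hf : ∀ r, Relation r → f r = 0) (a c : Matching n)
    (i : Fin (2 * n)) :
    f (dot a i) * f (geodesic a c) = f (geodesic a c) * f (dot c i) := by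
  induction a using geodesic_induction (c := c) with
  | base => rw [geodesic_self, ← map_mul, ← map_mul, dot_mul_idem, idem_mul_dot]
  | step a h ih =>
    rw [geodesic_of_ne h, map_mul, ← mul_assoc, ← map_hBridge_mul_dot f hf, mul_assoc, ih,
      mul_assoc]

/-- Modulo the relations, an arc of `a` times a geodesic from `a` to `c` depends only on the circle
of `W(a)c` to which the arc belongs: sliding the arc along the geodesic, one may replace it by an
arc of `c` with a common endpoint. -/
theorem map_dot_mul_geodesic_congr (hf : ∀ r, Relation r → f r = 0) {a c : Matching n}
    {i j : Fin (2 * n)} (h : component {a, c} i = component {a, c} j) :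
    f (dot a i) * f (geodesic a c) = f (dot a j) * f (geodesic a c) := by
  have key : joinSetoid {a, c} ≤ Setoid.ker fun i => f (dot a i) * f (geodesic a c) := by
    rw [joinSetoid_le_iff]
    rintro m (rfl | rfl) i
    · exact congrArg (f · * _) (dot_partner m i).symm
    · change _ = _
      simp only [map_dot_mul_geodesic f hf, dot_partner]
  exact key (component_eq_iff.1 h)

/-- The image of the basis element `(W(a)c, σ)` under the inverse of the natural map: a geodesic
times one arc on each circle with label `-`. -/
def dottedGeodesic (hf : ∀ r, Relation r → f r = 0) (a c : Matching n) (S : Set (Circle a c)) : R :=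
  S.toFinite.toFinset.noncommProd (fun C => f (dot a (basePoint C)))
    (pairwise_commute_dot f hf a c _) * f (geodesic a c)

theorem dottedGeodesic_empty (hf : ∀ r, Relation r → f r = 0) (a c : Matching n) :
    dottedGeodesic f hf a c ∅ = f (geodesic a c) :=
  (congrArg (· * _) ((Finset.noncommProd_congr (by simp) (fun _ _ => rfl) _).trans
    (Finset.noncommProd_empty _ (by simp)))).trans (one_mul _)

/-- Modulo the relations, an arc acts on dotted geodesics as on basis elements of `H^n`: it changes the
label of its circle from `+` to `-`, or it gives `0` as its square is `0`. -/
theorem map_dot_mul_dottedGeodesic (hf : ∀ r, Relation r → f r = 0) {a c : Matching n}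
    (i : Fin (2 * n)) (S : Set (Circle a c)) :
    f (dot a i) * dottedGeodesic f hf a c S = if component {a, c} i ∈ S then 0 else
      dottedGeodesic f hf a c (insert (component {a, c} i) S) := by
  -- all arcs on the same circle act in the same way
  have h1 : ∀ T : Set (Circle a c), f (dot a i) * dottedGeodesic f hf a c T
      = f (dot a (basePoint (component {a, c} i))) * dottedGeodesic f hf a c T := by
    intro T
    unfold dottedGeodesic
    have hcomm : ∀ j, Commute (f (dot a j)) (T.toFinite.toFinset.noncommProd
        (fun C => f (dot a (basePoint C))) (pairwise_commute_dot f hf a c _)) := fun j =>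
      Finset.noncommProd_commute _ _ _ _ fun C _ => map_dot_comm f hf a _ _
    rw [← mul_assoc, ← mul_assoc, (hcomm _).eq, (hcomm _).eq, mul_assoc, mul_assoc,
      map_dot_mul_geodesic_congr f hf (component_basePoint _).symm]
  have h2 : ∀ (C : Circle a c) (T : Set (Circle a c)), C ∉ T →
      f (dot a (basePoint C)) * dottedGeodesic f hf a c T = dottedGeodesic f hf a c (insert C T) := by
    intro C T hC
    unfold dottedGeodesic
    have hCT : (insert C T).toFinite.toFinset = insert C T.toFinite.toFinset := by
      ext D
      simp
    rw [← mul_assoc]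
    refine congrArg (· * _) (Eq.symm ?_)
    exact (Finset.noncommProd_congr hCT (fun _ _ => rfl) _).trans
      (Finset.noncommProd_insert_of_notMem _ _ (fun C => f (dot a (basePoint C)))
        (fun _ _ _ _ _ => map_dot_comm f hf a _ _) (by simpa using hC))
  rw [h1]
  split_ifs with h
  · obtain ⟨T, hT, rfl⟩ : ∃ T, component {a, c} i ∉ T ∧ S = insert (component {a, c} i) T :=
      ⟨S \ {component {a, c} i}, by simp, by simp [Set.insert_eq_of_mem h]⟩
    rw [← h2 _ _ hT, ← mul_assoc, ← map_mul, dot, hf _ (.arcSquare _), zero_mul]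
  · exact h2 _ _ h

theorem map_idem_mul_dottedGeodesic (hf : ∀ r, Relation r → f r = 0) (a c : Matching n)
    (S : Set (Circle a c)) :
    f (LinQuad.idem _ _ a) * dottedGeodesic f hf a c S = dottedGeodesic f hf a c S := by
  induction S, S.toFinite using Set.Finite.induction_on with
  | empty => rw [dottedGeodesic_empty, ← map_mul, idem_mul_geodesic]
  | @insert C T hC _ ih =>
    obtain ⟨i, rfl⟩ := component_surjective _ C
    have h := map_dot_mul_dottedGeodesic f hf i T
    rw [if_neg hC] at h
    rw [← h, ← mul_assoc, ← map_mul, idem_mul_dot]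

/-- The additive map `H^n → R` which inverts the natural map modulo the relations. -/
def ofArcAlgebra (hf : ∀ r, Relation r → f r = 0) : ArcAlgebra n →+ R :=
  ArcAlgebra.lift (dottedGeodesic f hf)

theorem ofArcAlgebra_basisElt (hf : ∀ r, Relation r → f r = 0) (a c : Matching n)
    (S : Set (Circle a c)) : ofArcAlgebra f hf (basisElt a c S) = dottedGeodesic f hf a c S :=
  ArcAlgebra.lift_basisElt _ _ _ _

/-- It suffices to check the `T(V)`-linearity of `ofArcAlgebra` on basis elements with the same
idempotent. -/
theorem map_mul_ofArcAlgebra_of_basis (hf : ∀ r, Relation r → f r = 0) {x : TV n} {b : Matching n}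
    (hx : x * LinQuad.idem _ _ b = x)
    (h : ∀ c S, f x * ofArcAlgebra f hf (basisElt b c S)
      = ofArcAlgebra f hf (naturalMap n x * basisElt b c S)) (y : ArcAlgebra n) :
    f x * ofArcAlgebra f hf y = ofArcAlgebra f hf (naturalMap n x * y) := by
  refine DFunLike.congr_fun (ArcAlgebra.addHom_ext
    (f := (AddMonoidHom.mulLeft (f x)).comp (ofArcAlgebra f hf))
    (g := (ofArcAlgebra f hf).comp (AddMonoidHom.mulLeft (naturalMap n x))) fun a c S => ?_) y
  change f x * ofArcAlgebra f hf (basisElt a c S)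
    = ofArcAlgebra f hf (naturalMap n x * basisElt a c S)
  by_cases hab : b = a
  · subst hab
    exact h c S
  · rw [← hx, map_mul f, map_mul (naturalMap n), naturalMap_idem, mul_assoc, ArcAlgebra.mul_assoc,
      basisElt_mul_basisElt_of_ne _ _ hab, mul_zero, map_zero, ofArcAlgebra_basisElt,
      ← map_idem_mul_dottedGeodesic, ← mul_assoc (f (LinQuad.idem _ _ b)), ← map_mul,
      LinQuad.idem_mul_idem_of_ne _ _ hab, map_zero, zero_mul, mul_zero]

theorem naturalMap_dot (a : Matching n) (i : Fin (2 * n)) :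
    naturalMap n (dot a i) = basisElt a a {component {a, a} i} :=
  naturalMap_hArc i

theorem map_dot_mul_ofArcAlgebra (hf : ∀ r, Relation r → f r = 0) (a : Matching n)
    (i : Fin (2 * n)) (y : ArcAlgebra n) :
    f (dot a i) * ofArcAlgebra f hf y = ofArcAlgebra f hf (naturalMap n (dot a i) * y) := by
  refine map_mul_ofArcAlgebra_of_basis f hf (dot_mul_idem a i) (fun c S => ?_) y
  rw [ofArcAlgebra_basisElt, map_dot_mul_dottedGeodesic, naturalMap_dot, basisElt_arc_mul]
  split_ifs
  · rw [map_zero]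
  · rw [ofArcAlgebra_basisElt]

theorem map_hBridge_mul_ofArcAlgebra_empty (hf : ∀ r, Relation r → f r = 0) {a : Matching n}
    (γ : Bridge a) (c : Matching n) :
    f (hBridge γ) * ofArcAlgebra f hf (basisElt (surger γ) c ∅)
      = ofArcAlgebra f hf (naturalMap n (hBridge γ) * basisElt (surger γ) c ∅) := by
  have hself := circles_self_surger γ
  rw [ofArcAlgebra_basisElt, dottedGeodesic_empty, naturalMap_hBridge]
  rcases circles_surger γ c with h | h
  · rw [basisElt_mul_basisElt_empty (by omega), ofArcAlgebra_basisElt, dottedGeodesic_empty,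
      ← map_mul, map_hBridge_mul_geodesic f hf γ h]
  · -- the geodesic from `surger γ` to `c` may be chosen to begin with the dual of `γ`
    obtain ⟨γd, hd⟩ := exists_dual_bridge γ
    have h1 := map_hBridge_mul_geodesic f hf γd (c := c) (by rw [hd]; exact h.symm)
    have h2 := hf _ (.dualBridge γ γd hd)
    rw [sub_sub, map_sub, sub_eq_zero, map_add] at h2
    have h3 := map_dot_mul_ofArcAlgebra f hf a γ.fst.left (basisElt a c ∅)
    have h4 := map_dot_mul_ofArcAlgebra f hf a γ.snd.left (basisElt a c ∅)
    rw [naturalMap_dot, ofArcAlgebra_basisElt, dottedGeodesic_empty, dot, arcThrough_left] at h3 h4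
    rw [← h1, ← map_mul, ← mul_assoc, map_mul, h2, hd, add_mul, h3, h4, ← map_add, ← add_mul,
      ← basisElt_mul_dual, ArcAlgebra.mul_assoc, basisElt_mul_basisElt_empty (a := surger γ)]
    rw [circles_comm _ a]
    omega

theorem map_hBridge_mul_ofArcAlgebra (hf : ∀ r, Relation r → f r = 0) {a : Matching n}
    (γ : Bridge a) (y : ArcAlgebra n) :
    f (hBridge γ) * ofArcAlgebra f hf y = ofArcAlgebra f hf (naturalMap n (hBridge γ) * y) := by
  refine map_mul_ofArcAlgebra_of_basis f hf (hBridge_mul_idem γ) (fun c S => ?_) y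
  induction S, S.toFinite using Set.Finite.induction_on with
  | empty => exact map_hBridge_mul_ofArcAlgebra_empty f hf γ c
  | @insert C T hC _ ih =>
    obtain ⟨i, rfl⟩ := component_surjective _ C
    have h := basisElt_arc_mul (a := surger γ) i T
    rw [if_neg hC, ← naturalMap_dot] at h
    have hrel := naturalMap_eq_zero_of_relation (.bridgeArc γ i)
    rw [map_sub, sub_eq_zero, map_mul, map_mul] at hrel
    change naturalMap n (hBridge γ) * naturalMap n (dot (surger γ) i)
      = naturalMap n (dot a i) * naturalMap n (hBridge γ) at hrel
    rw [← h, ← map_dot_mul_ofArcAlgebra, ← mul_assoc, map_hBridge_mul_dot f hf, mul_assoc, ih,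
      map_dot_mul_ofArcAlgebra, ← ArcAlgebra.mul_assoc, ← hrel, ArcAlgebra.mul_assoc]

theorem naturalMap_one : naturalMap n 1 = ofIdempotents 1 := by
  let _ := arcRing n
  exact map_one (naturalRingHom n)

/-- The additive map `ofArcAlgebra` is linear over `T(V)`. This is checked on the generators of `T(V)`. -/
theorem map_mul_ofArcAlgebra (hf : ∀ r, Relation r → f r = 0) (x : TV n) :
    ∀ y, f x * ofArcAlgebra f hf y = ofArcAlgebra f hf (naturalMap n x * y) := by
  let A : Subring (TV n) :=
    { carrier := {x | ∀ y, f x * ofArcAlgebra f hf y = ofArcAlgebra f hf (naturalMap n x * y)}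
      mul_mem' := fun {x y} hx hy z => by
        rw [map_mul f, mul_assoc, hy, hx, map_mul (naturalMap n), ArcAlgebra.mul_assoc]
      one_mem' := fun z => by
        rw [map_one, one_mul, naturalMap_one, ofIdempotents_one_mul]
      add_mem' := fun {x y} hx hy z => by
        rw [map_add, add_mul, hy, hx, map_add, add_mul, map_add]
      zero_mem' := fun z => by
        rw [map_zero, zero_mul, map_zero, zero_mul, map_zero]
      neg_mem' := fun {x} hx z => by
        rw [map_neg, neg_mul, hx, map_neg, neg_mul, map_neg] }
  refine LinQuad.mem_of_subring _ _ A (fun e => ?_) (fun g => ?_) x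
  · refine map_mul_ofArcAlgebra_of_basis f hf (LinQuad.idem_mul_idem _ _ e) (fun c S => ?_)
    rw [ofArcAlgebra_basisElt, map_idem_mul_dottedGeodesic, naturalMap_idem, basisElt_idem_mul,
      ofArcAlgebra_basisElt]
  · cases g with
    | bridge a γ => exact map_hBridge_mul_ofArcAlgebra f hf γ
    | arc a α =>
      have := map_dot_mul_ofArcAlgebra f hf a α.left
      rw [dot, arcThrough_left] at this
      exact this

/-- The natural map is injective modulo the relations. -/
theorem ofArcAlgebra_naturalMap (hf : ∀ r, Relation r → f r = 0) (x : TV n) :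
    ofArcAlgebra f hf (naturalMap n x) = f x := by
  have h := map_mul_ofArcAlgebra f hf x (ofIdempotents 1)
  rw [mul_ofIdempotents_one] at h
  rw [← h]
  have : ofArcAlgebra f hf (ofIdempotents 1) = 1 := by
    unfold ofIdempotents
    rw [map_sum, ← map_one f, ← LinQuad.sum_idem Gen.left Gen.right, map_sum]
    refine Finset.sum_congr rfl fun a _ => ?_
    rw [Pi.one_apply, one_smul, ofArcAlgebra_basisElt, dottedGeodesic_empty, geodesic_self]
  rw [this, mul_one]

end Presented

/-- The basis element `(W(a)c, σ)` is the product of a geodesic and of one arc on each circle with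
label `-`. -/
theorem basisElt_mem_range (a c : Matching n) (S : Set (Circle a c)) :
    ∃ x, naturalMap n x = basisElt a c S := by
  induction S, S.toFinite using Set.Finite.induction_on with
  | empty => exact ⟨_, naturalMap_geodesic a c⟩
  | @insert C T hC _ ih =>
    obtain ⟨i, rfl⟩ := component_surjective _ C
    obtain ⟨x, hx⟩ := ih
    refine ⟨dot a i * x, ?_⟩
    rw [map_mul, hx, naturalMap_dot, basisElt_arc_mul, if_neg hC]

theorem naturalMap_surjective : Function.Surjective (naturalMap n) := by
  intro x
  choose g hg using basisElt_mem_range (n := n)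
  refine ⟨ArcAlgebra.lift g x, DFunLike.congr_fun (ArcAlgebra.addHom_ext
    (f := (naturalMap n : TV n →+ ArcAlgebra n).comp (ArcAlgebra.lift g))
    (g := AddMonoidHom.id _) fun a c S => ?_) x⟩
  change naturalMap n (ArcAlgebra.lift g (basisElt a c S)) = basisElt a c S
  rw [ArcAlgebra.lift_basisElt, hg]

/-! ### The linear-quadratic part of the kernel -/

/-- The additive group generated by the explicit relations. -/
def relationGroup (n : ℕ) : AddSubgroup (TV n) := AddSubgroup.closure {r | Relation r}

theorem Relation.mem {r : TV n} (h : Relation r) : r ∈ relationGroup n :=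
  AddSubgroup.subset_closure h

/-- Modulo the relations, a product of two bridges from `a` to `c ≠ a` may begin with any given
bridge which belongs to a shortcut. -/
theorem exists_sub_mem_relationGroup {a c : Matching n} (hc : circles a c + 2 = n)
    {p q : Fin (2 * n)} (h : IsShortcut a c p q) {δ : Bridge a} (hδ : δ.Joins p q)
    (γ : Bridge a) (η : Bridge (surger γ)) (hη : surger η = c) :
    ∃ δ' : Bridge (surger δ), surger δ' = c ∧
      hBridge γ * hBridge η - hBridge δ * hBridge δ' ∈ relationGroup n := by
  by_cases hne : γ = δ
  · subst hne
    exact ⟨η, hη, by rw [sub_self]; exact zero_mem _⟩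
  have h1 := circles_self_surger η
  obtain ⟨δ', γ', ht, hc', hrel⟩ := exists_square h hδ (γ := γ) (by rw [← hη] at hc ⊢; omega) hne
  have h2 : surger δ' = c := eq_of_circles (by omega)
  obtain rfl : δ' = η := surger_injective (h2.trans hη.symm)
  exact ⟨γ', by rw [← ht, h2], hrel.mem⟩

/-- Modulo the relations, a product of two bridges from `a` to `c ≠ a` depends only on `a` and `c`. -/
theorem hBridge_mul_hBridge_sub_mem {a c : Matching n} (hc : circles a c + 2 = n)
    {γ γ' : Bridge a} {η : Bridge (surger γ)} {η' : Bridge (surger γ')} (hη : surger η = c)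
    (hη' : surger η' = c) :
    hBridge γ * hBridge η - hBridge γ' * hBridge η' ∈ relationGroup n := by
  have hac : a ≠ c := by
    rintro rfl
    rw [circles_self] at hc
    omega
  obtain ⟨δ, p, q, hpq, hδ⟩ := exists_shortcut_bridge hac
  obtain ⟨δ₁, h1, hm1⟩ := exists_sub_mem_relationGroup hc hpq hδ γ η hη
  obtain ⟨δ₂, h2, hm2⟩ := exists_sub_mem_relationGroup hc hpq hδ γ' η' hη'
  obtain rfl : δ₁ = δ₂ := surger_injective (h1.trans h2.symm)
  have := sub_mem hm1 hm2
  rwa [sub_sub_sub_cancel_right] at this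

theorem hBridge_mul_dot_sub_mem {a : Matching n} (γ : Bridge a) (i : Fin (2 * n)) :
    hBridge γ * dot (surger γ) i - dot a i * hBridge γ ∈ relationGroup n :=
  (Relation.bridgeArc γ i).mem

/-- Modulo the relations, an arc of `a` times `h_γ` depends only on the circle of `W(a)a_γ` to
which the arc belongs. -/
theorem dot_mul_hBridge_sub_mem {a : Matching n} (γ : Bridge a) {i j : Fin (2 * n)}
    (h : component {a, surger γ} i = component {a, surger γ} j) :
    dot a i * hBridge γ - dot a j * hBridge γ ∈ relationGroup n := by
  let r : Setoid (Fin (2 * n)) :=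
    { r := fun i j => dot a i * hBridge γ - dot a j * hBridge γ ∈ relationGroup n
      iseqv :=
        { refl := fun i => by rw [sub_self]; exact zero_mem _
          symm := fun {i j} h => by rw [← neg_sub]; exact neg_mem h
          trans := fun {i j k} h h' => by
            have := add_mem h h'
            rwa [sub_add_sub_cancel] at this } }
  have key : joinSetoid {a, surger γ} ≤ r := by
    rw [joinSetoid_le_iff]
    rintro m (rfl | rfl) i
    · change dot m i * hBridge γ - dot m (m.partner i) * hBridge γ ∈ _
      rw [dot_partner, sub_self]
      exact zero_mem _
    · change dot a i * hBridge γ - dot a ((surger γ).partner i) * hBridge γ ∈ _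
      have h1 := hBridge_mul_dot_sub_mem γ i
      have h2 := hBridge_mul_dot_sub_mem γ ((surger γ).partner i)
      rw [dot_partner] at h2
      have := sub_mem h2 h1
      rwa [sub_sub_sub_cancel_left] at this
  exact key (component_eq_iff.1 h)

theorem dot_eq_of_component {a : Matching n} {i j : Fin (2 * n)}
    (h : component {a, a} i = component {a, a} j) : dot a i = dot a j :=
  congrArg hArc (arcThrough_eq_iff.2 (component_self_eq_iff.1 h))

/-- The element `x` of `T(V)` is a generator or (modulo the relations) a product of two generators,
of one of the five types `h_γ`, `h_α`, `h_γ h_η`, `h_α h_γ`, `h_α h_β`, and the natural map sends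
it to the basis element `(W(a)c, σ)` with `σ = -` exactly on `S`. The types are told apart by the
numbers of circles and of minus signs. -/
def Represents (a c : Matching n) (S : Set (Circle a c)) (x : TV n) : Prop :=
  (circles a c + 1 = n ∧ S.ncard = 0 ∧ ∃ γ : Bridge a, surger γ = c ∧ x = hBridge γ) ∨
  (circles a c = n ∧ S.ncard = 1 ∧ ∃ i, S = {component {a, c} i} ∧ x = dot a i) ∨
  (circles a c + 2 = n ∧ S.ncard = 0 ∧ ∃ (γ : Bridge a) (η : Bridge (surger γ)), surger η = c ∧
    x = hBridge γ * hBridge η) ∨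
  (circles a c + 1 = n ∧ S.ncard = 1 ∧ ∃ (γ : Bridge a) (i : Fin (2 * n)), surger γ = c ∧
    S = {component {a, c} i} ∧ x - dot a i * hBridge γ ∈ relationGroup n) ∨
  (circles a c = n ∧ S.ncard = 2 ∧ ∃ i j, S = {component {a, c} i, component {a, c} j} ∧
    x = dot a i * dot a j)

theorem Represents.sub_mem {a c : Matching n} {S : Set (Circle a c)} {x y : TV n}
    (hx : Represents a c S x) (hy : Represents a c S y) : x - y ∈ relationGroup n := by
  rcases hx with ⟨h1, h2, hx⟩ | ⟨h1, h2, hx⟩ | ⟨h1, h2, hx⟩ | ⟨h1, h2, hx⟩ | ⟨h1, h2, hx⟩ <;>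
    rcases hy with ⟨k1, k2, hy⟩ | ⟨k1, k2, hy⟩ | ⟨k1, k2, hy⟩ | ⟨k1, k2, hy⟩ | ⟨k1, k2, hy⟩ <;>
    first | (exfalso; omega) | skip
  · obtain ⟨γ, rfl, rfl⟩ := hx
    obtain ⟨η, hη, rfl⟩ := hy
    rw [surger_injective hη, sub_self]
    exact zero_mem _
  · obtain rfl := eq_of_circles h1
    obtain ⟨i, rfl, rfl⟩ := hx
    obtain ⟨j, hj, rfl⟩ := hy
    rw [dot_eq_of_component (Set.singleton_injective hj), sub_self]
    exact zero_mem _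
  · obtain ⟨γ, η, hη, rfl⟩ := hx
    obtain ⟨γ', η', hη', rfl⟩ := hy
    exact hBridge_mul_hBridge_sub_mem h1 hη hη'
  · obtain ⟨γ, i, rfl, rfl, hx⟩ := hx
    obtain ⟨η, j, hη, hj, hy⟩ := hy
    obtain rfl := surger_injective hη
    have h3 := dot_mul_hBridge_sub_mem η (Set.singleton_injective hj)
    have h4 := AddSubgroup.add_mem _ (AddSubgroup.sub_mem _ hx hy) h3
    convert h4 using 1
    abel
  · obtain rfl := eq_of_circles h1
    obtain ⟨i, j, rfl, rfl⟩ := hx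
    obtain ⟨k, l, hkl, rfl⟩ := hy
    rcases Set.pair_eq_pair_iff.1 hkl with ⟨h3, h4⟩ | ⟨h3, h4⟩
    · rw [dot_eq_of_component h3, dot_eq_of_component h4, sub_self]
      exact zero_mem _
    · rw [dot_eq_of_component h3, dot_eq_of_component h4]
      exact (Relation.twoArcs _ _).mem

/-- An additive choice of preimages in `V ⊕ V ⊗ V` of the elements of `H^n`. It is `0` on the basis
elements which are not the image of a generator or of a product of two generators. -/
def linQuadLift (n : ℕ) : ArcAlgebra n →+ TV n :=
  ArcAlgebra.lift fun a c S => if h : ∃ x, Represents a c S x then h.choose else 0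

/-- The elements of `T(V)` which agree with the chosen lift of their image in `H^n` up to the
relations. -/
def linQuadLiftGroup (n : ℕ) : AddSubgroup (TV n) :=
  (relationGroup n).comap (AddMonoidHom.id (TV n) -
    (linQuadLift n).comp (naturalMap n : TV n →+ ArcAlgebra n))

theorem mem_linQuadLiftGroup {x : TV n} :
    x ∈ linQuadLiftGroup n ↔ x - linQuadLift n (naturalMap n x) ∈ relationGroup n :=
  Iff.rfl

theorem naturalMap_eq_zero_of_mem {r : TV n} (h : r ∈ relationGroup n) : naturalMap n r = 0 := by
  induction h using AddSubgroup.closure_induction with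
  | mem r h => exact naturalMap_eq_zero_of_relation h
  | zero => exact map_zero _
  | add x y _ _ hx hy => rw [map_add, hx, hy, add_zero]
  | neg x _ hx =>
    have := map_add (naturalMap n) x (-x)
    rwa [add_neg_cancel, map_zero, hx, zero_add, eq_comm] at this

theorem relationGroup_le : relationGroup n ≤ linQuadLiftGroup n := fun r h => by
  rw [mem_linQuadLiftGroup, naturalMap_eq_zero_of_mem h, map_zero, sub_zero]
  exact h

theorem Represents.mem {a c : Matching n} {S : Set (Circle a c)} {x : TV n}
    (h : Represents a c S x) (hx : naturalMap n x = basisElt a c S) : x ∈ linQuadLiftGroup n := by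
  have hex : ∃ x, Represents a c S x := ⟨x, h⟩
  rw [mem_linQuadLiftGroup, hx, linQuadLift, ArcAlgebra.lift_basisElt, dif_pos hex]
  exact h.sub_mem hex.choose_spec

theorem hBridge_mem {a : Matching n} (γ : Bridge a) : hBridge γ ∈ linQuadLiftGroup n :=
  Represents.mem (Or.inl ⟨circles_self_surger γ, Set.ncard_empty _, γ, rfl, rfl⟩)
    (naturalMap_hBridge γ)

theorem dot_mem (a : Matching n) (i : Fin (2 * n)) : dot a i ∈ linQuadLiftGroup n :=
  Represents.mem (Or.inr (Or.inl ⟨circles_self a, Set.ncard_singleton _, i, rfl, rfl⟩))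
    (naturalMap_dot a i)

theorem hBridge_mul_hBridge_mem {a : Matching n} (γ : Bridge a) (η : Bridge (surger γ)) :
    hBridge γ * hBridge η ∈ linQuadLiftGroup n := by
  by_cases h : surger η = a
  · have h1 := relationGroup_le (Relation.dualBridge γ η h).mem
    have h2 := dot_mem a γ.fst.left
    have h3 := dot_mem a γ.snd.left
    rw [dot, arcThrough_left] at h2 h3
    have h4 := add_mem (add_mem h1 h3) h2
    rwa [sub_add_cancel, sub_add_cancel] at h4
  · exact Represents.mem (Or.inr (Or.inr (Or.inl
      ⟨circles_surger_surger h, Set.ncard_empty _, γ, η, rfl, rfl⟩))) (hBridge_mul_hBridge h)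

theorem dot_mul_hBridge_mem {a : Matching n} (γ : Bridge a) (i : Fin (2 * n)) :
    dot a i * hBridge γ ∈ linQuadLiftGroup n := by
  refine Represents.mem (a := a) (c := surger γ) (S := {component _ i})
    (Or.inr (Or.inr (Or.inr (Or.inl ⟨circles_self_surger γ, Set.ncard_singleton _, γ, i, rfl, rfl,
      by rw [sub_self]; exact zero_mem _⟩)))) ?_
  rw [map_mul, naturalMap_dot, naturalMap_hBridge, basisElt_arc_mul, if_neg (Set.notMem_empty _),
    insert_empty_eq]

theorem hBridge_mul_dot_mem {a : Matching n} (γ : Bridge a) (i : Fin (2 * n)) :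
    hBridge γ * dot (surger γ) i ∈ linQuadLiftGroup n := by
  have := add_mem (relationGroup_le (hBridge_mul_dot_sub_mem γ i)) (dot_mul_hBridge_mem γ i)
  rwa [sub_add_cancel] at this

theorem dot_mul_dot_mem (a : Matching n) (i j : Fin (2 * n)) :
    dot a i * dot a j ∈ linQuadLiftGroup n := by
  by_cases h : component {a, a} i = component {a, a} j
  · rw [dot_eq_of_component h]
    exact relationGroup_le (Relation.arcSquare _).mem
  · refine Represents.mem (Or.inr (Or.inr (Or.inr (Or.inr
      ⟨circles_self a, Set.ncard_pair h, i, j, rfl, rfl⟩)))) ?_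
    rw [map_mul, naturalMap_dot, naturalMap_dot, basisElt_arc_mul, if_neg (by simpa using h)]

theorem dot_left {a : Matching n} (α : Arc a) : dot a α.left = hArc α := by
  rw [dot, arcThrough_left]

/-- A generator or a product of two generators is, up to the relations, a sum of chosen lifts; hence an
element of `V ⊕ V ⊗ V` with image `0` is a sum of relations. -/
theorem linear_sup_quadratic_le :
    LinQuad.linearPart Gen.left Gen.right ⊔ LinQuad.quadraticPart Gen.left Gen.right
      ≤ linQuadLiftGroup n := by
  refine sup_le ((AddSubgroup.closure_le _).2 ?_) ((AddSubgroup.closure_le _).2 ?_)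
  · rintro _ ⟨g, rfl⟩
    cases g with
    | bridge a γ => exact hBridge_mem γ
    | arc a α =>
      change hArc α ∈ linQuadLiftGroup n
      rw [← dot_left]
      exact dot_mem a α.left
  · rintro _ ⟨g, h, rfl⟩
    by_cases hne : g.right = h.left
    · cases g with
      | bridge a γ =>
        cases h with
        | bridge b η =>
          obtain rfl : surger γ = b := hne
          exact hBridge_mul_hBridge_mem γ η
        | arc b β =>
          obtain rfl : surger γ = b := hne
          change hBridge γ * hArc β ∈ linQuadLiftGroup n
          rw [← dot_left]
          exact hBridge_mul_dot_mem γ β.left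
      | arc a α =>
        cases h with
        | bridge b η =>
          obtain rfl : a = b := hne
          change hArc α * hBridge η ∈ linQuadLiftGroup n
          rw [← dot_left]
          exact dot_mul_hBridge_mem η α.left
        | arc b β =>
          obtain rfl : a = b := hne
          change hArc α * hArc β ∈ linQuadLiftGroup n
          rw [← dot_left, ← dot_left]
          exact dot_mul_dot_mem a α.left β.left
    · rw [LinQuad.gen_mul_gen_of_ne _ _ hne]
      exact zero_mem _

theorem relationGroup_le_linear_sup_quadratic : relationGroup n ≤
    LinQuad.linearPart Gen.left Gen.right ⊔ LinQuad.quadraticPart Gen.left Gen.right := by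
  have hl : ∀ g : Gen n, LinQuad.gen Gen.left Gen.right g ∈
      LinQuad.linearPart Gen.left Gen.right ⊔ LinQuad.quadraticPart Gen.left Gen.right :=
    fun g => AddSubgroup.mem_sup_left (AddSubgroup.subset_closure ⟨g, rfl⟩)
  have hq : ∀ g h : Gen n, LinQuad.gen Gen.left Gen.right g * LinQuad.gen Gen.left Gen.right h ∈
      LinQuad.linearPart Gen.left Gen.right ⊔ LinQuad.quadraticPart Gen.left Gen.right :=
    fun g h => AddSubgroup.mem_sup_right (AddSubgroup.subset_closure ⟨g, h, rfl⟩)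
  refine (AddSubgroup.closure_le _).2 fun r h => ?_
  induction h with
  | twoBridges => exact sub_mem (hq _ _) (hq _ _)
  | bridgeArc => exact sub_mem (hq _ _) (hq _ _)
  | twoArcs => exact sub_mem (hq _ _) (hq _ _)
  | arcSquare => exact hq _ _
  | dualBridge => exact sub_mem (sub_mem (hq _ _) (hl _)) (hl _)

theorem linQuadRelations_naturalMap :
    LinQuad.linQuadRelations (naturalMap n) = (relationGroup n : Set (TV n)) := by
  ext x
  constructor
  · rintro ⟨h0, hx⟩
    have := linear_sup_quadratic_le hx
    rwa [mem_linQuadLiftGroup, h0, map_zero, sub_zero] at this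
  · exact fun h => ⟨naturalMap_eq_zero_of_mem h, relationGroup_le_linear_sup_quadratic h⟩

theorem Gen.toArcAlgebra_injective : Function.Injective (Gen.toArcAlgebra (n := n)) := by
  have key : ∀ {a c a' c' : Matching n} {S : Set (Circle a c)} {S' : Set (Circle a' c')},
      basisElt a c S = basisElt a' c' S' → a = a' ∧ c = c' := by
    intro a c a' c' S S' h
    by_contra hne
    have h1 := congrFun (congrFun (congrFun h a) c) S
    rw [basisElt_apply, if_pos rfl, basisElt_apply_of_ne _ _ (by tauto)] at h1
    exact one_ne_zero h1
  rintro (⟨a, γ⟩ | ⟨a, α⟩) (⟨b, η⟩ | ⟨b, β⟩) h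
  · obtain ⟨rfl, h2⟩ := key h
    rw [surger_injective h2]
  · obtain ⟨rfl, h2⟩ := key h
    exact absurd h2 (surger_ne γ)
  · obtain ⟨rfl, h2⟩ := key h
    exact absurd h2.symm (surger_ne η)
  · obtain ⟨rfl, -⟩ := key h
    have h1 := congrFun (congrFun (congrFun h a) a) {component {a, a} α.left}
    change basisElt a a _ a a _ = basisElt a a _ a a _ at h1
    rw [basisElt_apply, basisElt_apply, if_pos rfl] at h1
    have h2 : ({component {a, a} α.left} : Set (Circle a a)) = {component {a, a} β.left} := by
      by_contra hne
      rw [if_neg hne] at h1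
      exact one_ne_zero h1
    have h3 := arcThrough_eq_iff.2 (component_self_eq_iff.1 (Set.singleton_injective h2))
    rw [arcThrough_left, arcThrough_left] at h3
    rw [h3]

/-- The generators map to distinct basis elements, so the natural map is injective on `V`. -/
theorem eq_zero_of_mem_linearPart {x : TV n}
    (hx : x ∈ LinQuad.linearPart (Gen.left (n := n)) Gen.right) (h0 : naturalMap n x = 0) :
    x = 0 := by
  let ψ : ArcAlgebra n →+ TV n := ArcAlgebra.lift fun a c S =>
    if h : ∃ g : Gen n, g.toArcAlgebra = basisElt a c S then LinQuad.gen _ _ h.choose else 0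
  have hψ : LinQuad.linearPart Gen.left Gen.right ≤
      (ψ.comp (naturalMap n : TV n →+ ArcAlgebra n)).eqLocus (AddMonoidHom.id _) := by
    refine (AddSubgroup.closure_le _).2 ?_
    rintro _ ⟨g, rfl⟩
    obtain ⟨S, hS, -⟩ := g.toArcAlgebra_eq
    have hex : ∃ g : Gen n, g.toArcAlgebra = basisElt _ _ S := ⟨g, hS⟩
    change ψ (naturalMap n _) = _
    rw [naturalMap_gen, hS, ArcAlgebra.lift_basisElt, dif_pos hex]
    exact congrArg _ (Gen.toArcAlgebra_injective (hex.choose_spec.trans hS.symm))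
  have h : ψ (naturalMap n x) = x := hψ hx
  rw [← h, h0, map_zero]

/-! ### The presentation -/

/-- The natural map is injective modulo the ideal generated by the relations: `ofArcAlgebra_naturalMap`
is applied to the projection onto the quotient of `T(V)` by this ideal. -/
theorem mem_span_relation {x : TV n} (h : naturalMap n x = 0) :
    x ∈ TwoSidedIdeal.span {r : TV n | Relation r} := by
  have hf : ∀ r : TV n, Relation r →
      (TwoSidedIdeal.span {r : TV n | Relation r}).ringCon.mk' r = 0 := fun r hr =>
    (RingCon.eq _).2 (TwoSidedIdeal.subset_span hr)
  have := ofArcAlgebra_naturalMap _ hf x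
  rw [h, map_zero] at this
  exact (RingCon.eq _).1 this.symm

theorem naturalMap_eq_zero_iff {x : TV n} :
    naturalMap n x = 0 ↔ x ∈ TwoSidedIdeal.span {r : TV n | Relation r} := by
  refine ⟨mem_span_relation, fun h => ?_⟩
  have : TwoSidedIdeal.span {r : TV n | Relation r} ≤ TwoSidedIdeal.ker (naturalMap n) :=
    TwoSidedIdeal.span_le.2 fun r hr =>
      (TwoSidedIdeal.mem_ker _).2 (naturalMap_eq_zero_of_relation hr)
  exact (TwoSidedIdeal.mem_ker _).1 (this h)

theorem naturalMap_eq_iff {x y : TV n} : naturalMap n x = naturalMap n y ↔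
    (TwoSidedIdeal.span {r : TV n | Relation r}).ringCon x y := by
  rw [TwoSidedIdeal.rel_iff, ← naturalMap_eq_zero_iff, map_sub, sub_eq_zero]

theorem isLinearQuadratic : LinQuad.IsLinearQuadratic ofIdempotents augmentation
    Gen.toArcAlgebra (naturalMap n) where
  toIsAugmentedAlgebra := isAugmentedAlgebra
  left_idem := left_idem_toArcAlgebra
  right_idem := right_idem_toArcAlgebra
  aug_gen := augmentation_toArcAlgebra
  map_idem e := by rw [naturalMap_idem, ofIdempotents_single]
  map_gen := naturalMap_gen
  surjective := naturalMap_surjective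
  ker_eq := by
    refine le_antisymm (fun x hx => ?_) (TwoSidedIdeal.span_le.2 fun x hx =>
      (TwoSidedIdeal.mem_ker _).2 hx.1)
    refine TwoSidedIdeal.span_mono ?_ (mem_span_relation ((TwoSidedIdeal.mem_ker _).1 hx))
    rw [linQuadRelations_naturalMap]
    exact fun r hr => Relation.mem hr
  ker_inf_linear _ hx h := eq_zero_of_mem_linearPart hx h

/-- The isomorphism `T(V)/(J₂) ≅ H^n` induced by the natural map. -/
def presentation (n : ℕ) :
    (TwoSidedIdeal.span {r : TV n | Relation r}).ringCon.Quotient ≃+* ArcAlgebra n where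
  toFun := Quotient.lift (naturalMap n) fun _ _ h => naturalMap_eq_iff.2 h
  invFun x := ((naturalMap_surjective x).choose : TV n)
  left_inv x := by
    induction x using Quotient.inductionOn with
    | _ x => exact (RingCon.eq _).2 (naturalMap_eq_iff.1 (naturalMap_surjective _).choose_spec)
  right_inv x := (naturalMap_surjective x).choose_spec
  map_mul' x y := Quotient.inductionOn₂ x y fun x y => map_mul (naturalMap n) x y
  map_add' x y := Quotient.inductionOn₂ x y fun x y => map_add (naturalMap n) x y

end KhovanovArc

end

theorem mainTheorem4 (n : ℕ) :
    ∃ (ε : KhovanovArc.ArcAlgebra n → (KhovanovArc.Matching n → ℤ))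
      (π : KhovanovArc.TV n →ₙ+* KhovanovArc.ArcAlgebra n),
      (∀ x, KhovanovArc.ofIdempotents (ε x) = KhovanovArc.degreeZeroPart x) ∧
      LinQuad.IsLinearQuadratic KhovanovArc.ofIdempotents ε KhovanovArc.Gen.toArcAlgebra π ∧
      LinQuad.linQuadRelations π =
        (AddSubgroup.closure {r : KhovanovArc.TV n | KhovanovArc.Relation r} :
          Set (KhovanovArc.TV n)) ∧
      ∃ φ : (TwoSidedIdeal.span
          {r : KhovanovArc.TV n | KhovanovArc.Relation r}).ringCon.Quotient ≃+*
          KhovanovArc.ArcAlgebra n,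
        ∀ x : KhovanovArc.TV n, φ x = π x :=
  ⟨KhovanovArc.augmentation, KhovanovArc.naturalMap n, KhovanovArc.ofIdempotents_augmentation,
    KhovanovArc.isLinearQuadratic, KhovanovArc.linQuadRelations_naturalMap,
    KhovanovArc.presentation n, fun _ => rfl⟩
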